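/- Fix integers $r,s\ge 1$ and put $d=r+s$. An observation is $z=(x,y)\in\mathbb R^r\times\mathbb R^s$. Write $u\preceq v$ if $u_j\le v_j$ for all coordinates $j$, and $u\prec v$ if $u_j<v_j$ for all $j$. For $\sigma\in S_m$ and $w=(w^1,\dots,w^m)$ let $\sigma w=(w^{\sigma^{-1}(1)},\dots,w^{\sigma^{-1}(m)})$, and for $m\ge 4$ let $H=\langle(1\,4),(2\,3)\rangle\le S_m$. For $\{0,1\}$-valued functions $I_X$ on $(\mathbb R^r)^m$ and $I_Y$ on $(\mathbb R^s)^m$ and $c>0$ let $$k(z^1,\dots,z^m)=\Big(\sum_{\sigma\in H}\operatorname{sign}(\sigma)I_X(\sigma x)\Big)\Big(\sum_{\sigma\in H}\operatorname{sign}(\sigma)I_Y(\sigma y)\Big),\qquad \kappa(z)=\frac1{m!}\sum_{\gamma\in S_m}k(\gamma z),$$ and for a sample $z^1,\dots,z^n$ with $n\ge m$ consider the U-statistic $$U=\binom nm^{-1}\sum_{1\le i_1<\dots<i_m\le n}c\,\kappa(z^{i_1},\dots,z^{i_m}).$$ * $U_D$: $m=5$, $c=\frac14$, and $I_X,I_Y$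 are the indicator of "$w^1,w^2\preceq w^5$ and $w^3\not\preceq w^5$, $w^4\not\preceq w^5$". * $U_R$: $m=d+4$, $c=\frac14$, and $I_X$, $I_Y$ are the indicators of "$w^1,w^2\preceq v$ and $w^3\not\preceq v$, $w^4\not\preceq v$", where $v_j=w^{4+j}_j$ ($1\le j\le r$) for $I_X$ and $v_j=w^{4+r+j}_j$ ($1\le j\le s$) for $I_Y$. * $U_{\tau^*_P}$: $m=4$, $c=1$, and $I_X,I_Y$ are the indicator of "$w^a\not\preceq w^b$ for all $a\in\{3,4\}$, $b\in\{1,2\}$". * $U_{\tau^*_J}$: $m=4$, $c=1$, and $I_X,I_Y$ are the indicator of "$w^b\prec w^a$ for all $a\in\{3,4\}$, $b\in\{1,2\}$". Time is the number of steps on a unit-cost real RAM: it has indirectly addressed memory cells for natural numbers (addition, truncated subtraction, comparison) and for real numbers ($+,-,\times,\div$, comparison), there is no rounding of reals to integers, and the input consists of $n$ and the $nd$ real coordinates of the sample. For fixed $(r,s)$, a program computes $U$ in time $O(T(n))$ if for some constant $C$ it halts, for every $n\ge m$ and every sample in $(\mathbb R^{d})^n$, with the exact value of $U$ after at most $C\,T(n)$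 steps; the program and $C$ may depend on $r,s$ only. **Proposition.** There are programs that compute 1. $U_D$ in time $O(n(\log_2 n)^{d-1})$; 2. $U_R$ in time $O(n^d)$; 3. $U_{\tau^*_P}$ in time $O(n^2(\log_2 n)^{2d-1})$; 4. $U_{\tau^*_J}$ in time $O(n^2(\log_2 n)^{2d-1})$. The naive programs, which run through all $i_1<\dots<i_m$ in $m$ nested loops, evaluate $c\,\kappa$ from its definition at each of them and average, compute $U_D$ in time $O(n^5)$, $U_R$ in time $O(n^{4+d})$, and $U_{\tau^*_P}$ and $U_{\tau^*_J}$ in time $O(n^4)$. -/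

import Mathlib

namespace RankCov

/-! ## Symmetric rank covariance kernels and their U-statistics -/

/-- The left action of the symmetric group on tuples:
`σ (w¹, …, wᵐ) = (w^{σ⁻¹(1)}, …, w^{σ⁻¹(m)})`. -/
def permute {m : ℕ} {α : Type*} (σ : Equiv.Perm (Fin m)) (w : Fin m → α) : Fin m → α :=
  fun i => w (σ⁻¹ i)

/-- The elements of a subgroup of a finite symmetric group, as a finset. -/
noncomputable def elems {m : ℕ} (H : Subgroup (Equiv.Perm (Fin m))) :
    Finset (Equiv.Perm (Fin m)) :=
  open Classical in Finset.univ.filter (fun σ => σ ∈ H)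

/-- The `0/1` indicator of a proposition. -/
noncomputable def ind (p : Prop) : ℝ := open Classical in if p then 1 else 0

/-- An observation `z = (x, y)` with `x ∈ ℝʳ` and `y ∈ ℝˢ`. -/
abbrev Obs (r s : ℕ) : Type := (Fin r → ℝ) × (Fin s → ℝ)

/-- The unsymmetrised kernel
`k(z) = (∑_{σ ∈ H} sign(σ) I_X(σ x)) (∑_{σ ∈ H} sign(σ) I_Y(σ y))`. -/
noncomputable def kernel {m r s : ℕ} (H : Subgroup (Equiv.Perm (Fin m)))
    (IX : (Fin m → Fin r → ℝ) → Prop) (IY : (Fin m → Fin s → ℝ) → Prop)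
    (z : Fin m → Obs r s) : ℝ :=
  (∑ σ ∈ elems H, ((Equiv.Perm.sign σ : ℤ) : ℝ) * ind (IX (permute σ fun i => (z i).1))) *
  (∑ σ ∈ elems H, ((Equiv.Perm.sign σ : ℤ) : ℝ) * ind (IY (permute σ fun i => (z i).2)))

/-- The symmetrised kernel `κ(z) = (1/m!) ∑_{γ ∈ S_m} k(γ z)`. -/
noncomputable def symKernel {m r s : ℕ} (H : Subgroup (Equiv.Perm (Fin m)))
    (IX : (Fin m → Fin r → ℝ) → Prop) (IY : (Fin m → Fin s → ℝ) → Prop)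
    (z : Fin m → Obs r s) : ℝ :=
  (1 / (m.factorial : ℝ)) * ∑ γ : Equiv.Perm (Fin m), kernel H IX IY (permute γ z)

/-- The U-statistic `U_μ` of `μ = c μ_{I_X, I_Y, H}` (meant for `n ≥ m`):
the average of `c κ(z^{i₁}, …, z^{i_m})` over `i₁ < ⋯ < i_m`. -/
noncomputable def uStat {m r s : ℕ} (c : ℝ) (H : Subgroup (Equiv.Perm (Fin m)))
    (IX : (Fin m → Fin r → ℝ) → Prop) (IY : (Fin m → Fin s → ℝ) → Prop)
    (n : ℕ) (z : Fin n → Obs r s) : ℝ :=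
  open Classical in
  (1 / (n.choose m : ℝ)) *
    ∑ i ∈ Finset.univ.filter (fun i : Fin m → Fin n => StrictMono i),
      c * symKernel H IX IY (fun a => z (i a))

/-- `H_{τ*} = ⟨(1 4), (2 3)⟩`, as a subgroup of `S_{t+4}` (indices start at `0` here). -/
def Htau (t : ℕ) : Subgroup (Equiv.Perm (Fin (t + 4))) :=
  Subgroup.closure {Equiv.swap 0 3, Equiv.swap 1 2}

/-- `w¹, w² ⪯ v` and `w³, w⁴ ⋠ v`, where `⪯` is the coordinatewise order. -/
def Splits {t d : ℕ} (w : Fin (t + 4) → Fin d → ℝ) (v : Fin d → ℝ) : Prop :=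
  w 0 ≤ v ∧ w 1 ≤ v ∧ ¬ w 2 ≤ v ∧ ¬ w 3 ≤ v

/-- `I_D(w) = 1[w¹, w² ⪯ w⁵] 1[w³, w⁴ ⋠ w⁵]`. -/
def indD {d : ℕ} (w : Fin (1 + 4) → Fin d → ℝ) : Prop := Splits w (w 4)

/-- The indicator of `R` in the `x` part: the cut point takes its `j`-th coordinate from
the observation number `4 + j`. -/
def indRX {r s : ℕ} (w : Fin (r + s + 4) → Fin r → ℝ) : Prop :=
  Splits w (fun j => w ⟨4 + j, by omega⟩ j)

/-- The indicator of `R` in the `y` part: the cut point takes its `j`-th coordinate from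
the observation number `4 + r + j`. -/
def indRY {r s : ℕ} (w : Fin (r + s + 4) → Fin s → ℝ) : Prop :=
  Splits w (fun j => w ⟨4 + (r + j), by omega⟩ j)

/-- `I_P(w) = 1[w³, w⁴ ⋠ w¹, w²]`. -/
def indP {d : ℕ} (w : Fin (0 + 4) → Fin d → ℝ) : Prop :=
  ¬ w 2 ≤ w 0 ∧ ¬ w 2 ≤ w 1 ∧ ¬ w 3 ≤ w 0 ∧ ¬ w 3 ≤ w 1

/-- `I_J(w) = 1[w¹, w² ≺ w³, w⁴]`, where `≺` is strict inequality in every coordinate. -/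
def indJ {d : ℕ} (w : Fin (0 + 4) → Fin d → ℝ) : Prop :=
  StrongLT (w 0) (w 2) ∧ StrongLT (w 0) (w 3) ∧ StrongLT (w 1) (w 2) ∧ StrongLT (w 1) (w 3)

/-- The U-statistic of Hoeffding's `D = ¼ μ_{I_D, I_D, H_{τ*}}`, of order `5`. -/
noncomputable def UD (r s n : ℕ) (z : Fin n → Obs r s) : ℝ :=
  uStat (1 / 4) (Htau 1) indD indD n z

/-- The U-statistic of Hoeffding's `R = ¼ μ_{I_R, I_R, H_{τ*}}`, of order `r + s + 4`. -/
noncomputable def UR (r s n : ℕ) (z : Fin n → Obs r s) : ℝ :=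
  uStat (1 / 4) (Htau (r + s)) (indRX (r := r) (s := s)) (indRY (r := r) (s := s)) n z

/-- The U-statistic of `τ*_P = μ_{I_P, I_P, H_{τ*}}`, of order `4`. -/
noncomputable def UP (r s n : ℕ) (z : Fin n → Obs r s) : ℝ :=
  uStat 1 (Htau 0) indP indP n z

/-- The U-statistic of `τ*_J = μ_{I_J, I_J, H_{τ*}}`, of order `4`. -/
noncomputable def UJ (r s n : ℕ) (z : Fin n → Obs r s) : ℝ :=
  uStat 1 (Htau 0) indJ indJ n z

/-! ## A unit-cost real RAM

Memory consists of arrays of natural numbers and arrays of reals; the numbers of the arrays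
are constants of the program, the positions in them are computed.  Natural numbers can be
added, subtracted and compared.  Reals can be added, subtracted, multiplied, divided and
compared, but there is no rounding of a real to a natural number.  Every operation costs `1`. -/

/-- Expressions with values in the natural numbers; `load a i` is the entry `i` of the `a`-th
array of naturals. -/
inductive NExp : Type
  | const (k : ℕ)
  | load (a : ℕ) (i : NExp)
  | add (e f : NExp)
  | sub (e f : NExp)

/-- Expressions with values in the reals; `load a i` is the entry `i` of the `a`-th array of
reals, `le e f` is `1` if `e ≤ f` and `0` otherwise. -/
inductive RExp : Type
  | ofNat (e : NExp)
  | load (a : ℕ) (i : NExp)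
  | add (e f : RExp)
  | sub (e f : RExp)
  | mul (e f : RExp)
  | div (e f : RExp)
  | le (e f : RExp)

/-- Tests: strict comparison of two naturals or of two reals. -/
inductive Test : Type
  | ltN (e f : NExp)
  | ltR (e f : RExp)

/-- Programs. -/
inductive Cmd : Type
  | nop
  | setN (a : ℕ) (i e : NExp)
  | setR (a : ℕ) (i : NExp) (e : RExp)
  | seq (p q : Cmd)
  | ite (b : Test) (p q : Cmd)
  | loop (b : Test) (p : Cmd)

/-- The contents of the memory. -/
structure Mem where
  nat : ℕ → ℕ → ℕ
  real : ℕ → ℕ → ℝ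

def Mem.setN (σ : Mem) (a i v : ℕ) : Mem :=
  ⟨Function.update σ.nat a (Function.update (σ.nat a) i v), σ.real⟩

def Mem.setR (σ : Mem) (a i : ℕ) (v : ℝ) : Mem :=
  ⟨σ.nat, Function.update σ.real a (Function.update (σ.real a) i v)⟩

def NExp.eval (σ : Mem) : NExp → ℕ
  | const k => k
  | load a i => σ.nat a (i.eval σ)
  | add e f => e.eval σ + f.eval σ
  | sub e f => e.eval σ - f.eval σ

def NExp.cost : NExp → ℕ
  | const _ => 1
  | load _ i => i.cost + 1
  | add e f => e.cost + f.cost + 1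
  | sub e f => e.cost + f.cost + 1

noncomputable def RExp.eval (σ : Mem) : RExp → ℝ
  | ofNat e => (e.eval σ : ℝ)
  | load a i => σ.real a (i.eval σ)
  | add e f => e.eval σ + f.eval σ
  | sub e f => e.eval σ - f.eval σ
  | mul e f => e.eval σ * f.eval σ
  | div e f => e.eval σ / f.eval σ
  | le e f => ind (e.eval σ ≤ f.eval σ)

def RExp.cost : RExp → ℕ
  | ofNat e => e.cost + 1
  | load _ i => i.cost + 1
  | add e f => e.cost + f.cost + 1
  | sub e f => e.cost + f.cost + 1
  | mul e f => e.cost + f.cost + 1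
  | div e f => e.cost + f.cost + 1
  | le e f => e.cost + f.cost + 1

def Test.holds (σ : Mem) : Test → Prop
  | ltN e f => e.eval σ < f.eval σ
  | ltR e f => e.eval σ < f.eval σ

def Test.cost : Test → ℕ
  | ltN e f => e.cost + f.cost + 1
  | ltR e f => e.cost + f.cost + 1

/-- `Exec p σ σ' k`: started in the memory `σ`, the program `p` halts in the memory `σ'` after
`k` steps. -/
inductive Exec : Cmd → Mem → Mem → ℕ → Prop
  | nop (σ : Mem) : Exec Cmd.nop σ σ 1
  | setN (a : ℕ) (i e : NExp) (σ : Mem) :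
      Exec (Cmd.setN a i e) σ (σ.setN a (i.eval σ) (e.eval σ)) (i.cost + e.cost + 1)
  | setR (a : ℕ) (i : NExp) (e : RExp) (σ : Mem) :
      Exec (Cmd.setR a i e) σ (σ.setR a (i.eval σ) (e.eval σ)) (i.cost + e.cost + 1)
  | seq {p q : Cmd} {σ σ' σ'' : Mem} {k l : ℕ} :
      Exec p σ σ' k → Exec q σ' σ'' l → Exec (Cmd.seq p q) σ σ'' (k + l)
  | iteTrue {b : Test} {p q : Cmd} {σ σ' : Mem} {k : ℕ} :
      b.holds σ → Exec p σ σ' k → Exec (Cmd.ite b p q) σ σ' (b.cost + k)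
  | iteFalse {b : Test} {p q : Cmd} {σ σ' : Mem} {k : ℕ} :
      ¬ b.holds σ → Exec q σ σ' k → Exec (Cmd.ite b p q) σ σ' (b.cost + k)
  | loopTrue {b : Test} {p : Cmd} {σ σ' σ'' : Mem} {k l : ℕ} :
      b.holds σ → Exec p σ σ' k → Exec (Cmd.loop b p) σ' σ'' l →
      Exec (Cmd.loop b p) σ σ'' (b.cost + k + l)
  | loopFalse {b : Test} {p : Cmd} {σ : Mem} :
      ¬ b.holds σ → Exec (Cmd.loop b p) σ σ b.cost

/-- The initial memory on the sample `z`: the entry `0` of the natural array `0` is the sample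
size `n`; the real arrays `0, …, r - 1` hold the coordinates of `x¹, …, xⁿ` and the real arrays
`r, …, r + s - 1` those of `y¹, …, yⁿ` (positions `0, …, n - 1`); everything else is `0`. -/
noncomputable def input {r s n : ℕ} (z : Fin n → Obs r s) : Mem where
  nat := fun a i => if a = 0 ∧ i = 0 then n else 0
  real := fun a i =>
    if hi : i < n then
      if hx : a < r then (z ⟨i, hi⟩).1 ⟨a, hx⟩
      else if hy : a - r < s then (z ⟨i, hi⟩).2 ⟨a - r, hy⟩
      else 0
    else 0

/-- On every sample of size `n ≥ m` the program `P` halts with `U n z` in the entry `0` of the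
real array `r + s`, after `O(T n)` steps.  The program and the constant do not depend on the
sample or on its size. -/
def ComputesInTime (r s m : ℕ) (P : Cmd) (U : (n : ℕ) → (Fin n → Obs r s) → ℝ)
    (T : ℕ → ℝ) : Prop :=
  ∃ C : ℝ, 0 < C ∧ ∀ n : ℕ, m ≤ n → ∀ z : Fin n → Obs r s, ∃ (σ : Mem) (k : ℕ),
    Exec P (input z) σ k ∧ σ.real (r + s) 0 = U n z ∧ (k : ℝ) ≤ C * T n

/-! ## The naive algorithm

It runs through all `i₁ < ⋯ < i_m` in nested loops and evaluates the symmetrised kernel, from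
its definition, at each of them.  The index `i_p` is kept in the entry `0` of the natural array
`p`, the sum in the output cell, and the number of summands (which ends up as the binomial
coefficient) in the entry `0` of the real array `r + s + 1`. -/

/-- The scalar variable `p`. -/
def NExp.var (p : ℕ) : NExp := NExp.load p (NExp.const 0)

def RExp.num (k : ℕ) : RExp := RExp.ofNat (NExp.const k)

/-- The expression `∑_{a ∈ S} f a`. -/
noncomputable def RExp.sum {α : Type*} (S : Finset α) (f : α → RExp) : RExp :=
  (S.toList.map f).foldr RExp.add (RExp.num 0)

/-- The expression `∏_{j < d} f j`. -/
def RExp.prod (d : ℕ) (f : ℕ → RExp) : RExp :=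
  ((List.range d).map f).foldr RExp.mul (RExp.num 1)

/-- Negation of a `0/1` expression. -/
def RExp.neg (e : RExp) : RExp := RExp.sub (RExp.num 1) e

/-- Multiplication of an expression by the sign of a permutation. -/
def RExp.signed {m : ℕ} (σ : Equiv.Perm (Fin m)) (e : RExp) : RExp :=
  if Equiv.Perm.sign σ = 1 then e else RExp.sub (RExp.num 0) e

/-- The kernel `k` at the observations whose positions are given by `w`. -/
noncomputable def kernelExp {m : ℕ} (H : Subgroup (Equiv.Perm (Fin m)))
    (EX EY : (Fin m → NExp) → RExp) (w : Fin m → NExp) : RExp :=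
  RExp.mul (RExp.sum (elems H) fun σ => RExp.signed σ (EX (permute σ w)))
    (RExp.sum (elems H) fun σ => RExp.signed σ (EY (permute σ w)))

/-- The symmetrised kernel `κ` at the observations whose positions are given by `w`. -/
noncomputable def symKernelExp {m : ℕ} (H : Subgroup (Equiv.Perm (Fin m)))
    (EX EY : (Fin m → NExp) → RExp) (w : Fin m → NExp) : RExp :=
  RExp.div (RExp.sum Finset.univ fun γ : Equiv.Perm (Fin m) => kernelExp H EX EY (permute γ w))
    (RExp.num m.factorial)

/-- The `k` nested loops over the variables `i_p < i_{p+1} < ⋯ < i_{p+k-1} < n` around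
`body`; the variable `0` holds `n`, the first index starts at `0` and every later one at the
successor of the one before. -/
def nest (body : Cmd) : ℕ → ℕ → Cmd
  | 0, _ => body
  | k + 1, p =>
    Cmd.seq
      (Cmd.setN p (NExp.const 0)
        (if p = 1 then NExp.const 0 else NExp.add (NExp.var (p - 1)) (NExp.const 1)))
      (Cmd.loop (Test.ltN (NExp.var p) (NExp.var 0))
        (Cmd.seq (nest body k (p + 1))
          (Cmd.setN p (NExp.const 0) (NExp.add (NExp.var p) (NExp.const 1)))))

/-- The naive algorithm for the U-statistic of `(1/q) μ_{I_X, I_Y, H}`, of order `m`, in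
dimension `d = r + s`, where `EX` and `EY` are expressions for `I_X` and `I_Y`. -/
noncomputable def naive {m : ℕ} (d q : ℕ) (H : Subgroup (Equiv.Perm (Fin m)))
    (EX EY : (Fin m → NExp) → RExp) : Cmd :=
  Cmd.seq
    (nest
      (Cmd.seq
        (Cmd.setR d (NExp.const 0)
          (RExp.add (RExp.load d (NExp.const 0))
            (symKernelExp H EX EY fun a => NExp.var (a + 1))))
        (Cmd.setR (d + 1) (NExp.const 0)
          (RExp.add (RExp.load (d + 1) (NExp.const 0)) (RExp.num 1))))
      m 1)
    (Cmd.setR d (NExp.const 0)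
      (RExp.div (RExp.load d (NExp.const 0))
        (RExp.mul (RExp.num q) (RExp.load (d + 1) (NExp.const 0)))))

/-- `wᵃ ⪯ wᵇ` in the coordinates `off, …, off + d - 1`. -/
def leExp (off d : ℕ) (a b : NExp) : RExp :=
  RExp.prod d fun j => RExp.le (RExp.load (off + j) a) (RExp.load (off + j) b)

/-- `wᵃ ≺ wᵇ` in the coordinates `off, …, off + d - 1`. -/
def ltExp (off d : ℕ) (a b : NExp) : RExp :=
  RExp.prod d fun j => RExp.neg (RExp.le (RExp.load (off + j) b) (RExp.load (off + j) a))

/-- Conjunction of four `0/1` expressions. -/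
def RExp.and4 (e₁ e₂ e₃ e₄ : RExp) : RExp := RExp.mul (RExp.mul e₁ e₂) (RExp.mul e₃ e₄)

def expD (off d : ℕ) (w : Fin (1 + 4) → NExp) : RExp :=
  RExp.and4 (leExp off d (w 0) (w 4)) (leExp off d (w 1) (w 4))
    (RExp.neg (leExp off d (w 2) (w 4))) (RExp.neg (leExp off d (w 3) (w 4)))

/-- `wᵃ ⪯ v` in the coordinates `off, …, off + d - 1`, where the coordinate number `c` of the cut
point `v` is taken from the observation number `4 + c` of the tuple `w`. -/
def cutExp {t : ℕ} (off d : ℕ) (w : Fin (t + 4) → NExp) (a : NExp) : RExp :=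
  RExp.prod d fun j => RExp.le (RExp.load (off + j) a)
    (RExp.load (off + j) (if h : 4 + (off + j) < t + 4 then w ⟨4 + (off + j), h⟩ else a))

def expR {t : ℕ} (off d : ℕ) (w : Fin (t + 4) → NExp) : RExp :=
  RExp.and4 (cutExp off d w (w 0)) (cutExp off d w (w 1))
    (RExp.neg (cutExp off d w (w 2))) (RExp.neg (cutExp off d w (w 3)))

def expP (off d : ℕ) (w : Fin (0 + 4) → NExp) : RExp :=
  RExp.and4 (RExp.neg (leExp off d (w 2) (w 0))) (RExp.neg (leExp off d (w 2) (w 1)))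
    (RExp.neg (leExp off d (w 3) (w 0))) (RExp.neg (leExp off d (w 3) (w 1)))

def expJ (off d : ℕ) (w : Fin (0 + 4) → NExp) : RExp :=
  RExp.and4 (ltExp off d (w 0) (w 2)) (ltExp off d (w 0) (w 3))
    (ltExp off d (w 1) (w 2)) (ltExp off d (w 1) (w 3))

noncomputable def naiveD (r s : ℕ) : Cmd :=
  naive (r + s) 4 (Htau 1) (expD 0 r) (expD r s)

noncomputable def naiveR (r s : ℕ) : Cmd :=
  naive (r + s) 4 (Htau (r + s)) (expR 0 r) (expR r s)

noncomputable def naiveP (r s : ℕ) : Cmd :=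
  naive (r + s) 1 (Htau 0) (expP 0 r) (expP r s)

noncomputable def naiveJ (r s : ℕ) : Cmd :=
  naive (r + s) 1 (Htau 0) (expJ 0 r) (expJ r s)

end RankCov

/-! The symmetrisation and the average over increasing indices combine into one sum over injective
index tuples divided by a descending factorial (`uStat_eq_sum_injective`). The fast programs exploit
a factorisation of the kernel in this sum.

For `D` and `R` the four signed indicators factor as `(a i - a l) * (a j - a k)`, where `a`
indicates the observations below the cut point in the `x` part; likewise with `b` in the `y` part.
Inclusion-exclusion over coincident indices (`dsum_eq`) then shows that, for a fixed cut point, the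
sum over distinct quadruples is the polynomial `hoef` in the sample size and the numbers of
observations below the cut point in `x`, in `y` and in both (`dsum_hoef`). For `U_D` the cut points
are the observations themselves, and all these counts are dominance counts in at most `d`
coordinates. For `U_R` there are `n ^ d` cut points; if all coordinates but the last are fixed,
cumulative sums along the ranks of the last coordinate give the counts of all `n` remaining cut
points in linear time (`runs_sweep`).

For the two versions of `τ*` the indicator is a product of four edges, that is, of values of a
relation between two observations. With the indices grouped into the pairs `(i, j)` and `(k, l)`,
each signed term has one edge inside each pair and two edges between the pairs (`quad_eq_sum`). The
edges between the pairs expand into signed products of weak coordinate inequalities (`EdgeKind`).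
Hence the sum over all quadruples is a fixed number of weighted dominance sums among the `n ^ 2`
pairs in `2 * d` coordinates, and the coincidences cost only sums over pairs (`dsum_quad`).

Dominance sums are computed by `dominance`. Every coordinate is replaced by its rank, found with a
tournament tree. Since `a < b` is decided at exactly one level of the binary expansions
(`sum_ind_leftSibling`), it suffices to go through all choices of levels for all coordinates but
one, and for each choice to scan the items once in the order of the remaining coordinate, with
counters addressed by the current tree nodes. For `E` items in `K + 1` coordinates this takes `E`
times the `K`-th power of the logarithm, up to constants (`runs_dominance`).

Running times are tracked by `Runs`: the bound is the product of the constant `Cmd.weight` of the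
program and a quantity that only loops multiply. What a program leaves alone is read off its text by
`Exec.frame`. The naive programs follow the definition, and `runs_nest` bounds their nested loops.
-/

namespace RankCov

/-! ## A program logic with time bounds -/

/-- A constant such that the running time of a program is at most this constant times a quantity
which only counts loop iterations. -/
def Cmd.weight : Cmd → ℕ
  | nop => 1
  | setN _ i e => i.cost + e.cost + 1
  | setR _ i e => i.cost + e.cost + 1
  | seq p q => p.weight + q.weight
  | ite b p q => b.cost + p.weight + q.weight
  | loop b p => b.cost + p.weight

/-- The program may write into the array `a` of naturals. -/
def Cmd.WritesN : Cmd → ℕ → Prop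
  | nop, _ => False
  | setN b _ _, a => a = b
  | setR _ _ _, _ => False
  | seq p q, a => p.WritesN a ∨ q.WritesN a
  | ite _ p q, a => p.WritesN a ∨ q.WritesN a
  | loop _ p, a => p.WritesN a

/-- The program may write into the array `a` of reals. -/
def Cmd.WritesR : Cmd → ℕ → Prop
  | nop, _ => False
  | setN _ _ _, _ => False
  | setR b _ _, a => a = b
  | seq p q, a => p.WritesR a ∨ q.WritesR a
  | ite _ p q, a => p.WritesR a ∨ q.WritesR a
  | loop _ p, a => p.WritesR a

/-- The memories differ at most in arrays into which the program may write. -/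
structure Frame (p : Cmd) (σ τ : Mem) : Prop where
  nat : ∀ a, ¬ p.WritesN a → τ.nat a = σ.nat a
  real : ∀ a, ¬ p.WritesR a → τ.real a = σ.real a

theorem Frame.refl (p : Cmd) (σ : Mem) : Frame p σ σ := ⟨fun _ _ => rfl, fun _ _ => rfl⟩

theorem Frame.trans {p : Cmd} {σ τ υ : Mem} (h : Frame p σ τ) (h' : Frame p τ υ) :
    Frame p σ υ :=
  ⟨fun a ha => (h'.nat a ha).trans (h.nat a ha), fun a ha => (h'.real a ha).trans (h.real a ha)⟩

theorem Frame.mono {p q : Cmd} {σ τ : Mem} (h : Frame p σ τ)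
    (hN : ∀ a, p.WritesN a → q.WritesN a) (hR : ∀ a, p.WritesR a → q.WritesR a) :
    Frame q σ τ :=
  ⟨fun a ha => h.nat a fun h' => ha (hN a h'), fun a ha => h.real a fun h' => ha (hR a h')⟩

@[simp] theorem Mem.setN_nat (σ : Mem) (a i v b j : ℕ) :
    (σ.setN a i v).nat b j = if b = a ∧ j = i then v else σ.nat b j := by
  simp only [Mem.setN, Function.update_apply]
  by_cases h : b = a
  · subst h; by_cases h' : j = i <;> simp [h']
  · simp [h]

@[simp] theorem Mem.setN_real (σ : Mem) (a i v : ℕ) : (σ.setN a i v).real = σ.real := rfl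

@[simp] theorem Mem.setR_nat (σ : Mem) (a i : ℕ) (v : ℝ) : (σ.setR a i v).nat = σ.nat := rfl

@[simp] theorem Mem.setR_real (σ : Mem) (a i : ℕ) (v : ℝ) (b j : ℕ) :
    (σ.setR a i v).real b j = if b = a ∧ j = i then v else σ.real b j := by
  simp only [Mem.setR, Function.update_apply]
  by_cases h : b = a
  · subst h; by_cases h' : j = i <;> simp [h']
  · simp [h]

/-- The set of arrays a program can write is read off its syntax. Specifications can therefore be
confined to the arrays that change; all the rest follows from this lemma. -/
theorem Exec.frame {p : Cmd} {σ τ : Mem} {k : ℕ} (h : Exec p σ τ k) : Frame p σ τ := by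
  induction h with
  | nop σ => exact Frame.refl _ _
  | setN a i e σ =>
    refine ⟨fun b hb => ?_, fun _ _ => rfl⟩
    ext j
    simp only [Cmd.WritesN] at hb
    simp [hb]
  | setR a i e σ =>
    refine ⟨fun _ _ => rfl, fun b hb => ?_⟩
    ext j
    simp only [Cmd.WritesR] at hb
    simp [hb]
  | seq _ _ ih1 ih2 =>
    exact Frame.trans (p := Cmd.seq _ _) (ih1.mono (fun _ h => Or.inl h) (fun _ h => Or.inl h))
      (ih2.mono (fun _ h => Or.inr h) (fun _ h => Or.inr h))
  | iteTrue _ _ ih => exact ih.mono (fun _ h => Or.inl h) (fun _ h => Or.inl h)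
  | iteFalse _ _ ih => exact ih.mono (fun _ h => Or.inr h) (fun _ h => Or.inr h)
  | loopTrue _ _ _ ih1 ih2 =>
    exact Frame.trans (p := Cmd.loop _ _) (ih1.mono (fun _ h => h) (fun _ h => h)) ih2
  | loopFalse _ => exact Frame.refl _ _

/-- Started in `σ` the program halts after at most `p.weight * f` steps, in a memory with
the property `Q`. -/
def Runs (p : Cmd) (σ : Mem) (f : ℕ) (Q : Mem → Prop) : Prop :=
  ∃ τ k, Exec p σ τ k ∧ k ≤ p.weight * f ∧ Q τ

namespace Runs
variable {p q : Cmd} {σ : Mem} {f g : ℕ} {Q R : Mem → Prop}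

/-- The consequence rule also supplies the frame of the run when the postcondition is changed. This
is the place where unchanged arrays are recovered. -/
theorem mono (h : Runs p σ f Q) (hfg : f ≤ g) (hQ : ∀ τ, Frame p σ τ → Q τ → R τ) :
    Runs p σ g R := by
  obtain ⟨τ, k, hx, hk, hq⟩ := h
  exact ⟨τ, k, hx, hk.trans (Nat.mul_le_mul_left _ hfg), hQ τ hx.frame hq⟩

theorem nop (hf : 1 ≤ f) (h : Q σ) : Runs Cmd.nop σ f Q :=
  ⟨σ, 1, Exec.nop σ, by simpa [Cmd.weight] using hf, h⟩

theorem setN {a : ℕ} {i e : NExp} (hf : 1 ≤ f) (h : Q (σ.setN a (i.eval σ) (e.eval σ))) :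
    Runs (Cmd.setN a i e) σ f Q :=
  ⟨_, _, Exec.setN a i e σ, Nat.le_mul_of_pos_right _ hf, h⟩

theorem setR {a : ℕ} {i : NExp} {e : RExp} (hf : 1 ≤ f)
    (h : Q (σ.setR a (i.eval σ) (e.eval σ))) : Runs (Cmd.setR a i e) σ f Q :=
  ⟨_, _, Exec.setR a i e σ, Nat.le_mul_of_pos_right _ hf, h⟩

/-- Both parts may use the whole budget `f`, because the weights add. So `f` never has to be divided
among consecutive commands. -/
theorem seq (h : Runs p σ f fun τ => Runs q τ f Q) : Runs (Cmd.seq p q) σ f Q := by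
  obtain ⟨τ, k, hx, hk, υ, l, hy, hl, hq⟩ := h
  refine ⟨υ, k + l, Exec.seq hx hy, ?_, hq⟩
  rw [Cmd.weight, add_mul]
  omega

theorem ite {b : Test} (hf : 1 ≤ f) (h : b.holds σ → Runs p σ f Q)
    (h' : ¬ b.holds σ → Runs q σ f Q) : Runs (Cmd.ite b p q) σ f Q := by
  have hb : b.cost ≤ b.cost * f := Nat.le_mul_of_pos_right _ hf
  by_cases hc : b.holds σ
  · obtain ⟨τ, k, hx, hk, hq⟩ := h hc
    refine ⟨τ, _, Exec.iteTrue hc hx, ?_, hq⟩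
    rw [Cmd.weight, add_mul, add_mul]
    omega
  · obtain ⟨τ, k, hx, hk, hq⟩ := h' hc
    refine ⟨τ, _, Exec.iteFalse hc hx, ?_, hq⟩
    rw [Cmd.weight, add_mul, add_mul]
    omega

/-- The rule for loops in which a counter runs from its initial value up to `N`. -/
theorem loop {b : Test} {N : ℕ} (I : ℕ → Mem → Prop) (hf : 1 ≤ f)
    (hs : ∀ i < N, ∀ τ, Frame (Cmd.loop b p) σ τ → I i τ →
      b.holds τ ∧ Runs p τ f (fun υ => I (i + 1) υ))
    (he : ∀ τ, Frame (Cmd.loop b p) σ τ → I N τ → ¬ b.holds τ ∧ Q τ)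
    (lo : ℕ) (hlo : lo ≤ N) (hg : (N - lo + 1) * f ≤ g) (h0 : I lo σ) :
    Runs (Cmd.loop b p) σ g Q := by
  -- Induction on the number `m` of remaining iterations; the extra unit in `m + 1` pays for the
  -- final, failing test.
  have key : ∀ m i τ, i + m = N → Frame (Cmd.loop b p) σ τ → I i τ →
      ∃ υ k, Exec (Cmd.loop b p) τ υ k ∧ k ≤ (b.cost + p.weight) * ((m + 1) * f) ∧ Q υ := by
    intro m
    induction m with
    | zero =>
      intro i τ hi hF hI
      obtain rfl : i = N := by omega
      obtain ⟨h1, h2⟩ := he τ hF hI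
      refine ⟨τ, _, Exec.loopFalse h1, ?_, h2⟩
      nlinarith [Nat.zero_le (p.weight * f), Nat.le_mul_of_pos_right b.cost hf]
    | succ m ih =>
      intro i τ hi hF hI
      obtain ⟨h1, υ, k, hx, hk, hI'⟩ := hs i (by omega) τ hF hI
      obtain ⟨ω, l, hy, hl, hq⟩ := ih (i + 1) υ (by omega)
        (hF.trans (hx.frame.mono (fun _ h => h) (fun _ h => h))) hI'
      refine ⟨ω, _, Exec.loopTrue h1 hx hy, ?_, hq⟩
      nlinarith [Nat.le_mul_of_pos_right b.cost hf]
  obtain ⟨υ, k, hx, hk, hq⟩ := key (N - lo) lo σ (by omega) (Frame.refl _ _) h0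
  exact ⟨υ, k, hx, hk.trans (Nat.mul_le_mul_left _ hg), hq⟩

end Runs

/-- `for v < hi do body`. -/
def Cmd.for (v : ℕ) (hi : NExp) (body : Cmd) : Cmd :=
  Cmd.seq (Cmd.setN v (NExp.const 0) (NExp.const 0))
    (Cmd.loop (Test.ltN (NExp.var v) hi)
      (Cmd.seq body (Cmd.setN v (NExp.const 0) (NExp.add (NExp.var v) (NExp.const 1)))))

theorem Cmd.writesN_for (v : ℕ) (hi : NExp) (body : Cmd) (a : ℕ) :
    (Cmd.for v hi body).WritesN a ↔ a = v ∨ body.WritesN a := by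
  simp only [Cmd.for, Cmd.WritesN]; tauto

theorem Cmd.writesR_for (v : ℕ) (hi : NExp) (body : Cmd) (a : ℕ) :
    (Cmd.for v hi body).WritesR a ↔ body.WritesR a := by
  simp [Cmd.for, Cmd.WritesR]

@[simp] theorem NExp.eval_var (σ : Mem) (v : ℕ) : (NExp.var v).eval σ = σ.nat v 0 := rfl

/-- The invariant after a round is required in the memory with the counter already increased, since
`I` may speak about any part of the memory. The bound `hi` may be any expression, as long as it
keeps the value `N` wherever only the arrays of the loop have changed. -/
theorem Runs.for {v : ℕ} {hi : NExp} {body : Cmd} {σ : Mem} {f g N : ℕ} {Q : Mem → Prop}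
    (I : ℕ → Mem → Prop) (hf : 1 ≤ f) (hg : (N + 1) * f ≤ g) (hv : ¬ body.WritesN v)
    (hhi : ∀ τ, Frame (Cmd.for v hi body) σ τ → hi.eval τ = N)
    (h0 : I 0 (σ.setN v 0 0))
    (hs : ∀ i < N, ∀ τ, Frame (Cmd.for v hi body) σ τ → τ.nat v 0 = i → I i τ →
      Runs body τ f (fun υ => I (i + 1) (υ.setN v 0 (i + 1))))
    (he : ∀ τ, Frame (Cmd.for v hi body) σ τ → I N τ → Q τ) :
    Runs (Cmd.for v hi body) σ g Q := by
  have hg1 : 1 ≤ g := le_trans (by nlinarith [Nat.zero_le (N * f)]) hg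
  have hF0 : Frame (Cmd.for v hi body) σ (σ.setN v 0 0) := by
    refine ⟨fun a ha => ?_, fun _ _ => rfl⟩
    rw [Cmd.writesN_for] at ha
    ext j
    simp; intro h; tauto
  have hF : ∀ {τ}, Frame (Cmd.loop (Test.ltN (NExp.var v) hi)
      (Cmd.seq body (Cmd.setN v (NExp.const 0) (NExp.add (NExp.var v) (NExp.const 1)))))
      (σ.setN v 0 0) τ → Frame (Cmd.for v hi body) σ τ := fun h =>
    hF0.trans (h.mono (fun _ h => Or.inr h) (fun _ h => Or.inr h))
  refine Runs.seq (Runs.setN hg1 ?_)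
  refine Runs.loop (N := N) (fun i τ => τ.nat v 0 = i ∧ I i τ) hf ?_ ?_ 0 (Nat.zero_le _)
    (by simpa using hg) ⟨by simp [NExp.eval], h0⟩
  · rintro i hi' τ hτ ⟨hvi, hI⟩
    refine ⟨by simp [Test.holds, hhi τ (hF hτ), hvi, hi'], ?_⟩
    refine Runs.seq ((hs i hi' τ (hF hτ) hvi hI).mono le_rfl fun υ hυ hI' => ?_)
    refine Runs.setN hf ?_
    have : υ.nat v 0 = i := by rw [hυ.nat v hv, hvi]
    simp only [NExp.eval, NExp.eval_var, this]
    exact ⟨by simp, hI'⟩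
  · rintro τ hτ ⟨hvi, hI⟩
    exact ⟨by simp [Test.holds, hhi τ (hF hτ), hvi], he τ (hF hτ) hI⟩

/-! ### Evaluation of expressions -/

open Classical in
theorem ind_def (p : Prop) : ind p = if p then 1 else 0 := rfl

theorem ind_true {p : Prop} (h : p) : ind p = 1 := by simp [ind, h]

theorem ind_false {p : Prop} (h : ¬ p) : ind p = 0 := by simp [ind, h]

theorem ind_and (p q : Prop) : ind (p ∧ q) = ind p * ind q := by
  by_cases hp : p <;> by_cases hq : q <;> simp [ind, hp, hq]

theorem ind_not (p : Prop) : ind (¬ p) = 1 - ind p := by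
  by_cases hp : p <;> simp [ind, hp]

theorem ind_mul_self (p : Prop) : ind p * ind p = ind p := by
  by_cases hp : p <;> simp [ind, hp]

theorem prod_ind {ι : Type*} (s : Finset ι) (p : ι → Prop) :
    ∏ i ∈ s, ind (p i) = ind (∀ i ∈ s, p i) := by
  classical
  induction s using Finset.induction_on with
  | empty => simp [ind]
  | insert a s ha ih => rw [Finset.prod_insert ha, ih, ← ind_and]; simp

theorem ind_congr {p q : Prop} (h : p ↔ q) : ind p = ind q := by rw [propext h]

theorem RExp.eval_num (σ : Mem) (k : ℕ) : (RExp.num k).eval σ = k := rfl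

theorem RExp.eval_neg (σ : Mem) (e : RExp) : (RExp.neg e).eval σ = 1 - e.eval σ := by
  simp [RExp.neg, RExp.eval, RExp.eval_num]

theorem RExp.eval_foldr_add (σ : Mem) (l : List RExp) :
    (l.foldr RExp.add (RExp.num 0)).eval σ = (l.map (RExp.eval σ)).sum := by
  induction l with
  | nil => simp [RExp.eval_num]
  | cons a l ih => simp [RExp.eval, ih]

theorem RExp.eval_foldr_mul (σ : Mem) (l : List RExp) :
    (l.foldr RExp.mul (RExp.num 1)).eval σ = (l.map (RExp.eval σ)).prod := by
  induction l with
  | nil => simp [RExp.eval_num]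
  | cons a l ih => simp [RExp.eval, ih]

theorem RExp.eval_sum {α : Type*} (σ : Mem) (S : Finset α) (f : α → RExp) :
    (RExp.sum S f).eval σ = ∑ a ∈ S, (f a).eval σ := by
  rw [RExp.sum, RExp.eval_foldr_add, List.map_map, ← Finset.sum_map_toList]; rfl

theorem RExp.eval_prod (σ : Mem) (d : ℕ) (f : ℕ → RExp) :
    (RExp.prod d f).eval σ = ∏ j ∈ Finset.range d, (f j).eval σ := by
  rw [RExp.prod, RExp.eval_foldr_mul, List.map_map, Finset.prod_range]
  rw [← List.prod_ofFn, List.ofFn_eq_map]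
  congr 1
  rw [← List.map_coe_finRange_eq_range, List.map_map]
  rfl

theorem RExp.eval_signed {m : ℕ} (σ : Mem) (γ : Equiv.Perm (Fin m)) (e : RExp) :
    (RExp.signed γ e).eval σ = ((Equiv.Perm.sign γ : ℤ) : ℝ) * e.eval σ := by
  rcases Int.units_eq_one_or (Equiv.Perm.sign γ) with h | h <;>
    simp [RExp.signed, h, RExp.eval, RExp.eval_num]

theorem eval_leExp (σ : Mem) (off d : ℕ) (a b : NExp) :
    (leExp off d a b).eval σ =
      ind (∀ j < d, σ.real (off + j) (a.eval σ) ≤ σ.real (off + j) (b.eval σ)) := by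
  rw [leExp, RExp.eval_prod]
  simp only [RExp.eval]
  rw [prod_ind]
  simp

theorem eval_ltExp (σ : Mem) (off d : ℕ) (a b : NExp) :
    (ltExp off d a b).eval σ =
      ind (∀ j < d, σ.real (off + j) (a.eval σ) < σ.real (off + j) (b.eval σ)) := by
  rw [ltExp, RExp.eval_prod]
  simp only [RExp.eval_neg, RExp.eval, ← ind_not]
  rw [prod_ind]
  simp

theorem RExp.eval_and4 (σ : Mem) (e₁ e₂ e₃ e₄ : RExp) :
    (RExp.and4 e₁ e₂ e₃ e₄).eval σ = e₁.eval σ * e₂.eval σ * (e₃.eval σ * e₄.eval σ) := rfl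

/-! ## U-statistics as sums over injective tuples -/

-- An injective tuple is a strictly increasing one rearranged by a unique permutation: sorting gives
-- existence, and the range determines the increasing tuple.
open Classical in
theorem sum_strictMono_perm {m n : ℕ} {M : Type*} [AddCommMonoid M] (f : (Fin m → Fin n) → M) :
    ∑ i ∈ Finset.univ.filter (fun i : Fin m → Fin n => StrictMono i),
      ∑ γ : Equiv.Perm (Fin m), f (permute γ i) =
    ∑ i ∈ Finset.univ.filter (fun i : Fin m → Fin n => Function.Injective i), f i := by
  rw [← Finset.sum_product']
  refine Finset.sum_bij (fun p _ => permute p.2 p.1) ?_ ?_ ?_ ?_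
  · rintro ⟨i, γ⟩ h
    simp only [Finset.mem_product, Finset.mem_filter, Finset.mem_univ, true_and, and_true] at h ⊢
    exact h.injective.comp (γ⁻¹).injective
  · rintro ⟨i, γ⟩ h ⟨i', γ'⟩ h' he
    simp only [Finset.mem_product, Finset.mem_filter, Finset.mem_univ, true_and, and_true] at h h' he
    -- Rearranging does not change the range, and a strictly increasing tuple is determined by its
    -- range.
    have hr : Set.range i = Set.range i' := by
      have h1 : Set.range (permute γ i) = Set.range i := (γ⁻¹).surjective.range_comp i
      have h2 : Set.range (permute γ' i') = Set.range i' := (γ'⁻¹).surjective.range_comp i'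
      rw [← h1, he, h2]
    obtain rfl : i = i' := (h.range_inj h').mp hr
    have : γ⁻¹ = γ'⁻¹ := by
      ext a
      exact congrArg Fin.val (h.injective (congrFun he a))
    simpa using this
  · intro i hi
    simp only [Finset.mem_filter, Finset.mem_univ, true_and] at hi
    refine ⟨(i ∘ Tuple.sort i, Tuple.sort i), ?_, ?_⟩
    · simp only [Finset.mem_product, Finset.mem_filter, Finset.mem_univ, true_and, and_true]
      exact (Tuple.monotone_sort i).strictMono_of_injective
        (hi.comp (Tuple.sort i).injective)
    · ext a
      simp [permute]
  · rintro ⟨i, γ⟩ _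
    rfl

open Classical in
theorem card_filter_injective (m n : ℕ) :
    (Finset.univ.filter (fun i : Fin m → Fin n => Function.Injective i)).card =
      n.descFactorial m := by
  rw [← Fintype.card_subtype, Fintype.card_congr (Equiv.subtypeInjectiveEquivEmbedding _ _),
    Fintype.card_embedding_eq]
  simp

-- The reindexing of `sum_strictMono_perm`, applied to the constant `1`, counts every increasing
-- tuple `m!` times.
open Classical in
theorem card_filter_strictMono (m n : ℕ) :
    (Finset.univ.filter (fun i : Fin m → Fin n => StrictMono i)).card = n.choose m := by
  have h := sum_strictMono_perm (m := m) (n := n) (fun _ => 1)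
  simp only [Finset.sum_const, Finset.card_univ, Fintype.card_perm, Fintype.card_fin,
    smul_eq_mul, mul_one] at h
  rw [card_filter_injective, Nat.descFactorial_eq_factorial_mul_choose, mul_comm] at h
  exact Nat.eq_of_mul_eq_mul_left (Nat.factorial_pos m) h

-- The factor `1 / m!` of the symmetrised kernel and the binomial coefficient multiply to the
-- descending factorial, and the permutations are absorbed by passing to all injective tuples.
open Classical in
theorem uStat_eq_sum_injective {m r s : ℕ} (c : ℝ) (H : Subgroup (Equiv.Perm (Fin m)))
    (IX : (Fin m → Fin r → ℝ) → Prop) (IY : (Fin m → Fin s → ℝ) → Prop)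
    (n : ℕ) (z : Fin n → Obs r s) :
    uStat c H IX IY n z =
      c * (∑ i ∈ Finset.univ.filter (fun i : Fin m → Fin n => Function.Injective i),
        kernel H IX IY (fun a => z (i a))) / (n.descFactorial m : ℝ) := by
  rw [← sum_strictMono_perm (fun i : Fin m → Fin n => kernel H IX IY (fun a => z (i a))), uStat]
  simp only [symKernel]
  rw [Nat.descFactorial_eq_factorial_mul_choose, ← Finset.mul_sum, ← Finset.mul_sum]
  have : ∀ (i : Fin m → Fin n) (γ : Equiv.Perm (Fin m)),
      permute γ (fun a => z (i a)) = fun a => z (permute γ i a) := fun _ _ => rfl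
  simp only [this]
  push_cast
  have := Nat.factorial_ne_zero m
  -- For a sample of size less than `m` both sides are divided by zero, so both are `0`.
  by_cases h : (n.choose m : ℝ) = 0
  · simp [h]
  · field_simp

/-! ### The kernel -/

/-- Two disjoint transpositions commute and are involutions, so the subgroup they generate is a
Klein four-group. -/
theorem elems_Htau (t : ℕ) : elems (Htau t) =
    {1, Equiv.swap 0 3, Equiv.swap 1 2, Equiv.swap 0 3 * Equiv.swap 1 2} := by
  -- Numerals in `Fin (t + 4)` are residues; their values are needed to tell the indices apart for a
  -- variable `t`.
  have v1 : ((1 : Fin (t + 4)) : ℕ) = 1 := Nat.mod_eq_of_lt (show 1 < t + 4 by omega)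
  have v2 : ((2 : Fin (t + 4)) : ℕ) = 2 := Nat.mod_eq_of_lt (show 2 < t + 4 by omega)
  have v3 : ((3 : Fin (t + 4)) : ℕ) = 3 := Nat.mod_eq_of_lt (show 3 < t + 4 by omega)
  have h01 : (0 : Fin (t + 4)) ≠ 1 := by rw [Ne, Fin.ext_iff, v1]; simp
  have h02 : (0 : Fin (t + 4)) ≠ 2 := by rw [Ne, Fin.ext_iff, v2]; simp
  have h31 : (3 : Fin (t + 4)) ≠ 1 := by rw [Ne, Fin.ext_iff, v1, v3]; simp
  have h32 : (3 : Fin (t + 4)) ≠ 2 := by rw [Ne, Fin.ext_iff, v2, v3]; simp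
  have hc : Equiv.swap (0 : Fin (t + 4)) 3 * Equiv.swap 1 2 =
      Equiv.swap 1 2 * Equiv.swap 0 3 := by
    ext a
    simp only [Equiv.Perm.mul_apply]
    congr 1
    simp only [Equiv.swap_apply_def]
    split_ifs <;> simp_all
  ext σ
  simp only [elems, Finset.mem_filter, Finset.mem_univ, true_and, Finset.mem_insert,
    Finset.mem_singleton]
  constructor
  · intro h
    refine Subgroup.closure_induction (p := fun σ _ => σ = 1 ∨ σ = Equiv.swap 0 3 ∨
      σ = Equiv.swap 1 2 ∨ σ = Equiv.swap 0 3 * Equiv.swap 1 2) ?_ ?_ ?_ ?_ h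
    · rintro x (rfl | rfl) <;> simp
    · simp
    · have e1 : ∀ x : Equiv.Perm (Fin (t + 4)), Equiv.swap 0 3 * (Equiv.swap 0 3 * x) = x :=
        fun x => by rw [← mul_assoc, Equiv.swap_mul_self, one_mul]
      have e3 : ∀ x : Equiv.Perm (Fin (t + 4)), Equiv.swap 1 2 * (Equiv.swap 0 3 * x) =
          Equiv.swap 0 3 * (Equiv.swap 1 2 * x) := fun x => by
        rw [← mul_assoc, ← hc, mul_assoc]
      rintro x y - - (rfl | rfl | rfl | rfl) (rfl | rfl | rfl | rfl) <;>
        simp [mul_assoc, e1, e3, Equiv.swap_mul_self, hc.symm]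
    · rintro x - (rfl | rfl | rfl | rfl) <;> simp [mul_inv_rev, Equiv.swap_inv, hc]
  · have m1 : Equiv.swap 0 3 ∈ Htau t := Subgroup.subset_closure (by simp)
    have m2 : Equiv.swap 1 2 ∈ Htau t := Subgroup.subset_closure (by simp)
    rintro (rfl | rfl | rfl | rfl)
    exacts [one_mem _, m1, m2, mul_mem m1 m2]

/-- The tuple `(a, b, c, e, w⁵, w⁶, …)`. -/
def tup {α : Type*} {t : ℕ} (a b c e : α) (w : Fin t → α) : Fin (t + 4) → α :=
  Fin.cons a (Fin.cons b (Fin.cons c (Fin.cons e w)))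

section
variable {α : Type*} {t : ℕ} (a b c e : α) (w : Fin t → α)

theorem tup_add (j : ℕ) (h : j < t) (h' : 4 + j < t + 4) : tup a b c e w ⟨4 + j, h'⟩ = w ⟨j, h⟩ := by
  have : (⟨4 + j, h'⟩ : Fin (t + 4)) = Fin.succ (Fin.succ (Fin.succ (Fin.succ ⟨j, h⟩))) := by
    ext; simp; omega
  rw [this]; rfl

theorem fin_add_four_cases (i : Fin (t + 4)) :
    i = 0 ∨ i = 1 ∨ i = 2 ∨ i = 3 ∨
      ∃ j : Fin t, i = Fin.succ (Fin.succ (Fin.succ (Fin.succ j))) := by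
  refine Fin.cases (Or.inl rfl) (fun i => Or.inr ?_) i
  refine Fin.cases (Or.inl rfl) (fun i => Or.inr ?_) i
  refine Fin.cases (Or.inl rfl) (fun i => Or.inr ?_) i
  exact Fin.cases (Or.inl rfl) (fun i => Or.inr ⟨i, rfl⟩) i

theorem comp_tup {β : Type*} (g : α → β) :
    (fun i => g (tup a b c e w i)) = tup (g a) (g b) (g c) (g e) (fun j => g (w j)) := by
  ext i
  rcases fin_add_four_cases i with rfl | rfl | rfl | rfl | ⟨j, rfl⟩ <;> rfl

theorem swap_fix {i j : Fin 4} (k : Fin t) :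
    Equiv.swap (Fin.castLE (by omega : 4 ≤ t + 4) i) (Fin.castLE (by omega) j)
      (Fin.succ (Fin.succ (Fin.succ (Fin.succ k)))) =
      Fin.succ (Fin.succ (Fin.succ (Fin.succ k))) := by
  apply Equiv.swap_apply_of_ne_of_ne <;>
  · rw [Ne, Fin.ext_iff]
    simp only [Fin.val_succ, Fin.val_castLE]
    omega

theorem permute_swap_outer : permute (Equiv.swap 0 3) (tup a b c e w) = tup e b c a w := by
  have v1 : ((1 : Fin (t + 4)) : ℕ) = 1 := Nat.mod_eq_of_lt (show 1 < t + 4 by omega)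
  have v2 : ((2 : Fin (t + 4)) : ℕ) = 2 := Nat.mod_eq_of_lt (show 2 < t + 4 by omega)
  have v3 : ((3 : Fin (t + 4)) : ℕ) = 3 := Nat.mod_eq_of_lt (show 3 < t + 4 by omega)
  ext i
  rw [permute, Equiv.swap_inv]
  rcases fin_add_four_cases i with rfl | rfl | rfl | rfl | ⟨j, rfl⟩
  · rw [Equiv.swap_apply_left]; rfl
  · rw [Equiv.swap_apply_of_ne_of_ne]; rfl
    all_goals rw [Ne, Fin.ext_iff]; simp only [Fin.val_zero, v1, v3]; omega
  · rw [Equiv.swap_apply_of_ne_of_ne]; rfl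
    all_goals rw [Ne, Fin.ext_iff]; simp only [Fin.val_zero, v2, v3]; omega
  · rw [Equiv.swap_apply_right]; rfl
  · exact congrArg _ (swap_fix (i := 0) (j := 3) j)

theorem permute_swap_inner : permute (Equiv.swap 1 2) (tup a b c e w) = tup a c b e w := by
  have v1 : ((1 : Fin (t + 4)) : ℕ) = 1 := Nat.mod_eq_of_lt (show 1 < t + 4 by omega)
  have v2 : ((2 : Fin (t + 4)) : ℕ) = 2 := Nat.mod_eq_of_lt (show 2 < t + 4 by omega)
  have v3 : ((3 : Fin (t + 4)) : ℕ) = 3 := Nat.mod_eq_of_lt (show 3 < t + 4 by omega)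
  ext i
  rw [permute, Equiv.swap_inv]
  rcases fin_add_four_cases i with rfl | rfl | rfl | rfl | ⟨j, rfl⟩
  · rw [Equiv.swap_apply_of_ne_of_ne]; rfl
    all_goals rw [Ne, Fin.ext_iff]; simp only [Fin.val_zero, v1, v2]; omega
  · rw [Equiv.swap_apply_left]; rfl
  · rw [Equiv.swap_apply_right]; rfl
  · rw [Equiv.swap_apply_of_ne_of_ne]; rfl
    all_goals rw [Ne, Fin.ext_iff]; simp only [v1, v2, v3]; omega
  · exact congrArg _ (swap_fix (i := 1) (j := 2) j)

theorem permute_mul {m : ℕ} (σ τ : Equiv.Perm (Fin m)) (w : Fin m → α) :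
    permute (σ * τ) w = permute σ (permute τ w) := by
  ext i; simp [permute, mul_inv_rev]

theorem sum_Htau (I : (Fin (t + 4) → α) → Prop) :
    ∑ σ ∈ elems (Htau t), ((Equiv.Perm.sign σ : ℤ) : ℝ) * ind (I (permute σ (tup a b c e w))) =
      ind (I (tup a b c e w)) - ind (I (tup e b c a w)) - ind (I (tup a c b e w)) +
        ind (I (tup e c b a w)) := by
  have v1 : ((1 : Fin (t + 4)) : ℕ) = 1 := Nat.mod_eq_of_lt (show 1 < t + 4 by omega)
  have v2 : ((2 : Fin (t + 4)) : ℕ) = 2 := Nat.mod_eq_of_lt (show 2 < t + 4 by omega)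
  have v3 : ((3 : Fin (t + 4)) : ℕ) = 3 := Nat.mod_eq_of_lt (show 3 < t + 4 by omega)
  have h03 : (0 : Fin (t + 4)) ≠ 3 := by rw [Ne, Fin.ext_iff, v3]; simp
  have h12 : (1 : Fin (t + 4)) ≠ 2 := by rw [Ne, Fin.ext_iff, v1, v2]; simp
  have h01 : (0 : Fin (t + 4)) ≠ 1 := by rw [Ne, Fin.ext_iff, v1]; simp
  have h02 : (0 : Fin (t + 4)) ≠ 2 := by rw [Ne, Fin.ext_iff, v2]; simp
  -- The four group elements have to be pairwise different before the sum over the finset can be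
  -- written out.
  have n1 : Equiv.swap (0 : Fin (t + 4)) 3 ≠ 1 := fun h => h03 (by
    simpa using (congrArg (fun σ => σ 0) h).symm)
  have n2 : Equiv.swap (1 : Fin (t + 4)) 2 ≠ 1 := fun h => h12 (by
    simpa using (congrArg (fun σ => σ 1) h).symm)
  have n3 : Equiv.swap (0 : Fin (t + 4)) 3 ≠ Equiv.swap 1 2 := fun h => h03 (by
    have := congrArg (fun σ => σ 0) h
    simp only [Equiv.swap_apply_left, Equiv.swap_apply_of_ne_of_ne h01 h02] at this
    exact this.symm)
  have n4 : (1 : Equiv.Perm (Fin (t + 4))) ≠ Equiv.swap 0 3 * Equiv.swap 1 2 := fun h => n3 (by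
    rw [eq_comm, mul_eq_one_iff_eq_inv] at h
    simpa using h)
  rw [elems_Htau, Finset.sum_insert, Finset.sum_insert, Finset.sum_insert, Finset.sum_singleton]
  · rw [permute_mul, permute_swap_inner, permute_swap_outer, permute_swap_outer]
    simp only [Equiv.Perm.sign_one, Equiv.Perm.sign_swap h03, Equiv.Perm.sign_swap h12,
      Equiv.Perm.sign_mul]
    have : permute (1 : Equiv.Perm (Fin (t + 4))) (tup a b c e w) = tup a b c e w := rfl
    rw [this]
    push_cast
    ring
  · simp [n1]
  · simp [n2, n3]
  · simp [n1.symm, n2.symm, n4]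

end

/-! ### Sums over distinct indices -/

/-- The sum over all quadruples of distinct elements. -/
noncomputable def dsum {ι : Type*} (T : Finset ι) (F : ι → ι → ι → ι → ℝ) : ℝ :=
  ∑ a ∈ T, ∑ b ∈ T, ∑ c ∈ T, ∑ e ∈ T,
    ind (a ≠ b ∧ a ≠ c ∧ a ≠ e ∧ b ≠ c ∧ b ≠ e ∧ c ≠ e) * F a b c e

/-- Inclusion-exclusion over coincidences. As `F` vanishes if `a = e` or `b = c`, only `a = b`, `a =
c`, `b = e` and `c = e` matter. Two of these that share an index force `a = e` or `b = c`, so only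
the pairs `a = b`, `c = e` and `a = c`, `b = e` survive together. The symmetries make the four
single contributions equal and the two double ones equal, whence the coefficients `-4` and `2`. -/
theorem dsum_eq {ι : Type*} (T : Finset ι) (F : ι → ι → ι → ι → ℝ)
    (h14 : ∀ a b c, F a b c a = 0) (h23 : ∀ a b e, F a b b e = 0)
    (s14 : ∀ a b c e, F e b c a = F a b c e) (s23 : ∀ a b c e, F a c b e = F a b c e) :
    dsum T F = ∑ a ∈ T, ∑ b ∈ T, ∑ c ∈ T, ∑ e ∈ T, F a b c e
      - 4 * ∑ a ∈ T, ∑ b ∈ T, ∑ c ∈ T, F a a b c + 2 * ∑ a ∈ T, ∑ b ∈ T, F a a b b := by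
  classical
  have pt : ∀ a b c e, ind (a ≠ b ∧ a ≠ c ∧ a ≠ e ∧ b ≠ c ∧ b ≠ e ∧ c ≠ e) * F a b c e =
      F a b c e - (if a = b then F a b c e else 0) - (if a = c then F a b c e else 0)
      - (if b = e then F a b c e else 0) - (if c = e then F a b c e else 0)
      + (if a = b then (if c = e then F a b c e else 0) else 0)
      + (if a = c then (if b = e then F a b c e else 0) else 0) := by
    intro a b c e
    by_cases h1 : a = e
    · subst h1; simp [h14]
    by_cases h2 : b = c
    · subst h2; simp [h23]
    by_cases h3 : a = b
    · subst h3
      by_cases h4 : c = e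
      · subst h4; simp [ind_def, h1]
      · simp [ind_def, h1, h2, h4]
    by_cases h4 : a = c
    · subst h4
      by_cases h5 : b = e
      · subst h5; simp [ind_def, h1]
      · simp [ind_def, h1, h3, h5]
    by_cases h5 : b = e
    · subst h5
      simp [ind_def, h3, h4, Ne.symm h2]
    by_cases h6 : c = e
    · subst h6; simp [ind_def, h3, h4, h5]
    simp [ind_def, h1, h2, h3, h4, h5, h6]
  have e1 : ∑ a ∈ T, ∑ b ∈ T, ∑ c ∈ T, ∑ e ∈ T, (if a = b then F a b c e else 0) =
      ∑ a ∈ T, ∑ b ∈ T, ∑ c ∈ T, F a a b c := by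
    refine Finset.sum_congr rfl fun a ha => ?_
    rw [Finset.sum_eq_single_of_mem a ha]
    · simp
    · intro b _ hb
      simp [Ne.symm hb]
  have e2 : ∑ a ∈ T, ∑ b ∈ T, ∑ c ∈ T, ∑ e ∈ T, (if a = c then F a b c e else 0) =
      ∑ a ∈ T, ∑ b ∈ T, ∑ c ∈ T, F a a b c := by
    rw [← e1]
    refine Finset.sum_congr rfl fun a ha => ?_
    rw [Finset.sum_comm]
    simp only [s23]
  have e3 : ∑ a ∈ T, ∑ b ∈ T, ∑ c ∈ T, ∑ e ∈ T, (if b = e then F a b c e else 0) =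
      ∑ a ∈ T, ∑ b ∈ T, ∑ c ∈ T, F a a b c := by
    have : ∑ a ∈ T, ∑ b ∈ T, ∑ c ∈ T, ∑ e ∈ T, (if b = e then F a b c e else 0) =
        ∑ b ∈ T, ∑ c ∈ T, ∑ a ∈ T, F b b c a := by
      rw [Finset.sum_comm]
      refine Finset.sum_congr rfl fun b hb => ?_
      rw [Finset.sum_comm]
      refine Finset.sum_congr rfl fun c _ => Finset.sum_congr rfl fun a _ => ?_
      rw [Finset.sum_eq_single_of_mem b hb]
      · simp [s14 b b c a]
      · intro e _ he
        simp [Ne.symm he]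
    exact this
  have e4 : ∑ a ∈ T, ∑ b ∈ T, ∑ c ∈ T, ∑ e ∈ T, (if c = e then F a b c e else 0) =
      ∑ a ∈ T, ∑ b ∈ T, ∑ c ∈ T, F a a b c := by
    rw [← e3]
    refine Finset.sum_congr rfl fun a ha => ?_
    rw [Finset.sum_comm]
    simp only [s23]
  have e5 : ∑ a ∈ T, ∑ b ∈ T, ∑ c ∈ T, ∑ e ∈ T,
      (if a = b then (if c = e then F a b c e else 0) else 0) =
      ∑ a ∈ T, ∑ b ∈ T, F a a b b := by
    refine Finset.sum_congr rfl fun a ha => ?_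
    rw [Finset.sum_eq_single_of_mem a ha]
    · refine Finset.sum_congr rfl fun c hc => ?_
      rw [Finset.sum_eq_single_of_mem c hc]
      · simp
      · intro e _ he
        simp [Ne.symm he]
    · intro b _ hb
      simp [Ne.symm hb]
  have e6 : ∑ a ∈ T, ∑ b ∈ T, ∑ c ∈ T, ∑ e ∈ T,
      (if a = c then (if b = e then F a b c e else 0) else 0) =
      ∑ a ∈ T, ∑ b ∈ T, F a a b b := by
    rw [← e5]
    refine Finset.sum_congr rfl fun a ha => ?_
    rw [Finset.sum_comm]
    simp only [s23]
  simp only [dsum, pt, Finset.sum_add_distrib, Finset.sum_sub_distrib, e1, e2, e3, e4, e5, e6]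
  ring

open Classical in
theorem sum_injective_succ {n k : ℕ} (f : (Fin (k + 1) → Fin n) → ℝ) :
    ∑ i ∈ Finset.univ.filter (fun i : Fin (k + 1) → Fin n => Function.Injective i), f i =
    ∑ i ∈ Finset.univ.filter (fun i : Fin k → Fin n => Function.Injective i),
      ∑ a ∈ Finset.univ.filter (fun a => a ∉ Set.range i), f (Fin.cons a i) := by
  rw [Finset.sum_sigma', eq_comm]
  refine Finset.sum_bij (fun p _ => Fin.cons p.2 p.1) ?_ ?_ ?_ ?_
  · rintro ⟨i, a⟩ h
    simp only [Finset.mem_sigma, Finset.mem_filter, Finset.mem_univ, true_and] at h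
    simp only [Finset.mem_filter, Finset.mem_univ, true_and]
    exact Fin.cons_injective_iff.mpr ⟨h.2, h.1⟩
  · rintro ⟨i, a⟩ _ ⟨i', a'⟩ _ h
    obtain ⟨rfl, rfl⟩ : a = a' ∧ i = i' := Fin.cons_injective2 h
    rfl
  · intro j hj
    simp only [Finset.mem_filter, Finset.mem_univ, true_and] at hj
    rw [← Fin.cons_self_tail j, Fin.cons_injective_iff] at hj
    exact ⟨⟨Fin.tail j, j 0⟩, by
      simp only [Finset.mem_sigma, Finset.mem_filter, Finset.mem_univ, true_and]
      exact ⟨hj.2, hj.1⟩, Fin.cons_self_tail j⟩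
  · rintro ⟨i, a⟩ _
    rfl

theorem sum_rev_four {ι : Type*} (T : Finset ι) (g : ι → ι → ι → ι → ℝ) :
    ∑ e ∈ T, ∑ c ∈ T, ∑ b ∈ T, ∑ a ∈ T, g a b c e =
      ∑ a ∈ T, ∑ b ∈ T, ∑ c ∈ T, ∑ e ∈ T, g a b c e := by
  have r3 : ∀ h : ι → ι → ι → ℝ, ∑ c ∈ T, ∑ b ∈ T, ∑ a ∈ T, h a b c =
      ∑ a ∈ T, ∑ b ∈ T, ∑ c ∈ T, h a b c := fun h => by
    rw [Finset.sum_congr rfl fun c _ => Finset.sum_comm, Finset.sum_comm]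
    exact Finset.sum_congr rfl fun a _ => Finset.sum_comm
  rw [Finset.sum_congr rfl fun e _ => r3 fun a b c => g a b c e, Finset.sum_comm]
  refine Finset.sum_congr rfl fun a _ => ?_
  rw [Finset.sum_comm]
  exact Finset.sum_congr rfl fun b _ => Finset.sum_comm

-- The last `t` entries, which define the cut point for `D` and `R`, are separated from the four
-- entries permuted by the group. For a fixed tail the inner sum runs over distinct quadruples
-- outside its range.
open Classical in
theorem sum_injective_tup {n t : ℕ} (f : (Fin (t + 4) → Fin n) → ℝ) :
    ∑ i ∈ Finset.univ.filter (fun i : Fin (t + 4) → Fin n => Function.Injective i), f i =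
    ∑ w ∈ Finset.univ.filter (fun w : Fin t → Fin n => Function.Injective w),
      dsum (Finset.univ.filter (fun a => a ∉ Set.range w)) fun a b c e => f (tup a b c e w) := by
  rw [sum_injective_succ, sum_injective_succ, sum_injective_succ, sum_injective_succ]
  refine Finset.sum_congr rfl fun w _ => ?_
  have hx : ∀ (k : ℕ) (x : Fin k → Fin n) (b : Fin n) (g : Fin n → ℝ),
      ∑ a ∈ Finset.univ.filter
        (fun a => a ∉ Set.range (Fin.cons b x : Fin (k + 1) → Fin n)), g a =
        ∑ a ∈ Finset.univ.filter (fun a => a ∉ Set.range x), ind (a ≠ b) * g a := by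
    intro k x b g
    rw [Finset.sum_filter, Finset.sum_filter]
    refine Finset.sum_congr rfl fun a _ => ?_
    have hr : a ∈ Set.range (Fin.cons b x : Fin (k + 1) → Fin n) ↔ a = b ∨ a ∈ Set.range x := by
      rw [Fin.range_cons, Set.mem_insert_iff]
    by_cases h1 : a = b
    · simp only [ind_def, h1]; simp
    · simp only [hr, ind_def, h1]; simp [h1]
  simp only [hx, dsum, Finset.mul_sum]
  rw [sum_rev_four]
  refine Finset.sum_congr rfl fun a _ => Finset.sum_congr rfl fun b _ => Finset.sum_congr rfl
    fun c _ => Finset.sum_congr rfl fun e _ => ?_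
  simp only [ind_and, tup]
  ring

/-! ### Hoeffding's polynomial -/

/-- The number of quadruples of distinct elements, weighted by the kernel of Hoeffding's `D`, in
a set of `N` elements among which `A` have the first property, `B` have the second one, and `P`
have both. -/
def hoef (N A B P : ℝ) : ℝ :=
  (2 * (N * P - A * B)) * (2 * (N * P - A * B))
    - 4 * (P * (N * N - 2 * N * B - 2 * N * A + 2 * N * P + 2 * A * B) + A * (B * B - 2 * B * P)
      + B * (A * A - 2 * A * P) + N * P * P)
    + 2 * (2 * N * P + 2 * A * B - 4 * P * B - 4 * A * P + 4 * P * P)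

/-- The summand is `g i l * g j k` with `g i j = (a i - a j) * (b i - b j)`. The three sums of
`dsum_eq` are therefore the square of the total of `g`, the sum of the squares of its row sums, and
the sum of the squares of its entries. Idempotence of `a` and `b` reduces each of them to a
polynomial in `N`, `A`, `B` and `P`. -/
theorem dsum_hoef {ι : Type*} (T : Finset ι) (a b : ι → ℝ) (ha : ∀ i, a i * a i = a i)
    (hb : ∀ i, b i * b i = b i) :
    dsum T (fun i j k l => (a i - a l) * (a j - a k) * ((b i - b l) * (b j - b k))) =
      hoef T.card (∑ i ∈ T, a i) (∑ i ∈ T, b i) (∑ i ∈ T, a i * b i) := by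
  rw [dsum_eq T _ (by intros; ring) (by intros; ring) (by intros; ring) (by intros; ring)]
  set A := ∑ i ∈ T, a i
  set B := ∑ i ∈ T, b i
  set P := ∑ i ∈ T, a i * b i
  set N := (T.card : ℝ)
  -- Modulo idempotence every function that occurs is a combination of `1`, `a`, `b` and `a * b`, so
  -- this formula evaluates all sums below.
  have lin : ∀ p q u v : ℝ, ∑ i ∈ T, (p + q * a i + u * b i + v * (a i * b i)) =
      N * p + q * A + u * B + v * P := by
    intro p q u v
    simp [Finset.sum_add_distrib, ← Finset.mul_sum, A, B, P, N]
  have g : ∀ i, ∑ j ∈ T, (a i - a j) * (b i - b j) = N * (a i * b i) - a i * B - b i * A + P := by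
    intro i
    rw [← Finset.sum_congr rfl (fun j _ => (by ring : a i * b i + (-b i) * a j + (-a i) * b j +
      1 * (a j * b j) = (a i - a j) * (b i - b j))), lin]
    ring
  have G : ∑ i ∈ T, ∑ j ∈ T, (a i - a j) * (b i - b j) = 2 * (N * P - A * B) := by
    simp only [g]
    rw [← Finset.sum_congr rfl (fun i _ => (by ring : P + (-B) * a i + (-A) * b i +
      N * (a i * b i) = N * (a i * b i) - a i * B - b i * A + P)), lin]
    ring
  have h1 : ∑ i ∈ T, ∑ j ∈ T, ∑ k ∈ T, ∑ l ∈ T,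
      (a i - a l) * (a j - a k) * ((b i - b l) * (b j - b k)) =
      (2 * (N * P - A * B)) * (2 * (N * P - A * B)) := by
    rw [← G, Finset.sum_mul]
    refine Finset.sum_congr rfl fun i _ => ?_
    rw [Finset.mul_sum]
    refine Finset.sum_congr rfl fun j _ => ?_
    rw [Finset.mul_sum]
    refine Finset.sum_congr rfl fun k _ => ?_
    rw [Finset.sum_mul]
    exact Finset.sum_congr rfl fun l _ => by ring
  have h2 : ∑ i ∈ T, ∑ j ∈ T, ∑ k ∈ T, (a i - a k) * (a i - a j) * ((b i - b k) * (b i - b j)) =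
      P * (N * N - 2 * N * B - 2 * N * A + 2 * N * P + 2 * A * B) + A * (B * B - 2 * B * P)
      + B * (A * A - 2 * A * P) + N * P * P := by
    have : ∀ i, ∑ j ∈ T, ∑ k ∈ T, (a i - a k) * (a i - a j) * ((b i - b k) * (b i - b j)) =
        P * P + (B * B - 2 * B * P) * a i + (A * A - 2 * A * P) * b i +
        (N * N - 2 * N * B - 2 * N * A + 2 * N * P + 2 * A * B) * (a i * b i) := by
      intro i
      have e : ∑ j ∈ T, ∑ k ∈ T, (a i - a k) * (a i - a j) * ((b i - b k) * (b i - b j)) =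
          (∑ j ∈ T, (a i - a j) * (b i - b j)) * ∑ j ∈ T, (a i - a j) * (b i - b j) := by
        rw [Finset.sum_mul]
        refine Finset.sum_congr rfl fun j _ => ?_
        rw [Finset.mul_sum]
        exact Finset.sum_congr rfl fun k _ => by ring
      rw [e, g]
      -- The multiples of `ha i` and `hb i` replace the squares of `a i` and `b i` by first powers.
      linear_combination (B * B + N * N * (b i * b i) - 2 * N * B * b i) * ha i +
        (A * A + N * N * a i - 2 * N * A * a i) * hb i
    simp only [this, lin]
    ring
  have h3 : ∑ i ∈ T, ∑ j ∈ T, (a i - a j) * (a i - a j) * ((b i - b j) * (b i - b j)) =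
      2 * N * P + 2 * A * B - 4 * P * B - 4 * A * P + 4 * P * P := by
    have : ∀ i, ∑ j ∈ T, (a i - a j) * (a i - a j) * ((b i - b j) * (b i - b j)) =
        N * (a i * b i) + A * (b i - 2 * (a i * b i)) + B * (a i - 2 * (a i * b i)) +
          P * (1 - 2 * a i - 2 * b i + 4 * (a i * b i)) := by
      intro i
      rw [← Finset.sum_congr rfl (fun j _ => (by
        linear_combination (-(b i * b i + b j * b j - 2 * (b i * b j))) * (ha i + ha j) -
          (a i + a j - 2 * a i * a j) * (hb i + hb j) :
        a i * b i + (b i - 2 * (a i * b i)) * a j + (a i - 2 * (a i * b i)) * b j +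
        (1 - 2 * a i - 2 * b i + 4 * (a i * b i)) * (a j * b j) =
        (a i - a j) * (a i - a j) * ((b i - b j) * (b i - b j)))), lin]
      ring
    simp only [this]
    rw [← Finset.sum_congr rfl (fun i _ => (by ring : P + (B - 2 * P) * a i + (A - 2 * P) * b i +
      (N - 2 * A - 2 * B + 4 * P) * (a i * b i) = N * (a i * b i) + A * (b i - 2 * (a i * b i)) +
      B * (a i - 2 * (a i * b i)) + P * (1 - 2 * a i - 2 * b i + 4 * (a i * b i)))), lin]
    ring
  rw [h1, h2, h3, hoef]

/-! ## The naive programs -/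

/-- The memory holds the sample `z` in the real arrays `0, …, r + s - 1`. -/
structure Holds {r s n : ℕ} (z : Fin n → Obs r s) (σ : Mem) : Prop where
  fst : ∀ (i : Fin n) (j : Fin r), σ.real j i = (z i).1 j
  snd : ∀ (i : Fin n) (j : Fin s), σ.real (r + j) i = (z i).2 j

theorem holds_input {r s n : ℕ} (z : Fin n → Obs r s) : Holds z (input z) :=
  ⟨fun i j => by simp [input], fun i j => by simp [input]⟩

theorem Holds.of_real_eq {r s n : ℕ} {z : Fin n → Obs r s} {σ τ : Mem} (h : Holds z σ)
    (hτ : ∀ a < r + s, τ.real a = σ.real a) : Holds z τ :=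
  ⟨fun i j => by rw [hτ _ (by omega), h.fst], fun i j => by rw [hτ _ (by omega), h.snd]⟩

section
variable {r s n : ℕ} {z : Fin n → Obs r s} {σ : Mem}

theorem Holds.le_fst (h : Holds z σ) (i j : Fin n) :
    (∀ k < r, σ.real (0 + k) i ≤ σ.real (0 + k) j) ↔ (z i).1 ≤ (z j).1 := by
  simp only [zero_add]
  exact ⟨fun H k => by rw [← h.fst, ← h.fst]; exact H k k.2, fun H k hk => by
    have := H ⟨k, hk⟩
    rwa [← h.fst, ← h.fst] at this⟩

theorem Holds.le_snd (h : Holds z σ) (i j : Fin n) :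
    (∀ k < s, σ.real (r + k) i ≤ σ.real (r + k) j) ↔ (z i).2 ≤ (z j).2 :=
  ⟨fun H k => by rw [← h.snd, ← h.snd]; exact H k k.2, fun H k hk => by
    have := H ⟨k, hk⟩
    rwa [← h.snd, ← h.snd] at this⟩

theorem Holds.lt_fst (h : Holds z σ) (i j : Fin n) :
    (∀ k < r, σ.real (0 + k) i < σ.real (0 + k) j) ↔ StrongLT (z i).1 (z j).1 := by
  simp only [zero_add]
  exact ⟨fun H k => by rw [← h.fst, ← h.fst]; exact H k k.2, fun H k hk => by
    have := H ⟨k, hk⟩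
    rwa [← h.fst, ← h.fst] at this⟩

theorem Holds.lt_snd (h : Holds z σ) (i j : Fin n) :
    (∀ k < s, σ.real (r + k) i < σ.real (r + k) j) ↔ StrongLT (z i).2 (z j).2 :=
  ⟨fun H k => by rw [← h.snd, ← h.snd]; exact H k k.2, fun H k hk => by
    have := H ⟨k, hk⟩
    rwa [← h.snd, ← h.snd] at this⟩

end

theorem eval_expD {σ : Mem} {off d n : ℕ} {x : Fin n → Fin d → ℝ}
    (hle : ∀ i j : Fin n, (∀ k < d, σ.real (off + k) i ≤ σ.real (off + k) j) ↔ x i ≤ x j)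
    (w : Fin (1 + 4) → NExp) (i : Fin (1 + 4) → Fin n) (hw : ∀ a, (w a).eval σ = i a) :
    (expD off d w).eval σ = ind (indD fun a => x (i a)) := by
  simp only [expD, RExp.eval_and4, RExp.eval_neg, eval_leExp, hw, hle, indD, Splits, ind_and,
    ind_not]
  ring

theorem eval_expP {σ : Mem} {off d n : ℕ} {x : Fin n → Fin d → ℝ}
    (hle : ∀ i j : Fin n, (∀ k < d, σ.real (off + k) i ≤ σ.real (off + k) j) ↔ x i ≤ x j)
    (w : Fin (0 + 4) → NExp) (i : Fin (0 + 4) → Fin n) (hw : ∀ a, (w a).eval σ = i a) :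
    (expP off d w).eval σ = ind (indP fun a => x (i a)) := by
  simp only [expP, RExp.eval_and4, RExp.eval_neg, eval_leExp, hw, hle, indP, ind_and, ind_not]
  ring

theorem eval_expJ {σ : Mem} {off d n : ℕ} {x : Fin n → Fin d → ℝ}
    (hlt : ∀ i j : Fin n, (∀ k < d, σ.real (off + k) i < σ.real (off + k) j) ↔
      StrongLT (x i) (x j))
    (w : Fin (0 + 4) → NExp) (i : Fin (0 + 4) → Fin n) (hw : ∀ a, (w a).eval σ = i a) :
    (expJ off d w).eval σ = ind (indJ fun a => x (i a)) := by
  simp only [expJ, RExp.eval_and4, eval_ltExp, hw, hlt, indJ, ind_and]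
  ring

theorem eval_expR {σ : Mem} {t off d n : ℕ} (htd : off + d ≤ t) {x : Fin n → Fin d → ℝ}
    (hx : ∀ (i : Fin n) (k : Fin d), σ.real (off + k) i = x i k)
    (w : Fin (t + 4) → NExp) (i : Fin (t + 4) → Fin n) (hw : ∀ a, (w a).eval σ = i a) :
    (expR off d w).eval σ = ind (Splits (fun a => x (i a))
      (fun k : Fin d => x (i ⟨4 + (off + k), by omega⟩) k)) := by
  have key : ∀ a : Fin (t + 4), (cutExp off d w (w a)).eval σ =
      ind (x (i a) ≤ fun k : Fin d => x (i ⟨4 + (off + k), by omega⟩) k) := by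
    intro a
    simp only [cutExp, RExp.eval_prod, RExp.eval]
    rw [prod_ind]
    refine ind_congr ⟨fun H k => ?_, fun H k hk => ?_⟩
    -- The bound `off + d ≤ t` excludes the default branch of `cutExp`.
    · have hk : 4 + (off + (k : ℕ)) < t + 4 := by omega
      have := H k (by simp)
      rw [dif_pos hk] at this
      simpa only [NExp.eval, hw, hx] using this
    · rw [Finset.mem_range] at hk
      have hk' : 4 + (off + k) < t + 4 := by omega
      rw [dif_pos hk']
      have := H ⟨k, hk⟩
      simp only [← hx] at this
      simpa only [NExp.eval, hw] using this
  simp only [expR, RExp.eval_and4, RExp.eval_neg, key, Splits, ind_and, ind_not]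
  ring

theorem eval_symKernelExp {m r s n : ℕ} (H : Subgroup (Equiv.Perm (Fin m)))
    (IX : (Fin m → Fin r → ℝ) → Prop) (IY : (Fin m → Fin s → ℝ) → Prop)
    (EX EY : (Fin m → NExp) → RExp) (z : Fin n → Obs r s) (σ : Mem)
    (hX : ∀ (w : Fin m → NExp) (i : Fin m → Fin n), (∀ a, (w a).eval σ = i a) →
      (EX w).eval σ = ind (IX fun a => (z (i a)).1))
    (hY : ∀ (w : Fin m → NExp) (i : Fin m → Fin n), (∀ a, (w a).eval σ = i a) →
      (EY w).eval σ = ind (IY fun a => (z (i a)).2))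
    (w : Fin m → NExp) (i : Fin m → Fin n) (hw : ∀ a, (w a).eval σ = i a) :
    (symKernelExp H EX EY w).eval σ = symKernel H IX IY fun a => z (i a) := by
  have hk : ∀ (w : Fin m → NExp) (i : Fin m → Fin n), (∀ a, (w a).eval σ = i a) →
      (kernelExp H EX EY w).eval σ = kernel H IX IY fun a => z (i a) := by
    intro w i hw
    simp only [kernelExp, RExp.eval, RExp.eval_sum, RExp.eval_signed, kernel]
    congr 1
    · refine Finset.sum_congr rfl fun γ _ => ?_
      rw [hX (permute γ w) (permute γ i) fun a => hw _]; rfl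
    · refine Finset.sum_congr rfl fun γ _ => ?_
      rw [hY (permute γ w) (permute γ i) fun a => hw _]; rfl
  simp only [symKernelExp, RExp.eval, RExp.eval_sum, RExp.eval_num, symKernel]
  rw [div_eq_inv_mul, one_div]
  congr 1
  refine Finset.sum_congr rfl fun γ _ => ?_
  rw [hk (permute γ w) (permute γ i) fun a => hw _]; rfl

/-! ### Nested loops and increasing index tuples -/

/-- The sum of `g` over all `lo ≤ v_p < v_{p+1} < ⋯ < v_{p+k-1} < n`. -/
noncomputable def nestSum (n : ℕ) (g : (ℕ → ℕ) → ℝ) : ℕ → ℕ → ℕ → (ℕ → ℕ) → ℝ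
  | 0, _, _, v => g v
  | k + 1, p, lo, v => ∑ i ∈ Finset.Ico lo n, nestSum n g k (p + 1) (i + 1) (Function.update v p i)

/-- The loop variables read off the memory and those tracked by updates agree only on the indices
`1, …, m`; this is enough because `g` looks at nothing else. -/
theorem nestSum_congr (n : ℕ) (g : (ℕ → ℕ) → ℝ) (m : ℕ)
    (hg : ∀ v v' : ℕ → ℕ, (∀ q, 1 ≤ q → q ≤ m → v q = v' q) → g v = g v')
    (k p lo : ℕ) (hpk : p + k = m + 1) (v v' : ℕ → ℕ)
    (hv : ∀ q, 1 ≤ q → q < p → v q = v' q) : nestSum n g k p lo v = nestSum n g k p lo v' := by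
  induction k generalizing p lo v v' with
  | zero => exact hg _ _ fun q h1 h2 => hv q h1 (by omega)
  | succ k ih =>
    simp only [nestSum]
    refine Finset.sum_congr rfl fun i _ => ih _ _ (by omega) _ _ fun q h1 h2 => ?_
    by_cases h : q = p
    · simp [h]
    · simp only [Function.update_of_ne h]; exact hv q h1 (by omega)

theorem Fin.strictMono_cons_iff {n k : ℕ} (a : Fin n) (x : Fin k → Fin n) :
    StrictMono (Fin.cons a x : Fin (k + 1) → Fin n) ↔ StrictMono x ∧ ∀ j, a < x j := by
  constructor
  · refine fun h => ⟨fun i j hij => ?_, fun j => ?_⟩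
    · simpa using h (Fin.succ_lt_succ_iff.mpr hij)
    · simpa using h (Fin.succ_pos j)
  · rintro ⟨h1, h2⟩ i j hij
    refine Fin.cases ?_ (fun j => ?_) j hij
    · intro hij; simp at hij
    · refine Fin.cases (fun _ => by simpa using h2 j) (fun i hij => ?_) i
      simpa using h1 (Fin.succ_lt_succ_iff.mp hij)

theorem sum_fin_cons {n k : ℕ} (F : (Fin (k + 1) → Fin n) → ℝ) :
    ∑ i, F i = ∑ a : Fin n, ∑ x : Fin k → Fin n, F (Fin.cons a x) := by
  rw [← (Fin.consEquiv (fun _ => Fin n)).sum_comp, Fintype.sum_prod_type]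
  rfl

/-- The values `v` with `v_p, …, v_{p+k-1}` replaced by `i`. -/
def setVars {n k : ℕ} (p : ℕ) (i : Fin k → Fin n) (v : ℕ → ℕ) : ℕ → ℕ :=
  fun q => if h : p ≤ q ∧ q < p + k then i ⟨q - p, by omega⟩ else v q

theorem setVars_cons {n k : ℕ} (p : ℕ) (a : Fin n) (x : Fin k → Fin n) (v : ℕ → ℕ) :
    setVars p (Fin.cons a x : Fin (k + 1) → Fin n) v =
      setVars (p + 1) x (Function.update v p a) := by
  ext q
  by_cases h1 : q = p
  · subst h1; simp [setVars]
  by_cases h2 : p + 1 ≤ q ∧ q < p + 1 + k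
  · have h3 : p ≤ q ∧ q < p + (k + 1) := by omega
    have : (⟨q - p, by omega⟩ : Fin (k + 1)) = Fin.succ ⟨q - (p + 1), by omega⟩ := by
      ext; simp; omega
    simp only [setVars, dif_pos h2, dif_pos h3, this, Fin.cons_succ]
  · have h3 : ¬ (p ≤ q ∧ q < p + (k + 1)) := by omega
    simp only [setVars, dif_neg h2, dif_neg h3, Function.update_of_ne h1]

-- Starting each sum at the successor of the previous index enforces strict monotonicity one step at
-- a time.
open Classical in
theorem nestSum_eq (n : ℕ) (g : (ℕ → ℕ) → ℝ) (k p lo : ℕ) (v : ℕ → ℕ) :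
    nestSum n g k p lo v = ∑ i : Fin k → Fin n,
      if StrictMono i ∧ ∀ a, lo ≤ i a then g (setVars p i v) else 0 := by
  induction k generalizing p lo v with
  | zero =>
    have hv : ∀ i : Fin 0 → Fin n, setVars p i v = v := fun i => by
      ext q; simp [setVars]
    simp [nestSum, hv, Subsingleton.strictMono]
  | succ k ih =>
    have hI : Finset.Ico lo n = (Finset.range n).filter (fun i => lo ≤ i) := by
      ext i; simp [and_comm]
    rw [nestSum, sum_fin_cons, hI, Finset.sum_filter, Finset.sum_range]
    refine Finset.sum_congr rfl fun a _ => ?_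
    have hc : ∀ x : Fin k → Fin n, (StrictMono (Fin.cons a x : Fin (k + 1) → Fin n) ∧
        ∀ j, lo ≤ ((Fin.cons a x : Fin (k + 1) → Fin n) j : ℕ)) ↔
        lo ≤ a ∧ (StrictMono x ∧ ∀ j, (a : ℕ) + 1 ≤ x j) := by
      intro x
      rw [Fin.strictMono_cons_iff]
      constructor
      · rintro ⟨⟨h1, h2⟩, h3⟩
        exact ⟨by simpa using h3 0, h1, fun j => h2 j⟩
      · rintro ⟨h1, h2, h3⟩
        refine ⟨⟨h2, fun j => h3 j⟩, fun j => Fin.cases (by simpa using h1) (fun j => ?_) j⟩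
        have := h3 j
        simp only [Fin.cons_succ]
        omega
    simp only [hc, setVars_cons, ih]
    by_cases h : lo ≤ (a : ℕ) <;> simp [h]

theorem writesN_nest (body : Cmd) (k p a : ℕ) :
    (nest body k p).WritesN a ↔ body.WritesN a ∨ p ≤ a ∧ a < p + k := by
  induction k generalizing p with
  | zero => simp [nest]
  | succ k ih =>
    simp only [nest, Cmd.WritesN, ih]
    constructor
    · rintro (h | (h | h) | h)
      · exact Or.inr (by omega)
      · exact Or.inl h
      · exact Or.inr (by omega)
      · exact Or.inr (by omega)
    · rintro (h | h)
      · exact Or.inr (Or.inl (Or.inl h))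
      · by_cases h' : a = p
        · exact Or.inl h'
        · exact Or.inr (Or.inl (Or.inr (by omega)))

/-- The nested loops add up what the body adds to a cell. -/
theorem runs_nest {body : Cmd} {n m : ℕ} (c₁ c₂ : ℕ) {g₁ g₂ : (ℕ → ℕ) → ℝ} (Base : Mem → Prop)
    (hB : ∀ σ a i v, Base σ → Base (σ.setN a i v))
    (hbody : ∀ τ, Base τ → (∀ q, 1 ≤ q → q ≤ m → τ.nat q 0 < n) → Runs body τ 1 fun υ => Base υ ∧
      υ.real c₁ 0 = τ.real c₁ 0 + g₁ (fun q => τ.nat q 0) ∧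
      υ.real c₂ 0 = τ.real c₂ 0 + g₂ (fun q => τ.nat q 0))
    (hN : ∀ a, ¬ body.WritesN a)
    (hg₁ : ∀ v v' : ℕ → ℕ, (∀ q, 1 ≤ q → q ≤ m → v q = v' q) → g₁ v = g₁ v')
    (hg₂ : ∀ v v' : ℕ → ℕ, (∀ q, 1 ≤ q → q ≤ m → v q = v' q) → g₂ v = g₂ v')
    (k p : ℕ) (hp : 1 ≤ p) (hpk : p + k = m + 1) (lo : ℕ) (σ : Mem) (hσ : Base σ)
    (hn : σ.nat 0 0 = n) (hσ' : ∀ q, 1 ≤ q → q < p → σ.nat q 0 < n)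
    (hlo : lo ≤ n) (hlo' : lo = if p = 1 then 0 else σ.nat (p - 1) 0 + 1) :
    Runs (nest body k p) σ ((n + 1) ^ k) fun υ => Base υ ∧
      υ.real c₁ 0 = σ.real c₁ 0 + nestSum n g₁ k p lo (fun q => σ.nat q 0) ∧
      υ.real c₂ 0 = σ.real c₂ 0 + nestSum n g₂ k p lo (fun q => σ.nat q 0) := by
  induction k generalizing p lo σ with
  | zero => exact hbody σ hσ fun q h1 h2 => hσ' q h1 (by omega)
  | succ k ih =>
    have hpos : 1 ≤ (n + 1) ^ k := Nat.one_le_pow _ _ (by omega)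
    have hpos' : 1 ≤ (n + 1) ^ (k + 1) := Nat.one_le_pow _ _ (by omega)
    rw [nest]
    refine Runs.seq (Runs.setN hpos' ?_)
    have he : (if p = 1 then NExp.const 0 else
        NExp.add (NExp.var (p - 1)) (NExp.const 1)).eval σ = lo := by
      rw [hlo']; split_ifs <;> simp [NExp.eval]
    rw [he]
    set v₀ : ℕ → ℕ := fun q => σ.nat q 0
    refine Runs.loop (N := n) (f := (n + 1) ^ k)
      -- Both accumulators hold the partial sums over the values `lo, …, i - 1` of the current
      -- variable; the outer variables keep their initial values `v₀`.
      (fun i τ => Base τ ∧ (∀ q < p, τ.nat q 0 = v₀ q) ∧ τ.nat p 0 = i ∧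
        τ.real c₁ 0 = σ.real c₁ 0 + ∑ j ∈ Finset.Ico lo i,
          nestSum n g₁ k (p + 1) (j + 1) (Function.update v₀ p j) ∧
        τ.real c₂ 0 = σ.real c₂ 0 + ∑ j ∈ Finset.Ico lo i,
          nestSum n g₂ k (p + 1) (j + 1) (Function.update v₀ p j) ∧ lo ≤ i)
      hpos ?_ ?_ lo hlo ?_ ?_
    · rintro i hi τ - ⟨hb, hv, hvp, h1, h2, hloi⟩
      have h0 : τ.nat 0 0 = n := by rw [hv 0 (by omega), ← hn]
      refine ⟨by simp [Test.holds, h0, hvp, hi], Runs.seq ?_⟩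
      -- The inner loop starts at `i + 1 ≤ n`; in the case of equality it is empty.
      refine (ih (p + 1) (by omega) (by omega) (i + 1) τ hb h0 ?_ hi ?_).mono le_rfl ?_
      · intro q h1 h2
        by_cases h : q = p
        · rw [h, hvp]; exact hi
        · rw [hv q (by omega)]; exact hσ' q h1 (by omega)
      · simp [hvp]; omega
      · rintro υ hυ ⟨hb', h1', h2'⟩
        refine Runs.setN hpos ?_
        have hW : ∀ q ≤ p, υ.nat q 0 = τ.nat q 0 := fun q hq => by
          rw [hυ.nat]
          rw [writesN_nest]
          rintro (h | h)
          · exact hN _ h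
          · omega
        have hc : ∀ g : (ℕ → ℕ) → ℝ,
            (∀ v v' : ℕ → ℕ, (∀ q, 1 ≤ q → q ≤ m → v q = v' q) → g v = g v') →
            nestSum n g k (p + 1) (i + 1) (fun q => τ.nat q 0) =
            nestSum n g k (p + 1) (i + 1) (Function.update v₀ p i) := fun g hg => by
          refine nestSum_congr n g m hg _ _ _ (by omega) _ _ fun q _ hq => ?_
          by_cases h : q = p
          · simp [h, hvp]
          · rw [Function.update_of_ne h]; exact hv q (by omega)
        simp only [NExp.eval, NExp.eval_var, hW p le_rfl, hvp]
        refine ⟨hB _ _ _ _ hb', fun q hq => ?_, by simp, ?_, ?_, by omega⟩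
        · have : q ≠ p := by omega
          simp [this, hW q hq.le, hv q hq]
        · rw [Mem.setN_real, h1', h1, hc g₁ hg₁, Finset.sum_Ico_succ_top hloi, add_assoc]
        · rw [Mem.setN_real, h2', h2, hc g₂ hg₂, Finset.sum_Ico_succ_top hloi, add_assoc]
    · rintro τ - ⟨hb, hv, hvp, h1, h2, -⟩
      have h0 : τ.nat 0 0 = n := by rw [hv 0 (by omega), ← hn]
      exact ⟨by simp [Test.holds, h0, hvp], hb, h1, h2⟩
    · rw [pow_succ, mul_comm]
      exact Nat.mul_le_mul_left _ (by omega)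
    · refine ⟨hB _ _ _ _ hσ, fun q hq => ?_, by simp [NExp.eval], by simp, by simp, le_rfl⟩
      have : q ≠ p := by omega
      simp [this, v₀]

/-- The weight depends only on the program, so it can be absorbed in the constant; adding `1` makes
the constant visibly positive. -/
theorem computesInTime_of_runs {r s m : ℕ} {P : Cmd} {U : (n : ℕ) → (Fin n → Obs r s) → ℝ}
    {T : ℕ → ℝ} (f : ℕ → ℕ) (c : ℝ) (hc : 0 < c) (hT : ∀ n, m ≤ n → (f n : ℝ) ≤ c * T n)
    (h : ∀ n, m ≤ n → ∀ z : Fin n → Obs r s,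
      Runs P (input z) (f n) fun σ => σ.real (r + s) 0 = U n z) :
    ComputesInTime r s m P U T := by
  refine ⟨(P.weight + 1) * c, by positivity, fun n hn z => ?_⟩
  obtain ⟨σ, k, hx, hk, hq⟩ := h n hn z
  refine ⟨σ, k, hx, hq, ?_⟩
  have h1 : (k : ℝ) ≤ P.weight * f n := by exact_mod_cast hk
  have h2 := hT n hn
  have h3 : (0 : ℝ) ≤ f n := Nat.cast_nonneg _
  have h4 : (0 : ℝ) ≤ P.weight := Nat.cast_nonneg _
  nlinarith [mul_le_mul_of_nonneg_left h2 h4]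

theorem naive_computesInTime {m r s q : ℕ} (hm : 1 ≤ m) (H : Subgroup (Equiv.Perm (Fin m)))
    (IX : (Fin m → Fin r → ℝ) → Prop) (IY : (Fin m → Fin s → ℝ) → Prop)
    (EX EY : (Fin m → NExp) → RExp)
    (hX : ∀ (n : ℕ) (z : Fin n → Obs r s) (σ : Mem), Holds z σ →
      ∀ (w : Fin m → NExp) (i : Fin m → Fin n), (∀ a, (w a).eval σ = i a) →
      (EX w).eval σ = ind (IX fun a => (z (i a)).1))
    (hY : ∀ (n : ℕ) (z : Fin n → Obs r s) (σ : Mem), Holds z σ →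
      ∀ (w : Fin m → NExp) (i : Fin m → Fin n), (∀ a, (w a).eval σ = i a) →
      (EY w).eval σ = ind (IY fun a => (z (i a)).2)) :
    ComputesInTime r s m (naive (r + s) q H EX EY) (uStat (1 / q) H IX IY)
      (fun n => (n : ℝ) ^ m) := by
  classical
  refine computesInTime_of_runs (fun n => (n + 1) ^ m) (2 ^ m) (by positivity) ?_ ?_
  · intro n hn
    rw [← mul_pow]
    push_cast
    have : (1 : ℝ) ≤ n := by exact_mod_cast hm.trans hn
    gcongr
    linarith
  intro n hn z
  -- The loop rule needs a summand defined for all values of the variables; the default `0` is never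
  -- reached, since the loops keep the indices below `n`.
  let g : (ℕ → ℕ) → ℝ := fun v =>
    if h : ∀ a : Fin m, v (a + 1) < n then symKernel H IX IY fun a => z ⟨v (a + 1), h a⟩ else 0
  have hg : ∀ v v' : ℕ → ℕ, (∀ q, 1 ≤ q → q ≤ m → v q = v' q) → g v = g v' := by
    intro v v' h
    have : ∀ a : Fin m, v (a + 1) = v' (a + 1) := fun a => h _ (by omega) (by omega)
    simp only [g, this]
  have hgs : ∀ i : Fin m → Fin n, g (setVars 1 i fun q => (input z).nat q 0) =
      symKernel H IX IY fun a => z (i a) := by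
    intro i
    have h1 : ∀ a : Fin m, setVars 1 i (fun q => (input z).nat q 0) (a + 1) = i a := by
      intro a
      have : 1 ≤ (a : ℕ) + 1 ∧ (a : ℕ) + 1 < 1 + m := by omega
      simp only [setVars, dif_pos this]
      rfl
    simp only [g, h1]
    simp
  have hpos : 1 ≤ (n + 1) ^ m := Nat.one_le_pow _ _ (by omega)
  -- The second accumulator adds the constant `1` and thus ends up as the binomial coefficient by
  -- which the program divides.
  refine Runs.seq ((runs_nest (n := n) (m := m) (r + s) (r + s + 1) (g₁ := g) (g₂ := fun _ => 1)
    (Holds z) (fun σ a i v h => ⟨h.fst, h.snd⟩) ?_ (by simp [Cmd.WritesN]) hg (fun _ _ _ => rfl)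
    m 1 le_rfl (by omega) 0 (input z) (holds_input z) (by simp [input])
    (by intro q h1 h2; omega) (Nat.zero_le _) (by simp)).mono le_rfl ?_)
  · intro τ hτ hv
    refine Runs.seq (Runs.setR le_rfl (Runs.setR le_rfl ?_))
    have hv' : ∀ a : Fin m, τ.nat (a + 1) 0 < n := fun a => hv _ (by omega) (by omega)
    have he := eval_symKernelExp H IX IY EX EY z τ (hX n z τ hτ) (hY n z τ hτ)
      (fun a => NExp.var (a + 1)) (fun a => ⟨τ.nat (a + 1) 0, hv' a⟩) (fun a => rfl)
    refine ⟨hτ.of_real_eq fun a ha => ?_, ?_, ?_⟩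
    · ext j
      have h1 : a ≠ r + s := by omega
      have h2 : a ≠ r + s + 1 := by omega
      simp [h1, h2]
    · simp only [RExp.eval, NExp.eval, he, g, dif_pos hv']
      simp
    · simp [RExp.eval, NExp.eval, RExp.eval_num]
  · rintro τ - ⟨-, h1, h2⟩
    refine Runs.setR hpos ?_
    have i0 : ∀ a, r + s ≤ a → (input z).real a 0 = 0 := by
      intro a ha
      have e1 : ¬ a < r := by omega
      have e2 : ¬ a - r < s := by omega
      simp [input, e1, e2]
    simp only [RExp.eval, NExp.eval, RExp.eval_num, h1, h2, nestSum_eq, hgs, Mem.setR_real,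
      and_self, if_true, i0 _ le_rfl, i0 _ (Nat.le_succ _)]
    simp only [Nat.zero_le, implies_true, and_true, zero_add]
    rw [← Finset.sum_filter, ← Finset.sum_filter, uStat, ← Finset.mul_sum]
    simp only [Finset.sum_const, card_filter_strictMono, nsmul_eq_mul, mul_one, one_div]
    rw [div_eq_mul_inv, mul_inv]
    ring

theorem naiveD_computesInTime (r s : ℕ) :
    ComputesInTime r s 5 (naiveD r s) (UD r s) (fun n => (n : ℝ) ^ 5) := by
  have := naive_computesInTime (r := r) (s := s) (m := 1 + 4) (q := 4) (by norm_num) (Htau 1)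
    indD indD (expD 0 r) (expD r s) (fun n z σ h => eval_expD h.le_fst)
    (fun n z σ h => eval_expD h.le_snd)
  have e' : UD r s = uStat (1 / ((4 : ℕ) : ℝ)) (Htau 1) indD indD := by
    funext n z; simp [UD]
  rw [e']
  exact this

theorem naiveR_computesInTime (r s : ℕ) :
    ComputesInTime r s (r + s + 4) (naiveR r s) (UR r s) (fun n => (n : ℝ) ^ (4 + (r + s))) := by
  have := naive_computesInTime (r := r) (s := s) (m := r + s + 4) (q := 4) (by omega)
    (Htau (r + s)) indRX indRY (expR 0 r) (expR r s)
    (fun n z σ h w i hw => by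
      rw [eval_expR (x := fun i => (z i).1) (by omega) (fun i k => by rw [zero_add, h.fst])
        w i hw, indRX]
      simp only [zero_add])
    (fun n z σ h w i hw => by
      rw [eval_expR (x := fun i => (z i).2) (by omega) (fun i k => by rw [h.snd]) w i hw, indRY])
  have e : r + s + 4 = 4 + (r + s) := by omega
  rw [← e]
  have e' : UR r s = uStat (1 / ((4 : ℕ) : ℝ)) (Htau (r + s)) indRX indRY := by
    funext n z; simp [UR]
  rw [e']
  exact this

theorem naiveP_computesInTime (r s : ℕ) :
    ComputesInTime r s 4 (naiveP r s) (UP r s) (fun n => (n : ℝ) ^ 4) := by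
  have := naive_computesInTime (r := r) (s := s) (m := 0 + 4) (q := 1) (by norm_num) (Htau 0)
    indP indP (expP 0 r) (expP r s) (fun n z σ h => eval_expP h.le_fst)
    (fun n z σ h => eval_expP h.le_snd)
  have e' : UP r s = uStat (1 / ((1 : ℕ) : ℝ)) (Htau 0) indP indP := by
    funext n z; simp [UP]
  rw [e']
  exact this

theorem naiveJ_computesInTime (r s : ℕ) :
    ComputesInTime r s 4 (naiveJ r s) (UJ r s) (fun n => (n : ℝ) ^ 4) := by
  have := naive_computesInTime (r := r) (s := s) (m := 0 + 4) (q := 1) (by norm_num) (Htau 0)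
    indJ indJ (expJ 0 r) (expJ r s) (fun n z σ h => eval_expJ h.lt_fst)
    (fun n z σ h => eval_expJ h.lt_snd)
  have e' : UJ r s = uStat (1 / ((1 : ℕ) : ℝ)) (Htau 0) indJ indJ := by
    funext n z; simp [UJ]
  rw [e']
  exact this

/-! ## Sorting with a tournament tree -/

/-- Comparison of the indices `i` and `j` by their keys; ties are broken by the indices. -/
def LexLT (c : ℕ → ℝ) (i j : ℕ) : Prop := c i < c j ∨ c i = c j ∧ i < j

theorem LexLT.trans {c : ℕ → ℝ} {i j k : ℕ} (h : LexLT c i j) (h' : LexLT c j k) :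
    LexLT c i k := by
  rcases h with h | ⟨h, h1⟩ <;> rcases h' with h' | ⟨h', h2⟩
  · exact Or.inl (h.trans h')
  · exact Or.inl (h' ▸ h)
  · exact Or.inl (h ▸ h')
  · exact Or.inr ⟨h.trans h', h1.trans h2⟩

theorem LexLT.asymm {c : ℕ → ℝ} {i j : ℕ} (h : LexLT c i j) : ¬ LexLT c j i := by
  rintro h'
  rcases h.trans h' with h | h
  · exact lt_irrefl _ h
  · exact lt_irrefl _ h.2

/-- The winner of a match between `x`, from the left, and `y`, from the right. -/
noncomputable def winner (al : ℕ → ℕ) (c : ℕ → ℝ) (x y : ℕ) : ℕ :=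
  open Classical in
  if al y < 1 then x else if al x < 1 then y else if c y < c x then y else x

/-- `T` is a tournament tree with the players `0, …, M - 1`. -/
structure IsTree (M : ℕ) (T al : ℕ → ℕ) (c : ℕ → ℝ) : Prop where
  leaf : ∀ i < M, T (M + i) = i
  node : ∀ v, 1 ≤ v → v < M → T v = winner al c (T (2 * v)) (T (2 * v + 1))

/-- A node `v` of height `h` covers the leaves numbered from `v * 2 ^ h` up to `(v + 1) * 2 ^ h`,
excluded. The two bounds `h1` and `h2` say that these numbers are leaves. Induction on the height
compares the winners of the two halves. -/
theorem IsTree.subtree {M : ℕ} {T al : ℕ → ℕ} {c : ℕ → ℝ} (hT : IsTree M T al c) (_hM : 1 ≤ M)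
    (h v : ℕ) (h1 : M ≤ v * 2 ^ h) (h2 : (v + 1) * 2 ^ h ≤ 2 * M) :
    v * 2 ^ h ≤ M + T v ∧ M + T v < (v + 1) * 2 ^ h ∧
      ∀ i, v * 2 ^ h ≤ M + i → M + i < (v + 1) * 2 ^ h → 1 ≤ al i →
        1 ≤ al (T v) ∧ (i = T v ∨ LexLT c (T v) i) := by
  induction h generalizing v with
  | zero =>
    simp only [pow_zero, mul_one] at h1 h2 ⊢
    have : T v = v - M := by
      have := hT.leaf (v - M) (by omega)
      rwa [Nat.add_sub_cancel' h1] at this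
    refine ⟨by omega, by omega, fun i h3 h4 h5 => ?_⟩
    obtain rfl : i = T v := by omega
    exact ⟨h5, Or.inl rfl⟩
  | succ h ih =>
    have e1 : 2 * v * 2 ^ h = v * 2 ^ (h + 1) := by rw [pow_succ]; ring
    have e2 : (2 * v + 1) * 2 ^ h = v * 2 ^ (h + 1) + 2 ^ h := by rw [pow_succ]; ring
    have e3 : (2 * v + 1 + 1) * 2 ^ h = (v + 1) * 2 ^ (h + 1) := by rw [pow_succ]; ring
    have e4 : (v + 1) * 2 ^ (h + 1) = v * 2 ^ (h + 1) + 2 ^ h + 2 ^ h := by rw [pow_succ]; ring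
    have hp : 1 ≤ 2 ^ h := Nat.one_le_two_pow
    have hv1 : 1 ≤ v := by
      by_contra hv
      obtain rfl : v = 0 := by omega
      omega
    have hv2 : v < M := by
      have : (v + 1) * 1 ≤ (v + 1) * 2 ^ h := Nat.mul_le_mul_left _ hp
      rw [pow_succ, ← mul_assoc] at h2
      omega
    obtain ⟨l1, l2, l3⟩ := ih (2 * v) (by omega) (by omega)
    obtain ⟨r1, r2, r3⟩ := ih (2 * v + 1) (by omega) (by omega)
    rw [hT.node v hv1 hv2, winner]
    split_ifs with ha hb hc
    · refine ⟨by omega, by omega, fun i i1 i2 i3 => ?_⟩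
      by_cases hi : M + i < (2 * v + 1) * 2 ^ h
      · exact l3 i (by omega) hi i3
      · have := (r3 i (by omega) (by omega) i3).1
        omega
    · refine ⟨by omega, by omega, fun i i1 i2 i3 => ?_⟩
      by_cases hi : M + i < (2 * v + 1) * 2 ^ h
      · have := (l3 i (by omega) hi i3).1
        omega
      · exact r3 i (by omega) (by omega) i3
    · refine ⟨by omega, by omega, fun i i1 i2 i3 => ⟨by omega, ?_⟩⟩
      by_cases hi : M + i < (2 * v + 1) * 2 ^ h
      · right
        rcases (l3 i (by omega) hi i3).2 with h | h
        · rw [h]; exact Or.inl hc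
        · exact LexLT.trans (Or.inl hc) h
      · exact (r3 i (by omega) (by omega) i3).2
    -- Equal keys are won by the left player, whose index is smaller because its leaf lies further
    -- left.
    · have hlr : LexLT c (T (2 * v)) (T (2 * v + 1)) := by
        rcases lt_or_eq_of_le (not_lt.mp hc) with h | h
        · exact Or.inl h
        · exact Or.inr ⟨h, by omega⟩
      refine ⟨by omega, by omega, fun i i1 i2 i3 => ⟨by omega, ?_⟩⟩
      by_cases hi : M + i < (2 * v + 1) * 2 ^ h
      · exact (l3 i (by omega) hi i3).2
      · right
        rcases (r3 i (by omega) (by omega) i3).2 with h | h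
        · rw [h]; exact hlr
        · exact hlr.trans h

theorem IsTree.root {L : ℕ} {T al : ℕ → ℕ} {c : ℕ → ℝ} (hT : IsTree (2 ^ L) T al c) {i : ℕ}
    (hi : i < 2 ^ L) (hal : 1 ≤ al i) :
    T 1 < 2 ^ L ∧ 1 ≤ al (T 1) ∧ ∀ j < 2 ^ L, 1 ≤ al j → j = T 1 ∨ LexLT c (T 1) j := by
  obtain ⟨h1, h2, h3⟩ := hT.subtree Nat.one_le_two_pow L 1 (by omega) (by omega)
  exact ⟨by omega, (h3 i (by omega) (by omega) hal).1,
    fun j hj hj' => (h3 j (by omega) (by omega) hj').2⟩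

/-- A node whose subtree is won by `w` is an ancestor of the leaf of `w`. -/
theorem IsTree.ancestor {L : ℕ} {T al : ℕ → ℕ} {c : ℕ → ℝ} (hT : IsTree (2 ^ L) T al c) {u w : ℕ}
    (hu : 1 ≤ u) (hu' : u < 2 * 2 ^ L) (h : T u = w) : ∃ j, u = (2 ^ L + w) / 2 ^ j := by
  -- The node `u` has depth `Nat.log 2 u`, hence height `L - Nat.log 2 u`.
  have hk : Nat.log 2 u ≤ L := by
    have : u < 2 ^ (L + 1) := by rw [pow_succ]; omega
    have := Nat.log_lt_of_lt_pow (by omega) this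
    omega
  have h1 := Nat.pow_log_le_self 2 (x := u) (by omega)
  have h2 := Nat.lt_pow_succ_log_self (b := 2) (by norm_num) u
  have e : 2 ^ Nat.log 2 u * 2 ^ (L - Nat.log 2 u) = 2 ^ L := by
    rw [← pow_add, Nat.add_sub_cancel' hk]
  obtain ⟨a, b, -⟩ := hT.subtree Nat.one_le_two_pow (L - Nat.log 2 u) u
    (by rw [← e]; exact Nat.mul_le_mul_right _ h1)
    (by
      have : (u + 1) * 2 ^ (L - Nat.log 2 u) ≤ 2 ^ (Nat.log 2 u + 1) * 2 ^ (L - Nat.log 2 u) :=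
        Nat.mul_le_mul_right _ h2
      calc _ ≤ _ := this
        _ = 2 * 2 ^ L := by rw [pow_succ, ← e]; ring)
  refine ⟨L - Nat.log 2 u, ?_⟩
  rw [h] at a b
  symm
  rw [Nat.div_eq_iff (by positivity)]
  constructor
  · exact a
  · have : (u + 1) * 2 ^ (L - Nat.log 2 u) = u * 2 ^ (L - Nat.log 2 u) + 2 ^ (L - Nat.log 2 u) := by
      ring
    omega

theorem winner_update {al : ℕ → ℕ} {c : ℕ → ℝ} {w x y : ℕ} (hx : x ≠ w) (hy : y ≠ w) :
    winner (Function.update al w 0) c x y = winner al c x y := by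
  simp [winner, Function.update_of_ne hx, Function.update_of_ne hy]

/-- The tree is correct except at the ancestors of height more than `i` of the leaf of `w`. -/
structure IsTreeExcept (L w i : ℕ) (T al : ℕ → ℕ) (c : ℕ → ℝ) : Prop where
  leaf : ∀ j < 2 ^ L, T (2 ^ L + j) = j
  node : ∀ v, 1 ≤ v → v < 2 ^ L → (∀ j, i ≤ j → v ≠ (2 ^ L + w) / 2 ^ (j + 1)) →
    T v = winner al c (T (2 * v)) (T (2 * v + 1))

/-- Removing the player `w` affects only the matches in which `w` takes part. The children concerned
are won by `w`, so by `ancestor` these matches are on the path from its leaf to the root. -/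
theorem IsTree.except {L : ℕ} {T al : ℕ → ℕ} {c : ℕ → ℝ} (hT : IsTree (2 ^ L) T al c) (w : ℕ) :
    IsTreeExcept L w 0 T (Function.update al w 0) c := by
  refine ⟨hT.leaf, fun v h1 h2 h3 => ?_⟩
  have key : ∀ u, u / 2 = v → u < 2 * 2 ^ L → T u ≠ w := fun u hu hu' h => by
    obtain ⟨j, hj⟩ := hT.ancestor (by omega) hu' h
    exact h3 j (Nat.zero_le _) (by rw [pow_succ, ← Nat.div_div_eq_div_mul, ← hj, hu])
  rw [hT.node v h1 h2, winner_update (key _ (by omega) (by omega)) (key _ (by omega) (by omega))]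

/-- Replaying the match at the ancestor of height `i + 1` repairs that node. The only match that
uses its result is at the next ancestor, which is still exempt. -/
theorem IsTreeExcept.step {L w i : ℕ} {T al : ℕ → ℕ} {c : ℕ → ℝ} (hT : IsTreeExcept L w i T al c)
    (hw : w < 2 ^ L) (hi : i < L) {v : ℕ} (hv : v = (2 ^ L + w) / 2 ^ (i + 1)) :
    IsTreeExcept L w (i + 1)
      (Function.update T v (winner al c (T (v + v)) (T (v + v + 1)))) al c := by
  have hv1 : 1 ≤ v := by
    rw [hv, Nat.one_le_div_iff (by positivity)]
    exact (Nat.pow_le_pow_right (by norm_num) hi).trans (Nat.le_add_right _ _)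
  have hv2 : v < 2 ^ L := by
    rw [hv, Nat.div_lt_iff_lt_mul (by positivity), pow_succ]
    have : 1 ≤ 2 ^ i := Nat.one_le_two_pow
    nlinarith
  refine ⟨fun j hj => ?_, fun u h1 h2 h3 => ?_⟩
  · rw [Function.update_of_ne (by omega)]; exact hT.leaf j hj
  -- No child of `u` is the updated node `v`, for otherwise `u` would be the next ancestor.
  · have hne : ∀ x, x / 2 = u → x ≠ v := fun x hx h => by
      refine h3 (i + 1) le_rfl ?_
      rw [pow_succ, ← Nat.div_div_eq_div_mul, ← hv, ← h, hx]
    rw [Function.update_of_ne (hne (2 * u) (by omega)),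
      Function.update_of_ne (hne (2 * u + 1) (by omega))]
    by_cases huv : u = v
    · subst huv
      rw [Function.update_self, two_mul]
    · rw [Function.update_of_ne huv]
      refine hT.node u h1 h2 fun j hj => ?_
      rcases Nat.eq_or_lt_of_le hj with rfl | hj
      · rw [← hv]; exact huv
      · exact h3 j hj

/-- Beyond height `L` the ancestor formula gives `0`, which is not a node, so no exception is left.
-/
theorem IsTreeExcept.isTree {L w : ℕ} {T al : ℕ → ℕ} {c : ℕ → ℝ} (hT : IsTreeExcept L w L T al c)
    (hw : w < 2 ^ L) : IsTree (2 ^ L) T al c := by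
  refine ⟨hT.leaf, fun v h1 h2 => hT.node v h1 h2 fun j hj h => ?_⟩
  have : (2 ^ L + w) / 2 ^ (j + 1) = 0 := by
    rw [Nat.div_eq_zero_iff]
    right
    calc 2 ^ L + w < 2 ^ (L + 1) := by rw [pow_succ]; omega
      _ ≤ 2 ^ (j + 1) := Nat.pow_le_pow_right (by norm_num) (by omega)
  omega

/-- `ord` lists the indices below `E` in the order of their keys, and `rank` is its inverse. -/
structure Sorted (E : ℕ) (ord rank : ℕ → ℕ) (c : ℕ → ℝ) : Prop where
  ord_rank : ∀ i < E, rank i < E ∧ ord (rank i) = i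
  rank_ord : ∀ t < E, ord t < E ∧ rank (ord t) = t
  lt_iff : ∀ i < E, ∀ j < E, (rank i < rank j ↔ LexLT c i j)

/-- The first `t` indices have been sorted. -/
structure PartSorted (E M t : ℕ) (al ord rank : ℕ → ℕ) (c : ℕ → ℝ) : Prop where
  lt : ∀ i < M, 1 ≤ al i → i < E
  dead : ∀ i < E, al i < 1 → rank i < t ∧ ord (rank i) = i
  ord : ∀ u < t, ord u < E ∧ al (ord u) < 1 ∧ rank (ord u) = u
  before : ∀ i < E, ∀ j < E, al i < 1 → 1 ≤ al j → LexLT c i j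
  sorted : ∀ i < E, ∀ j < E, al i < 1 → al j < 1 → rank i < rank j → LexLT c i j

/-- Pigeonhole: if all items below `E` were removed, `rank` would map them injectively into `t < E`
positions. -/
theorem PartSorted.exists_alive {E M t : ℕ} {al ord rank : ℕ → ℕ} {c : ℕ → ℝ}
    (h : PartSorted E M t al ord rank c) (ht : t < E) : ∃ i < E, 1 ≤ al i := by
  by_contra hc
  push Not at hc
  have := Finset.card_le_card_of_injOn (s := Finset.range E) (t := Finset.range t) rank
    (fun i hi => by simpa using (h.dead i (by simpa using hi) (hc i (by simpa using hi))).1)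
    (fun i hi j hj hij => by
      rw [← (h.dead i (by simpa using hi) (hc i (by simpa using hi))).2, hij,
        (h.dead j (by simpa using hj) (hc j (by simpa using hj))).2])
  simp at this
  omega

/-- The extracted item follows all removed ones by `before` and precedes all remaining ones by
`hmin`; it therefore belongs at position `t`. -/
theorem PartSorted.step {E M t : ℕ} {al ord rank : ℕ → ℕ} {c : ℕ → ℝ}
    (h : PartSorted E M t al ord rank c) {w : ℕ} (hw : w < E) (hal : 1 ≤ al w) (hEM : E ≤ M)
    (hmin : ∀ j < M, 1 ≤ al j → j = w ∨ LexLT c w j) :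
    PartSorted E M (t + 1) (Function.update al w 0) (Function.update ord t w)
      (Function.update rank w t) c := by
  have ha : ∀ i, Function.update al w 0 i = if i = w then 0 else al i := fun i => by
    rw [Function.update_apply]
  have ho : ∀ i, Function.update ord t w i = if i = t then w else ord i := fun i => by
    rw [Function.update_apply]
  have hr : ∀ i, Function.update rank w t i = if i = w then t else rank i := fun i => by
    rw [Function.update_apply]
  simp only [← funext_iff] at ha ho hr
  rw [ha, ho, hr]
  refine ⟨fun i hi hi' => ?_, fun i hi hi' => ?_, fun u hu => ?_, fun i hi j hj hi' hj' => ?_,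
    fun i hi j hj hi' hj' hij => ?_⟩
  · split_ifs at hi' with hiw
    · omega
    · exact h.lt i hi hi'
  · by_cases hiw : i = w
    · simp [hiw]
    · rw [if_neg hiw] at hi'
      obtain ⟨h1, h2⟩ := h.dead i hi hi'
      rw [if_neg hiw, if_neg (by omega)]
      exact ⟨by omega, h2⟩
  · by_cases hut : u = t
    · simp [hut, hw]
    · obtain ⟨h1, h2, h3⟩ := h.ord u (by omega)
      have : ord u ≠ w := by rintro h; rw [h] at h2; omega
      simp only [if_neg hut, if_neg this]
      exact ⟨h1, h2, h3⟩
  · have hjw : j ≠ w := by rintro rfl; simp at hj'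
    rw [if_neg hjw] at hj'
    by_cases hiw : i = w
    · subst hiw
      exact (hmin j (by omega) hj').resolve_left hjw
    · rw [if_neg hiw] at hi'
      exact h.before i hi j hj hi' hj'
  · by_cases hjw : j = w
    · subst hjw
      by_cases hiw : i = j
      · simp [hiw] at hij
      · rw [if_neg hiw] at hi'
        exact h.before i hi j hj hi' hal
    · rw [if_neg hjw] at hj' hij
      by_cases hiw : i = w
      · rw [if_pos hiw] at hij
        have := (h.dead j hj hj').1
        omega
      · rw [if_neg hiw] at hi' hij
        exact h.sorted i hi j hj hi' hj' hij

/-- After `E` extractions `ord` is an injection of the `E` items into themselves, hence onto, so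
every item has been removed. Asymmetry of `LexLT` turns the one-sided order statement into an
equivalence. -/
theorem PartSorted.sorted_of_all {E M : ℕ} {al ord rank : ℕ → ℕ} {c : ℕ → ℝ}
    (h : PartSorted E M E al ord rank c) : Sorted E ord rank c := by
  have hd : ∀ i < E, al i < 1 := by
    have hs : Set.SurjOn ord (Finset.range E) (Finset.range E) :=
      Finset.surjOn_of_injOn_of_card_le ord
        (fun u hu => by simpa using (h.ord u (by simpa using hu)).1)
        (fun u hu v hv huv => by
          rw [← (h.ord u (by simpa using hu)).2.2, huv, (h.ord v (by simpa using hv)).2.2]) le_rfl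
    intro i hi
    obtain ⟨u, hu, rfl⟩ := hs (show i ∈ (Finset.range E : Set ℕ) by simpa using hi)
    exact (h.ord u (by simpa using hu)).2.1
  refine ⟨fun i hi => h.dead i hi (hd i hi), fun t ht => ⟨(h.ord t ht).1, (h.ord t ht).2.2⟩,
    fun i hi j hj => ⟨h.sorted i hi j hj (hd i hi) (hd j hj), fun hij => ?_⟩⟩
  by_contra hc
  rcases Nat.eq_or_lt_of_le (not_lt.mp hc) with he | hlt
  · have : i = j := by rw [← (h.dead i hi (hd i hi)).2, ← he, (h.dead j hj (hd j hj)).2]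
    subst this
    exact hij.asymm hij
  · exact hij.asymm (h.sorted j hj i hi (hd j hj) (hd i hi) hlt)

/-! ## Sorting on the RAM -/

theorem Mem.setN_nat_of_ne {σ : Mem} {a i v b : ℕ} (h : b ≠ a) :
    (σ.setN a i v).nat b = σ.nat b := Function.update_of_ne h _ _

theorem Mem.setN_nat_self (σ : Mem) (a i v : ℕ) :
    (σ.setN a i v).nat a = Function.update (σ.nat a) i v := Function.update_self _ _ _

theorem Mem.setR_real_of_ne {σ : Mem} {a i b : ℕ} {v : ℝ} (h : b ≠ a) :
    (σ.setR a i v).real b = σ.real b := Function.update_of_ne h _ _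

/-- Assignment to a scalar variable. -/
def Cmd.setV (v : ℕ) (e : NExp) : Cmd := Cmd.setN v (NExp.const 0) e

theorem Runs.setV {v : ℕ} {e : NExp} {σ : Mem} {f : ℕ} {Q : Mem → Prop} (hf : 1 ≤ f)
    (h : Q (σ.setN v 0 (e.eval σ))) : Runs (Cmd.setV v e) σ f Q := Runs.setN hf h

@[simp] theorem Cmd.writesN_setV (v : ℕ) (e : NExp) (a : ℕ) :
    (Cmd.setV v e).WritesN a ↔ a = v := Iff.rfl

@[simp] theorem Cmd.writesR_setV (v : ℕ) (e : NExp) (a : ℕ) :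
    ¬ (Cmd.setV v e).WritesR a := id

/-- Computes the least power of two which is at least the number of items. -/
def initSize : Cmd :=
  Cmd.seq (Cmd.setV 2 (NExp.const 1)) (Cmd.seq (Cmd.setV 3 (NExp.const 0))
    (Cmd.for 4 (NExp.var 1) (Cmd.ite (Test.ltN (NExp.var 2) (NExp.var 1))
      (Cmd.seq (Cmd.setV 2 (NExp.add (NExp.var 2) (NExp.var 2)))
        (Cmd.setV 3 (NExp.add (NExp.var 3) (NExp.const 1)))) Cmd.nop)))

/-- After `i` rounds the exponent is the minimum of `i` and the logarithm, rounded up. The machine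
has no logarithm, but `E` rounds of doubling suffice because `E ≤ 2 ^ E`. -/
theorem runs_initSize {σ : Mem} {E : ℕ} (hE : σ.nat 1 0 = E) :
    Runs initSize σ (E + 1) fun τ => τ.nat 2 0 = 2 ^ Nat.clog 2 E ∧ τ.nat 3 0 = Nat.clog 2 E := by
  have hpos : 1 ≤ E + 1 := by omega
  refine Runs.seq (Runs.setV hpos (Runs.seq (Runs.setV hpos ?_)))
  refine Runs.for (N := E) (f := 1) (fun i τ => τ.nat 1 0 = E ∧
    τ.nat 2 0 = 2 ^ min i (Nat.clog 2 E) ∧ τ.nat 3 0 = min i (Nat.clog 2 E))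
    le_rfl (by omega) (by simp [Cmd.WritesN]) ?_ ?_ ?_ ?_
  · intro τ hτ
    rw [NExp.eval_var, hτ.nat 1 (by simp [Cmd.writesN_for, Cmd.WritesN])]
    simpa using hE
  · simp [NExp.eval, hE]
  · rintro i hi τ - hvi ⟨h1, h2, h3⟩
    have key : i < Nat.clog 2 E ↔ 2 ^ min i (Nat.clog 2 E) < E := by
      constructor
      · intro h
        rw [min_eq_left h.le]
        by_contra hc
        have := (Nat.clog_le_iff_le_pow (by norm_num)).mpr (not_lt.mp hc)
        omega
      · intro h
        by_contra hc
        rw [min_eq_right (not_lt.mp hc)] at h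
        exact absurd (Nat.le_pow_clog (by norm_num) E) (not_le.mpr h)
    refine Runs.ite le_rfl (fun h => ?_) fun h => ?_
    · rw [Test.holds, NExp.eval_var, NExp.eval_var, h1, h2, ← key] at h
      refine Runs.seq (Runs.setV le_rfl (Runs.setV le_rfl ?_))
      rw [min_eq_left h.le] at h2 h3
      simp [NExp.eval, h1, h2, h3, min_eq_left (Nat.succ_le_of_lt h), pow_succ, mul_two]
    · rw [Test.holds, NExp.eval_var, NExp.eval_var, h1, h2, ← key] at h
      refine Runs.nop le_rfl ?_
      rw [min_eq_right (not_lt.mp h)] at h2 h3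
      simp [h1, h2, h3, min_eq_right ((not_lt.mp h).trans (Nat.le_succ i))]
  · rintro τ - ⟨-, h2, h3⟩
    have : Nat.clog 2 E ≤ E := (Nat.clog_le_iff_le_pow (by norm_num)).mpr
      (Nat.lt_two_pow_self).le
    rw [min_eq_right this] at h2 h3
    exact ⟨h2, h3⟩

/-- The left sibling of a right child; no node for a left child. -/
def leftSibling (S c : ℕ) : ℕ := if c % 2 = 1 then c - 1 else S

/-- Tables for halving and for left siblings. -/
def initTables : Cmd :=
  Cmd.for 4 (NExp.var 2)
    (Cmd.seq (Cmd.setN 9 (NExp.add (NExp.var 4) (NExp.var 4)) (NExp.var 4))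
    (Cmd.seq (Cmd.setN 9 (NExp.add (NExp.add (NExp.var 4) (NExp.var 4)) (NExp.const 1)) (NExp.var 4))
    (Cmd.seq (Cmd.setN 10 (NExp.add (NExp.var 4) (NExp.var 4)) (NExp.var 2))
      (Cmd.setN 10 (NExp.add (NExp.add (NExp.var 4) (NExp.var 4)) (NExp.const 1))
        (NExp.add (NExp.var 4) (NExp.var 4))))))

/-- Natural numbers cannot be halved by an instruction. The table is filled in the opposite
direction: from `i` one reaches `2 * i` and `2 * i + 1` by addition. -/
theorem runs_initTables {σ : Mem} {M : ℕ} (hM : σ.nat 2 0 = M) :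
    Runs initTables σ (M + 1) fun τ => ∀ c < 2 * M, τ.nat 9 c = c / 2 ∧
      τ.nat 10 c = leftSibling M c := by
  have hM' : ∀ {τ}, Frame initTables σ τ → τ.nat 2 0 = M := fun {τ} hτ => by
    rw [hτ.nat 2 (by simp [initTables, Cmd.writesN_for, Cmd.WritesN]), hM]
  refine Runs.for (N := M) (f := 1) (fun i τ => ∀ c < 2 * i, τ.nat 9 c = c / 2 ∧
      τ.nat 10 c = leftSibling M c) le_rfl (by omega) (by simp [Cmd.WritesN]) (fun τ hτ => hM' hτ)
      (by simp) ?_ ?_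
  · rintro i hi τ hτ hvi h
    refine Runs.seq (Runs.setN le_rfl (Runs.seq (Runs.setN le_rfl (Runs.seq (Runs.setN le_rfl
      (Runs.setN le_rfl ?_))))))
    have h2 := hM' hτ
    intro c hc
    simp [NExp.eval, hvi, h2]
    by_cases h3 : c = i + i + 1
    · subst h3
      have : (i + i + 1) % 2 = 1 := by omega
      simp [leftSibling, this]
      omega
    by_cases h4 : c = i + i
    · subst h4
      have : ¬ (i + i) % 2 = 1 := by omega
      simp [leftSibling, this]
      omega
    simp [h3, h4]
    exact h c (by omega)
  · intro τ _ h
    exact h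

/-- The players of the arrays `11` (tree) and `12` (alive) at the children of the node `7`
play against each other; the keys are in the real array `c`. -/
def playOff (c : ℕ) : Cmd :=
  let l := NExp.load 11 (NExp.add (NExp.var 7) (NExp.var 7))
  let r := NExp.load 11 (NExp.add (NExp.add (NExp.var 7) (NExp.var 7)) (NExp.const 1))
  Cmd.ite (Test.ltN (NExp.load 12 r) (NExp.const 1)) (Cmd.setN 11 (NExp.var 7) l)
    (Cmd.ite (Test.ltN (NExp.load 12 l) (NExp.const 1)) (Cmd.setN 11 (NExp.var 7) r)
      (Cmd.ite (Test.ltR (RExp.load c r) (RExp.load c l)) (Cmd.setN 11 (NExp.var 7) r)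
        (Cmd.setN 11 (NExp.var 7) l)))

theorem writesN_playOff (c a : ℕ) : (playOff c).WritesN a ↔ a = 11 := by
  simp [playOff, Cmd.WritesN]

theorem writesR_playOff (c a : ℕ) : ¬ (playOff c).WritesR a := by
  simp [playOff, Cmd.WritesR]

theorem runs_playOff {c : ℕ} {σ : Mem} {f v : ℕ} {Q : Mem → Prop} (hf : 1 ≤ f)
    (hv : σ.nat 7 0 = v)
    (h : Q (σ.setN 11 v
      (winner (σ.nat 12) (σ.real c) (σ.nat 11 (v + v)) (σ.nat 11 (v + v + 1))))) :
    Runs (playOff c) σ f Q := by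
  simp only [winner] at h
  refine Runs.ite hf (fun h1 => ?_) fun h1 => ?_
  · simp only [Test.holds, NExp.eval, NExp.eval_var, hv] at h1
    refine Runs.setN hf ?_
    rw [if_pos h1] at h
    simpa only [NExp.eval, NExp.eval_var, hv] using h
  simp only [Test.holds, NExp.eval, NExp.eval_var, hv] at h1
  rw [if_neg h1] at h
  refine Runs.ite hf (fun h2 => ?_) fun h2 => ?_
  · simp only [Test.holds, NExp.eval, NExp.eval_var, hv] at h2
    refine Runs.setN hf ?_
    rw [if_pos h2] at h
    simpa only [NExp.eval, NExp.eval_var, hv] using h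
  simp only [Test.holds, NExp.eval, NExp.eval_var, hv] at h2
  rw [if_neg h2] at h
  refine Runs.ite hf (fun h3 => ?_) fun h3 => ?_
  · simp only [Test.holds, RExp.eval, NExp.eval, NExp.eval_var, hv] at h3
    refine Runs.setN hf ?_
    rw [if_pos h3] at h
    simpa only [NExp.eval, NExp.eval_var, hv] using h
  · simp only [Test.holds, RExp.eval, NExp.eval, NExp.eval_var, hv] at h3
    refine Runs.setN hf ?_
    rw [if_neg h3] at h
    simpa only [NExp.eval, NExp.eval_var, hv] using h

/-- The leaves of the tournament tree. -/
def initLeaves : Cmd :=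
  Cmd.for 4 (NExp.var 2)
    (Cmd.seq (Cmd.setN 11 (NExp.add (NExp.var 2) (NExp.var 4)) (NExp.var 4))
      (Cmd.ite (Test.ltN (NExp.var 4) (NExp.var 1)) (Cmd.setN 12 (NExp.var 4) (NExp.const 1))
        (Cmd.setN 12 (NExp.var 4) (NExp.const 0))))

/-- The inner nodes of the tournament tree. -/
def initNodes (c : ℕ) : Cmd :=
  Cmd.for 4 (NExp.var 2)
    (Cmd.seq (Cmd.setV 7 (NExp.sub (NExp.var 2) (NExp.add (NExp.var 4) (NExp.const 1)))) (playOff c))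

/-- The winner of the tournament becomes number `5` in the order, and is removed. -/
def extractMin (c rk : ℕ) : Cmd :=
  Cmd.seq (Cmd.setV 6 (NExp.load 11 (NExp.const 1)))
    (Cmd.seq (Cmd.setN 13 (NExp.var 5) (NExp.var 6))
    (Cmd.seq (Cmd.setN rk (NExp.var 6) (NExp.var 5))
    (Cmd.seq (Cmd.setN 12 (NExp.var 6) (NExp.const 0))
    (Cmd.seq (Cmd.setV 7 (NExp.load 9 (NExp.add (NExp.var 2) (NExp.var 6))))
      (Cmd.for 4 (NExp.var 3)
        (Cmd.seq (playOff c) (Cmd.setV 7 (NExp.load 9 (NExp.var 7)))))))))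

/-- Sorts the items by the keys in the real array `c`. -/
def sortCmd (c rk : ℕ) : Cmd :=
  Cmd.seq initLeaves (Cmd.seq (initNodes c) (Cmd.for 5 (NExp.var 1) (extractMin c rk)))

theorem writesN_sortCmd (c rk a : ℕ) : (sortCmd c rk).WritesN a →
    a = rk ∨ a = 4 ∨ a = 5 ∨ a = 6 ∨ a = 7 ∨ a = 11 ∨ a = 12 ∨ a = 13 := by
  simp only [sortCmd, initLeaves, initNodes, extractMin, Cmd.WritesN, Cmd.writesN_for,
    writesN_playOff, Cmd.writesN_setV]
  omega

theorem writesR_sortCmd (c rk a : ℕ) : ¬ (sortCmd c rk).WritesR a := by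
  simp [sortCmd, initLeaves, initNodes, extractMin, Cmd.WritesR, Cmd.writesR_for,
    writesR_playOff]

theorem runs_initLeaves {σ : Mem} {E M : ℕ} (hE : σ.nat 1 0 = E) (hM : σ.nat 2 0 = M) :
    Runs initLeaves σ (M + 1) fun τ => ∀ i < M, τ.nat 11 (M + i) = i ∧
      τ.nat 12 i = if i < E then 1 else 0 := by
  have hF : ∀ {τ}, Frame initLeaves σ τ → τ.nat 1 0 = E ∧ τ.nat 2 0 = M := fun {τ} hτ => by
    rw [hτ.nat 1 (by simp [initLeaves, Cmd.writesN_for, Cmd.WritesN]),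
      hτ.nat 2 (by simp [initLeaves, Cmd.writesN_for, Cmd.WritesN])]
    exact ⟨hE, hM⟩
  refine Runs.for (N := M) (f := 1) (fun t τ => ∀ i < t, τ.nat 11 (M + i) = i ∧
      τ.nat 12 i = if i < E then 1 else 0) le_rfl (by omega) (by simp [Cmd.WritesN])
      (fun τ hτ => (hF hτ).2) (by simp) ?_ (fun τ _ h => h)
  intro t ht τ hτ hv h
  obtain ⟨h1, h2⟩ := hF hτ
  refine Runs.seq (Runs.setN le_rfl (Runs.ite le_rfl (fun h3 => ?_) fun h3 => ?_))
  all_goals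
    simp [Test.holds, hv, h1] at h3
    refine Runs.setN le_rfl fun i hi => ?_
    by_cases hit : i = t
    · subst hit
      simp [NExp.eval, hv, h2]
      omega
    · have := h i (by omega)
      simpa [NExp.eval, hv, h2, hit] using this

theorem runs_initNodes {σ : Mem} {c L : ℕ} (hM : σ.nat 2 0 = 2 ^ L)
    (hl : ∀ i < 2 ^ L, σ.nat 11 (2 ^ L + i) = i) :
    Runs (initNodes c) σ (2 ^ L + 1) fun τ =>
      IsTree (2 ^ L) (τ.nat 11) (σ.nat 12) (σ.real c) := by
  have hF : ∀ {τ}, Frame (initNodes c) σ τ → τ.nat 2 0 = 2 ^ L ∧ τ.nat 12 = σ.nat 12 ∧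
      τ.real c = σ.real c := fun {τ} hτ => by
    rw [hτ.nat 12 (by simp [initNodes, Cmd.writesN_for, Cmd.WritesN, writesN_playOff]),
      hτ.nat 2 (by simp [initNodes, Cmd.writesN_for, Cmd.WritesN, writesN_playOff]),
      hτ.real c (by simp [initNodes, Cmd.writesR_for, Cmd.WritesR, writesR_playOff])]
    exact ⟨hM, rfl, rfl⟩
  -- Nodes are treated downwards from `2 ^ L - 1`, so children come before parents. The last round
  -- writes to position `0`, which is not a node.
  refine Runs.for (N := 2 ^ L) (f := 1) (fun t τ => (∀ i < 2 ^ L, τ.nat 11 (2 ^ L + i) = i) ∧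
    ∀ v, 1 ≤ v → v < 2 ^ L → 2 ^ L ≤ v + t → τ.nat 11 v =
      winner (σ.nat 12) (σ.real c) (τ.nat 11 (2 * v)) (τ.nat 11 (2 * v + 1))) le_rfl (by omega)
      (by simp [Cmd.WritesN, writesN_playOff]) (fun τ hτ => (hF hτ).1) ?_ ?_ ?_
  · refine ⟨by simpa using hl, fun v h1 h2 h3 => ?_⟩
    omega
  · rintro t ht τ hτ hv ⟨h1, h2⟩
    obtain ⟨f1, f2, f3⟩ := hF hτ
    refine Runs.seq (Runs.setV le_rfl (runs_playOff le_rfl (v := 2 ^ L - (t + 1)) ?_ ?_))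
    · simp [NExp.eval, f1, hv]
    have e12 : ∀ x, (τ.setN 7 0 x).nat 12 = τ.nat 12 := fun x => Mem.setN_nat_of_ne (by norm_num)
    simp only [e12, Mem.setN_real, f2, f3]
    refine ⟨fun i hi => ?_, fun v v1 v2 v3 => ?_⟩
    · have : 2 ^ L + i ≠ 2 ^ L - (t + 1) := by omega
      simpa [this] using h1 i hi
    · by_cases hv' : v = 2 ^ L - (t + 1)
      · have n1 : ¬ 2 * v = v := by omega
        have n2 : ¬ 2 * v + 1 = v := by omega
        simp [← hv', n1, n2, ← two_mul]
      · have n1 : 2 * v ≠ 2 ^ L - (t + 1) := by omega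
        have n2 : 2 * v + 1 ≠ 2 ^ L - (t + 1) := by omega
        simpa [hv', n1, n2] using h2 v v1 v2 (by omega)
  · rintro τ - ⟨h1, h2⟩
    exact ⟨h1, fun v v1 v2 => h2 v v1 v2 (by omega)⟩

/-- The root names the smallest remaining item. Its removal requires replaying only the `L` matches
above its leaf, which gives the logarithmic bound. -/
theorem runs_extractMin {σ : Mem} {c rk E L t : ℕ} (hrk : 14 ≤ rk) (hM : σ.nat 2 0 = 2 ^ L)
    (hL : σ.nat 3 0 = L) (hE : E ≤ 2 ^ L) (ht : σ.nat 5 0 = t) (htE : t < E)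
    (hhalf : ∀ c < 2 * 2 ^ L, σ.nat 9 c = c / 2)
    (hT : IsTree (2 ^ L) (σ.nat 11) (σ.nat 12) (σ.real c))
    (hS : PartSorted E (2 ^ L) t (σ.nat 12) (σ.nat 13) (σ.nat rk) (σ.real c)) :
    Runs (extractMin c rk) σ (L + 1) fun τ =>
      IsTree (2 ^ L) (τ.nat 11) (τ.nat 12) (σ.real c) ∧
      PartSorted E (2 ^ L) (t + 1) (τ.nat 12) (τ.nat 13) (τ.nat rk) (σ.real c) := by
  obtain ⟨i, hi, hal⟩ := hS.exists_alive htE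
  obtain ⟨w1, w2, w3⟩ := hT.root (hi.trans_le hE) hal
  set w := σ.nat 11 1 with hw
  have hwE : w < E := hS.lt w w1 w2
  have hpos : 1 ≤ L + 1 := by omega
  have r3 : rk ≠ 13 := by omega
  have r4 : rk ≠ 12 := by omega
  refine Runs.seq (Runs.setV hpos (Runs.seq (Runs.setN hpos (Runs.seq (Runs.setN hpos
    (Runs.seq (Runs.setN hpos (Runs.seq (Runs.setV hpos ?_)))))))))
  have q1 : ¬ 6 = rk := by omega
  have q2 : ¬ 9 = rk := by omega
  have q3 : ¬ 2 = rk := by omega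
  simp only [NExp.eval, NExp.eval_var, Mem.setN_nat, Nat.reduceEqDiff,
    false_and, if_false, and_true, if_true, q1, q2, q3, hM, ht, ← hw]
  set υ := ((((σ.setN 6 0 w).setN 13 t w).setN rk w t).setN 12 w 0).setN 7 0
    (σ.nat 9 (2 ^ L + w)) with hυ
  have u12 : υ.nat 12 = Function.update (σ.nat 12) w 0 := by
    rw [hυ, Mem.setN_nat_of_ne (by norm_num), Mem.setN_nat_self, Mem.setN_nat_of_ne (by omega),
      Mem.setN_nat_of_ne (by norm_num), Mem.setN_nat_of_ne (by norm_num)]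
  have u13 : υ.nat 13 = Function.update (σ.nat 13) t w := by
    rw [hυ, Mem.setN_nat_of_ne (by norm_num), Mem.setN_nat_of_ne (by norm_num),
      Mem.setN_nat_of_ne (by omega), Mem.setN_nat_self, Mem.setN_nat_of_ne (by norm_num)]
  have urk : υ.nat rk = Function.update (σ.nat rk) w t := by
    rw [hυ, Mem.setN_nat_of_ne (by omega), Mem.setN_nat_of_ne (by omega), Mem.setN_nat_self,
      Mem.setN_nat_of_ne (by omega), Mem.setN_nat_of_ne (by omega)]
  have uo : ∀ a, a ≠ 12 → a ≠ 13 → a ≠ rk → a ≠ 6 → a ≠ 7 → υ.nat a = σ.nat a :=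
    fun a h1 h2 h3 h4 h5 => by
      rw [hυ, Mem.setN_nat_of_ne h5, Mem.setN_nat_of_ne h1, Mem.setN_nat_of_ne h3,
        Mem.setN_nat_of_ne h2, Mem.setN_nat_of_ne h4]
  have u7 : υ.nat 7 0 = (2 ^ L + w) / 2 ^ (0 + 1) := by
    rw [hυ, Mem.setN_nat_self, Function.update_self, hhalf _ (by omega)]
    simp
  have hF : ∀ {τ}, Frame (Cmd.for 4 (NExp.var 3)
      (Cmd.seq (playOff c) (Cmd.setV 7 (NExp.load 9 (NExp.var 7))))) υ τ →
      (∀ a, a ≠ 4 → a ≠ 7 → a ≠ 11 → τ.nat a = υ.nat a) ∧ τ.real = σ.real := fun {τ} hτ => by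
    refine ⟨fun a h1 h2 h3 => hτ.nat a ?_, ?_⟩
    · simp [Cmd.writesN_for, Cmd.WritesN, writesN_playOff, h1, h2, h3]
    · ext a : 1
      rw [hτ.real a (by simp [Cmd.writesR_for, Cmd.WritesR, writesR_playOff])]
      rfl
  -- The variable `7` climbs from the parent of the leaf of `w` to the root, and below it the tree
  -- has already been repaired.
  refine Runs.for (N := L) (f := 1) (fun i τ => τ.nat 7 0 = (2 ^ L + w) / 2 ^ (i + 1) ∧
    IsTreeExcept L w i (τ.nat 11) (υ.nat 12) (σ.real c)) le_rfl (by omega)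
    (by simp [Cmd.WritesN, writesN_playOff]) ?_ ?_ ?_ ?_
  · intro τ hτ
    rw [NExp.eval_var, (hF hτ).1 3 (by norm_num) (by norm_num) (by norm_num),
      uo 3 (by norm_num) (by norm_num) (by omega) (by norm_num) (by norm_num), hL]
  · constructor
    · rw [Mem.setN_nat_of_ne (by norm_num)]
      exact u7
    · rw [Mem.setN_nat_of_ne (by norm_num),
        uo 11 (by norm_num) (by norm_num) (by omega) (by norm_num) (by norm_num), u12]
      exact hT.except w
  · rintro i hi τ hτ hv ⟨h1, h2⟩
    obtain ⟨f1, f2⟩ := hF hτ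
    refine Runs.seq (runs_playOff le_rfl h1 (Runs.setV le_rfl ?_))
    have hlt : (2 ^ L + w) / 2 ^ (i + 1) < 2 * 2 ^ L :=
      (Nat.div_le_self _ _).trans_lt (by omega)
    constructor
    · rw [Mem.setN_nat_of_ne (by norm_num), Mem.setN_nat_self, Function.update_self]
      simp only [NExp.eval, NExp.eval_var]
      rw [Mem.setN_nat_of_ne (by norm_num), Mem.setN_nat_of_ne (by norm_num), h1,
        f1 9 (by norm_num) (by norm_num) (by norm_num),
        uo 9 (by norm_num) (by norm_num) (by omega) (by norm_num) (by norm_num), hhalf _ hlt,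
        Nat.div_div_eq_div_mul, ← pow_succ]
    · rw [Mem.setN_nat_of_ne (by norm_num), Mem.setN_nat_of_ne (by norm_num), Mem.setN_nat_self,
        f2, f1 12 (by norm_num) (by norm_num) (by norm_num)]
      exact h2.step w1 hi rfl
  · rintro τ hτ ⟨-, h2⟩
    obtain ⟨f1, f2⟩ := hF hτ
    rw [f1 12 (by norm_num) (by norm_num) (by norm_num),
      f1 13 (by norm_num) (by norm_num) (by norm_num), f1 rk (by omega) (by omega) (by omega)]
    refine ⟨h2.isTree w1, ?_⟩
    rw [u12, u13, urk]
    exact hS.step hwE w2 hE w3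

/-- Building the tree is linear in `2 ^ L`, and each of the `E ≤ 2 ^ L` extractions costs `L + 1`.
-/
theorem runs_sortCmd {σ : Mem} {c rk E L : ℕ} (hrk : 14 ≤ rk) (h1 : σ.nat 1 0 = E)
    (hM : σ.nat 2 0 = 2 ^ L) (hL : σ.nat 3 0 = L) (hE : E ≤ 2 ^ L)
    (hhalf : ∀ c < 2 * 2 ^ L, σ.nat 9 c = c / 2) :
    Runs (sortCmd c rk) σ ((2 ^ L + 1) * (L + 1)) fun τ =>
      Sorted E (τ.nat 13) (τ.nat rk) (σ.real c) := by
  have hg : 2 ^ L + 1 ≤ (2 ^ L + 1) * (L + 1) := Nat.le_mul_of_pos_right _ (by omega)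
  refine Runs.seq ((runs_initLeaves h1 hM).mono hg fun τ hτ hl => ?_)
  have e2 : τ.nat 2 = σ.nat 2 := hτ.nat 2 (by simp [initLeaves, Cmd.writesN_for, Cmd.WritesN])
  have er : τ.real c = σ.real c :=
    hτ.real c (by simp [initLeaves, Cmd.writesR_for, Cmd.WritesR])
  refine Runs.seq ((runs_initNodes (c := c) (by rw [e2, hM]) fun i hi => (hl i hi).1).mono hg
    fun υ hυ hT => ?_)
  have hF : ∀ {ω}, Frame (Cmd.for 5 (NExp.var 1) (extractMin c rk)) υ ω →
      (∀ a, a ≠ rk → a ≠ 4 → a ≠ 5 → a ≠ 6 → a ≠ 7 → a ≠ 11 → a ≠ 12 → a ≠ 13 →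
        ω.nat a = σ.nat a) ∧ ω.real = υ.real := fun {ω} hω => by
    refine ⟨fun a a1 a2 a3 a4 a5 a6 a7 a8 => ?_, ?_⟩
    · rw [hω.nat, hυ.nat, hτ.nat]
      · simp [initLeaves, Cmd.writesN_for, Cmd.WritesN, a2, a6, a7]
      · simp [initNodes, Cmd.writesN_for, Cmd.WritesN, writesN_playOff, a2, a5, a6]
      · simp [extractMin, Cmd.writesN_for, Cmd.WritesN, writesN_playOff, a1, a2, a3, a4, a5, a6,
          a7, a8]
    · ext a : 1
      rw [hω.real]
      simp [extractMin, Cmd.writesR_for, Cmd.WritesR, writesR_playOff]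
  have ur : υ.real c = σ.real c := by
    rw [hυ.real, er]
    simp [initNodes, Cmd.writesR_for, Cmd.WritesR, writesR_playOff]
  have u12 : υ.nat 12 = τ.nat 12 := by
    rw [hυ.nat]
    simp [initNodes, Cmd.writesN_for, Cmd.WritesN, writesN_playOff]
  refine Runs.for (N := E) (f := L + 1) (fun t τ =>
    IsTree (2 ^ L) (τ.nat 11) (τ.nat 12) (σ.real c) ∧
    PartSorted E (2 ^ L) t (τ.nat 12) (τ.nat 13) (τ.nat rk) (σ.real c)) (by omega)
    (Nat.mul_le_mul_right _ (by omega))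
    (by simp [extractMin, Cmd.writesN_for, Cmd.WritesN, writesN_playOff]; omega) ?_ ?_ ?_ ?_
  · intro ω hω
    rw [NExp.eval_var, (hF hω).1 1, h1] <;> omega
  · rw [Mem.setN_nat_of_ne (by norm_num), Mem.setN_nat_of_ne (by norm_num),
      Mem.setN_nat_of_ne (by norm_num), Mem.setN_nat_of_ne (by omega), u12]
    -- At the start no item below `E` is removed, while the padding leaves from `E` on count as
    -- removed and never win against an item.
    rw [er] at hT
    refine ⟨hT, fun i hi hi' => ?_, fun i hi hi' => ?_, fun u hu => ?_,
      fun i hi j hj hi' hj' => ?_, fun i hi j hj hi' => ?_⟩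
    · rw [(hl i hi).2] at hi'
      by_contra hc
      rw [if_neg hc] at hi'
      omega
    · rw [(hl i (hi.trans_le hE)).2, if_pos hi] at hi'
      omega
    · omega
    · rw [(hl i (hi.trans_le hE)).2, if_pos hi] at hi'
      omega
    · rw [(hl i (hi.trans_le hE)).2, if_pos hi] at hi'
      omega
  · rintro t ht ω hω hv ⟨i1, i2⟩
    obtain ⟨f1, f2⟩ := hF hω
    have fr : ω.real c = σ.real c := by rw [f2, ur]
    have := runs_extractMin (σ := ω) (c := c) (rk := rk) (E := E) (L := L) (t := t) hrk
      (by rw [f1 2 (by omega), hM] <;> omega) (by rw [f1 3 (by omega), hL] <;> omega) hE hv ht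
      (fun x hx => by rw [f1 9 (by omega), hhalf x hx] <;> omega) (by rw [fr]; exact i1)
      (by rw [fr]; exact i2)
    refine this.mono le_rfl fun ξ _ hξ => ?_
    rw [fr] at hξ
    rw [Mem.setN_nat_of_ne (by norm_num), Mem.setN_nat_of_ne (by norm_num),
      Mem.setN_nat_of_ne (by norm_num), Mem.setN_nat_of_ne (by omega)]
    exact hξ
  · rintro ω - ⟨-, h⟩
    exact h.sorted_of_all

/-! ## Dominance sums -/

theorem leftSibling_eq_iff {S a b : ℕ} (ha : a < S) :
    a = leftSibling S b ↔ a / 2 = b / 2 ∧ a < b := by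
  rw [leftSibling]
  split_ifs with h <;> omega

/-- `a < b` is decided at a unique level of the binary expansions. -/
theorem sum_ind_leftSibling {S : ℕ} (L : ℕ) {a b : ℕ} (ha : a < S) (ha' : a < 2 ^ L)
    (hb : b < 2 ^ L) :
    ∑ l ∈ Finset.range L, ind (a / 2 ^ l = leftSibling S (b / 2 ^ l)) = ind (a < b) := by
  induction L generalizing a b with
  | zero =>
    have : ¬ a < b := by simp at ha' hb; omega
    simp [ind_false this]
  | succ L ih =>
    rw [pow_succ] at ha' hb
    rw [Finset.sum_range_succ']
    have e : ∀ x l, x / 2 ^ (l + 1) = x / 2 / 2 ^ l := fun x l => by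
      rw [pow_succ', Nat.div_div_eq_div_mul]
    simp only [e, pow_zero, Nat.div_one]
    rw [ih (by omega) (by omega) (by omega), ind_congr (leftSibling_eq_iff ha)]
    -- If the halves are already ordered, some higher level decides and level `0` contributes
    -- nothing; otherwise only equal halves can still give `a < b`, at level `0`.
    by_cases h1 : a / 2 < b / 2
    · rw [ind_true h1, ind_false (by omega), ind_true (by omega), add_zero]
    · rw [ind_false h1, zero_add]
      exact ind_congr (by omega)

theorem sum_radix_lt {S : ℕ} (K : ℕ) {a : ℕ → ℕ} (ha : ∀ k < K, a k ≤ S) :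
    ∑ k ∈ Finset.range K, a k * (S + 1) ^ k < (S + 1) ^ K := by
  induction K with
  | zero => simp
  | succ K ih =>
    rw [Finset.sum_range_succ, pow_succ]
    have h1 := ih fun k hk => ha k (by omega)
    have h2 := Nat.mul_le_mul_right ((S + 1) ^ K) (ha K (by omega))
    nlinarith

/-- Uniqueness of digits in base `S + 1` lets a tuple of nodes serve as a single address. Digits up
to `S` are allowed because `S` encodes a missing left sibling. -/
theorem sum_radix_inj {S : ℕ} (K : ℕ) {a b : ℕ → ℕ} (ha : ∀ k < K, a k ≤ S)
    (hb : ∀ k < K, b k ≤ S) :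
    ∑ k ∈ Finset.range K, a k * (S + 1) ^ k = ∑ k ∈ Finset.range K, b k * (S + 1) ^ k ↔
      ∀ k ∈ Finset.range K, a k = b k := by
  refine ⟨fun h => ?_, fun h => Finset.sum_congr rfl fun k hk => by rw [h k hk]⟩
  induction K with
  | zero => simp
  | succ K ih =>
    rw [Finset.sum_range_succ, Finset.sum_range_succ] at h
    have la := sum_radix_lt K fun k hk => ha k (Nat.lt_succ_of_lt hk)
    have lb := sum_radix_lt K fun k hk => hb k (Nat.lt_succ_of_lt hk)
    have hp : 0 < (S + 1) ^ K := by positivity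
    have hK : a K = b K := by
      have := congrArg (· / (S + 1) ^ K) h
      simpa [Nat.add_mul_div_right _ _ hp, Nat.div_eq_of_lt la, Nat.div_eq_of_lt lb] using this
    rw [hK, add_left_inj] at h
    have := ih (fun k hk => ha k (Nat.lt_succ_of_lt hk)) (fun k hk => hb k (Nat.lt_succ_of_lt hk)) h
    intro k hk
    rw [Finset.mem_range, Nat.lt_succ_iff_lt_or_eq] at hk
    rcases hk with hk | rfl
    · exact this k (Finset.mem_range.mpr hk)
    · exact hK

/-- The address of the counter which belongs to the item `6`; the current nodes of the item are in
the arrays `21 + 4 k`, and the array `22 + 4 k` holds the multiples of a power of the radix. -/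
def keyExp (sel : NExp → NExp) : ℕ → NExp
  | 0 => NExp.const 0
  | k + 1 => NExp.add (keyExp sel k)
      (NExp.load (22 + 4 * k) (sel (NExp.load (21 + 4 * k) (NExp.var 6))))

theorem eval_keyExp (sel : NExp → NExp) (K : ℕ) (σ : Mem) :
    (keyExp sel K).eval σ = ∑ k ∈ Finset.range K,
      σ.nat (22 + 4 * k) ((sel (NExp.load (21 + 4 * k) (NExp.var 6))).eval σ) := by
  induction K with
  | zero => rfl
  | succ K ih => rw [Finset.sum_range_succ, ← ih]; rfl

/-- Runs through the items in the order `13`, adds the counter of the left sibling of every item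
to its result and its weight to its own counter, and finally clears the counters. -/
def scan (B : ℕ) (kp kq : NExp) : Cmd :=
  Cmd.seq
    (Cmd.for 5 (NExp.var 1)
      (Cmd.seq (Cmd.setV 6 (NExp.load 13 (NExp.var 5)))
      (Cmd.seq (Cmd.setR (B + 2) (NExp.var 6)
          (RExp.add (RExp.load (B + 2) (NExp.var 6)) (RExp.load (B + 3) kq)))
        (Cmd.setR (B + 3) kp (RExp.add (RExp.load (B + 3) kp) (RExp.load (B + 1) (NExp.var 6)))))))
    (Cmd.for 4 (NExp.var 1)
      (Cmd.seq (Cmd.setV 6 (NExp.var 4)) (Cmd.setR (B + 3) kp (RExp.num 0))))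

theorem writesN_scan {B : ℕ} {kp kq : NExp} (a : ℕ) :
    (scan B kp kq).WritesN a ↔ a = 4 ∨ a = 5 ∨ a = 6 := by
  simp only [scan, Cmd.WritesN, Cmd.writesN_for, Cmd.writesN_setV]; tauto

theorem writesR_scan {B : ℕ} {kp kq : NExp} (a : ℕ) :
    (scan B kp kq).WritesR a ↔ a = B + 2 ∨ a = B + 3 := by
  simp only [scan, Cmd.WritesR, Cmd.writesR_for, Cmd.writesR_setV]; tauto

/-- `ord` and `rank` are inverse bijections, so positions before `q` may be reindexed by items of
smaller rank. -/
theorem Sorted.sum_range_rank {E : ℕ} {ord rank : ℕ → ℕ} {c : ℕ → ℝ} (h : Sorted E ord rank c)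
    {q : ℕ} (hq : q < E) (G : ℕ → ℝ) :
    ∑ u ∈ Finset.range (rank q), G (ord u) =
      ∑ p ∈ Finset.range E, ind (rank p < rank q) * G p := by
  have hb : ∑ p ∈ Finset.range E, ind (rank p < rank q) * G p =
      ∑ u ∈ Finset.range E, ind (u < rank q) * G (ord u) := by
    refine Finset.sum_nbij' rank ord ?_ ?_ ?_ ?_ ?_
    · intro p hp; simpa using (h.ord_rank p (by simpa using hp)).1
    · intro t ht; simpa using (h.rank_ord t (by simpa using ht)).1
    · intro p hp; exact (h.ord_rank p (by simpa using hp)).2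
    · intro t ht; exact (h.rank_ord t (by simpa using ht)).2
    · intro p hp; rw [(h.ord_rank p (by simpa using hp)).2]
  rw [hb]
  have hs : Finset.range (rank q) = (Finset.range E).filter (fun u => u < rank q) := by
    ext u
    have := (h.ord_rank q hq).1
    simp
    omega
  rw [hs, Finset.sum_filter]
  refine Finset.sum_congr rfl fun u _ => ?_
  by_cases hu : u < rank q <;> simp [ind_def, hu]

/-- Here `fp` is the address an item adds its weight to, and `fq` the address it reads. Reading
precedes adding, so an item sees exactly the weights of the items of strictly smaller rank. Counters
are cleared by revisiting the items: the address space is far larger than the time available, but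
only addresses of the form `fp p` have been touched. -/
theorem runs_scan {B E : ℕ} {kp kq : NExp} {σ : Mem} {rank : ℕ → ℕ} {c : ℕ → ℝ} (fp fq : ℕ → ℕ)
    (hE : σ.nat 1 0 = E) (hS : Sorted E (σ.nat 13) rank c)
    (hp : ∀ τ : Mem, ∀ w < E, (∀ a, a ≠ 4 → a ≠ 5 → a ≠ 6 → τ.nat a = σ.nat a) →
      τ.nat 6 0 = w → kp.eval τ = fp w)
    (hq : ∀ τ : Mem, ∀ w < E, (∀ a, a ≠ 4 → a ≠ 5 → a ≠ 6 → τ.nat a = σ.nat a) →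
      τ.nat 6 0 = w → kq.eval τ = fq w)
    (hcnt : ∀ x, σ.real (B + 3) x = 0) :
    Runs (scan B kp kq) σ (E + 1) fun τ => (∀ x, τ.real (B + 3) x = 0) ∧ ∀ q < E,
      τ.real (B + 2) q = σ.real (B + 2) q + ∑ p ∈ Finset.range E, σ.real (B + 1) p *
        (ind (rank p < rank q) * ind (fp p = fq q)) := by
  set ord := σ.nat 13 with hord
  have fN : ∀ {τ : Mem}, Frame (scan B kp kq) σ τ → ∀ a, a ≠ 4 → a ≠ 5 → a ≠ 6 →
      τ.nat a = σ.nat a := fun {τ} hτ a h1 h2 h3 => hτ.nat a (by rw [writesN_scan]; tauto)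
  have fR : ∀ {τ : Mem}, Frame (scan B kp kq) σ τ → τ.real (B + 1) = σ.real (B + 1) :=
    fun {τ} hτ => hτ.real _ (by rw [writesR_scan]; omega)
  refine Runs.seq (Runs.for (N := E) (f := 1) (fun t τ =>
    (∀ x, τ.real (B + 3) x = ∑ u ∈ Finset.range t, σ.real (B + 1) (ord u) * ind (fp (ord u) = x)) ∧
    ∀ q < E, τ.real (B + 2) q = σ.real (B + 2) q + if rank q < t then
      ∑ u ∈ Finset.range (rank q), σ.real (B + 1) (ord u) * ind (fp (ord u) = fq q) else 0)
    le_rfl (by omega) (by simp [Cmd.WritesN]) ?_ ?_ ?_ ?_)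
  · intro τ hτ
    have := fN (hτ.mono (q := scan B kp kq) (fun _ h => Or.inl h) (fun _ h => Or.inl h)) 1
      (by norm_num) (by norm_num) (by norm_num)
    simp [this, hE]
  · simpa using hcnt
  · rintro t ht τ hτ hv ⟨h1, h2⟩
    have hτ' : Frame (scan B kp kq) σ τ := hτ.mono (fun _ h => Or.inl h) (fun _ h => Or.inl h)
    have gN := fN hτ'
    have gR := fR hτ'
    obtain ⟨o1, o2⟩ := hS.rank_ord t ht
    refine Runs.seq (Runs.setV le_rfl (Runs.seq (Runs.setR le_rfl (Runs.setR le_rfl ?_))))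
    have ew : (NExp.load 13 (NExp.var 5)).eval τ = ord t := by
      simp [NExp.eval, hv, gN 13, hord]
    rw [ew]
    have kN : ∀ a, a ≠ 4 → a ≠ 5 → a ≠ 6 → (τ.setN 6 0 (ord t)).nat a = σ.nat a :=
      fun a a1 a2 a3 => by rw [Mem.setN_nat_of_ne a3, gN a a1 a2 a3]
    have ekp : kp.eval (τ.setN 6 0 (ord t)) = fp (ord t) := hp _ _ o1 kN (by simp)
    have ekq : kq.eval (τ.setN 6 0 (ord t)) = fq (ord t) := hq _ _ o1 kN (by simp)
    have ekp' : ∀ a i v, kp.eval ((τ.setN 6 0 (ord t)).setR a i v) = fp (ord t) :=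
      fun a i v => hp _ _ o1 kN (by simp)
    constructor
    · intro x
      simp only [RExp.eval, NExp.eval_var, ekp', ekq, Mem.setN_real, Mem.setR_real,
        Mem.setR_nat, Mem.setN_nat]
      simp only [Nat.reduceEqDiff, Nat.add_left_cancel_iff, false_and, if_false, and_true,
        if_true, true_and]
      rw [Finset.sum_range_succ, h1, h1, gR]
      by_cases hx : x = fp (ord t)
      · subst hx; simp [ind_true]
      · simp [hx, Ne.symm hx, ind_false]
    · intro q hqE
      simp only [RExp.eval, NExp.eval_var, ekp', ekq, Mem.setN_real, Mem.setR_real,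
        Mem.setR_nat, Mem.setN_nat]
      simp only [Nat.reduceEqDiff, Nat.add_left_cancel_iff, false_and, if_false, and_true,
        if_true, true_and]
      by_cases hqt : q = ord t
      · subst hqt
        rw [if_pos rfl, h2 _ o1, o2, if_neg (lt_irrefl t), if_pos (Nat.lt_succ_self t), h1, add_zero]
      · have : rank q ≠ t := fun h => hqt (by rw [← h, (hS.ord_rank q hqE).2])
        rw [if_neg hqt, h2 q hqE]
        have e : rank q < t + 1 ↔ rank q < t := by omega
        simp only [e]
  · rintro τ hτ ⟨h1, h2⟩
    have hτ' : Frame (scan B kp kq) σ τ := hτ.mono (fun _ h => Or.inl h) (fun _ h => Or.inl h)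
    -- A counter is known to be zero once every item with that address has been revisited; in
    -- particular, untouched counters are zero from the start.
    refine Runs.for (N := E) (f := 1) (fun i υ => υ.real (B + 2) = τ.real (B + 2) ∧
      ∀ x, (∀ p < E, fp p = x → p < i) → υ.real (B + 3) x = 0)
      le_rfl (by omega) (by simp [Cmd.WritesN]) ?_ ?_ ?_ ?_
    · intro υ hυ
      have := fN (hτ'.trans (hυ.mono (fun _ h => Or.inr h) (fun _ h => Or.inr h))) 1
        (by norm_num) (by norm_num) (by norm_num)
      simp [this, hE]
    · refine ⟨rfl, fun x hx => ?_⟩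
      rw [Mem.setN_real, h1]
      refine Finset.sum_eq_zero fun u hu => ?_
      rw [ind_false, mul_zero]
      intro h
      have := hx _ (hS.rank_ord u (by simpa using hu)).1 h
      omega
    · rintro i hi υ hυ hv ⟨i1, i2⟩
      have gN := fN (hτ'.trans (hυ.mono (fun _ h => Or.inr h) (fun _ h => Or.inr h)))
      refine Runs.seq (Runs.setV le_rfl (Runs.setR le_rfl ?_))
      have ekp : kp.eval (υ.setN 6 0 i) = fp i := hp _ _ hi
        (fun a a1 a2 a3 => by rw [Mem.setN_nat_of_ne a3, gN a a1 a2 a3]) (by simp)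
      rw [NExp.eval_var, hv, ekp]
      refine ⟨by rw [Mem.setN_real, Mem.setR_real_of_ne (by omega)]; exact i1, fun x hx => ?_⟩
      by_cases hxi : x = fp i
      · simp [hxi, RExp.eval_num]
      · simp only [Mem.setN_real, Mem.setR_real, hxi, and_false, if_false]
        refine i2 x fun p hp' hpx => ?_
        have := hx p hp' hpx
        rcases Nat.lt_succ_iff_lt_or_eq.mp this with h | h
        · exact h
        · exact absurd (by rw [← hpx, h]) hxi
    · rintro υ - ⟨i1, i2⟩
      refine ⟨fun x => i2 x fun p hp' _ => hp', fun q hqE => ?_⟩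
      rw [i1, h2 q hqE, if_pos (hS.ord_rank q hqE).1,
        hS.sum_range_rank hqE (fun p => σ.real (B + 1) p * ind (fp p = fq q))]
      congr 1
      exact Finset.sum_congr rfl fun p _ => by ring

/-! ### Passes over all levels of the coordinates -/

/-- The state in which the passes over the levels run: there are `E ≤ 2 ^ L` items, the ranks for
the first `K` coordinates are in the arrays `20 + 4 k`, and the items are sorted by the last
coordinate. -/
structure Ready (B K E L : ℕ) (c : ℕ → ℝ) (σ : Mem) : Prop where
  nE : σ.nat 1 0 = E
  nM : σ.nat 2 0 = 2 ^ L
  nL : σ.nat 3 0 = L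
  half : ∀ x < 2 * 2 ^ L, σ.nat 9 x = x / 2
  left : ∀ x < 2 * 2 ^ L, σ.nat 10 x = leftSibling (2 ^ L) x
  radix : ∀ k < K, ∀ x ≤ 2 ^ L, σ.nat (22 + 4 * k) x = x * (2 ^ L + 1) ^ k
  sorted : Sorted E (σ.nat 13) (σ.nat (20 + 4 * K)) c
  rank : ∀ k < K, ∀ i < E, σ.nat (20 + 4 * k) i < 2 ^ L
  cnt : ∀ x, σ.real (B + 3) x = 0

/-- The passes over all levels of the first `k` coordinates. -/
def levels (B K : ℕ) : ℕ → Cmd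
  | 0 => scan B (keyExp id K) (keyExp (NExp.load 10) K)
  | k + 1 => Cmd.seq
      (Cmd.for 4 (NExp.var 1)
        (Cmd.setN (21 + 4 * k) (NExp.var 4) (NExp.load (20 + 4 * k) (NExp.var 4))))
      (Cmd.for (23 + 4 * k) (NExp.var 3)
        (Cmd.seq (levels B K k)
          (Cmd.for 4 (NExp.var 1)
            (Cmd.setN (21 + 4 * k) (NExp.var 4)
              (NExp.load 9 (NExp.load (21 + 4 * k) (NExp.var 4)))))))

theorem writesN_levels (B K k a : ℕ) : (levels B K k).WritesN a →
    a = 4 ∨ a = 5 ∨ a = 6 ∨ ∃ j < k, a = 21 + 4 * j ∨ a = 23 + 4 * j := by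
  induction k with
  | zero =>
    rw [levels, writesN_scan]
    tauto
  | succ k ih =>
    simp only [levels, Cmd.WritesN, Cmd.writesN_for]
    rintro ((h | h) | (h | h | h | h))
    · exact Or.inl h
    · exact Or.inr (Or.inr (Or.inr ⟨k, by omega, Or.inl h⟩))
    · exact Or.inr (Or.inr (Or.inr ⟨k, by omega, Or.inr h⟩))
    · rcases ih h with h | h | h | ⟨j, hj, h⟩
      · exact Or.inl h
      · exact Or.inr (Or.inl h)
      · exact Or.inr (Or.inr (Or.inl h))
      · exact Or.inr (Or.inr (Or.inr ⟨j, by omega, h⟩))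
    · exact Or.inl h
    · exact Or.inr (Or.inr (Or.inr ⟨k, by omega, Or.inl h⟩))

theorem writesR_levels (B K k a : ℕ) : (levels B K k).WritesR a → a = B + 2 ∨ a = B + 3 := by
  induction k with
  | zero =>
    rw [levels, writesR_scan]
    exact id
  | succ k ih =>
    simp only [levels, Cmd.WritesR, Cmd.writesR_for]
    rintro (h | h | h)
    exacts [h.elim, ih h, h.elim]

/-- The passes write the arrays `4`, `5`, `6` and odd-numbered arrays from `21` on. The conditions
on naturals concern other arrays, which are either below `21` or even-numbered. -/
theorem Ready.congr {B K E L : ℕ} {c : ℕ → ℝ} {σ τ : Mem} (h : Ready B K E L c σ)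
    (hN : ∀ a, a ≠ 4 → a ≠ 5 → a ≠ 6 → (∀ j < K, a ≠ 21 + 4 * j ∧ a ≠ 23 + 4 * j) →
      τ.nat a = σ.nat a) (hR : ∀ x, τ.real (B + 3) x = 0) : Ready B K E L c τ := by
  have e : ∀ a, (a < 4 ∨ 6 < a) → (a < 21 ∨ a % 2 = 0) → τ.nat a = σ.nat a := fun a h1 h2 =>
    hN a (by omega) (by omega) (by omega) fun j _ => by omega
  refine ⟨?_, ?_, ?_, ?_, ?_, fun k hk => ?_, ?_, fun k hk => ?_, hR⟩
  · rw [e 1 (by omega) (by omega)]; exact h.nE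
  · rw [e 2 (by omega) (by omega)]; exact h.nM
  · rw [e 3 (by omega) (by omega)]; exact h.nL
  · rw [e 9 (by omega) (by omega)]; exact h.half
  · rw [e 10 (by omega) (by omega)]; exact h.left
  · rw [e (22 + 4 * k) (by omega) (by omega)]; exact h.radix k hk
  · rw [e 13 (by omega) (by omega), e (20 + 4 * K) (by omega) (by omega)]; exact h.sorted
  · rw [e (20 + 4 * k) (by omega) (by omega)]; exact h.rank k hk

theorem leftSibling_le {S x : ℕ} (h : x < S) : leftSibling S x ≤ S := by
  rw [leftSibling]; split_ifs <;> omega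

/-- Induction on the number `k` of coordinates whose levels are still looped over; the coordinates
from `k` on stay at a fixed node each. Adding the sibling indicators over all levels of one
coordinate yields the comparison of ranks, and each such loop costs a factor `L + 1`. -/
theorem runs_levels (B K k : ℕ) (hk : k ≤ K) {E L : ℕ} {c : ℕ → ℝ} {σ : Mem}
    (hσ : Ready B K E L c σ)
    (hcur : ∀ j, k ≤ j → j < K → ∀ i < E, σ.nat (21 + 4 * j) i < 2 ^ L) :
    Runs (levels B K k) σ ((E + 1) * (L + 1) ^ k) fun τ => (∀ x, τ.real (B + 3) x = 0) ∧
      ∀ q < E, τ.real (B + 2) q = σ.real (B + 2) q + ∑ p ∈ Finset.range E, σ.real (B + 1) p *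
        (ind (σ.nat (20 + 4 * K) p < σ.nat (20 + 4 * K) q) *
        (∏ j ∈ Finset.range k, ind (σ.nat (20 + 4 * j) p < σ.nat (20 + 4 * j) q)) *
        ∏ j ∈ Finset.Ico k K, ind (σ.nat (21 + 4 * j) p =
          leftSibling (2 ^ L) (σ.nat (21 + 4 * j) q))) := by
  induction k generalizing σ with
  | zero =>
    rw [levels]
    refine (runs_scan (rank := σ.nat (20 + 4 * K)) (c := c)
      (fun w => ∑ j ∈ Finset.range K, σ.nat (21 + 4 * j) w * (2 ^ L + 1) ^ j)
      (fun w => ∑ j ∈ Finset.range K,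
        leftSibling (2 ^ L) (σ.nat (21 + 4 * j) w) * (2 ^ L + 1) ^ j)
      hσ.nE hσ.sorted ?_ ?_ hσ.cnt).mono (by simp) ?_
    · intro τ w hw hτ h6
      rw [eval_keyExp]
      refine Finset.sum_congr rfl fun j hj => ?_
      rw [Finset.mem_range] at hj
      simp only [id, NExp.eval, NExp.eval_var, h6]
      rw [hτ _ (by omega) (by omega) (by omega), hτ _ (by omega) (by omega) (by omega)]
      exact hσ.radix j hj _ (hcur j (Nat.zero_le _) hj w hw).le
    · intro τ w hw hτ h6
      rw [eval_keyExp]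
      refine Finset.sum_congr rfl fun j hj => ?_
      rw [Finset.mem_range] at hj
      have hc := hcur j (Nat.zero_le _) hj w hw
      simp only [NExp.eval, NExp.eval_var, h6]
      rw [hτ _ (by omega) (by omega) (by omega), hτ _ (by omega) (by omega) (by omega),
        hτ _ (by omega) (by omega) (by omega), hσ.left _ (by omega)]
      exact hσ.radix j hj _ (leftSibling_le hc)
    · rintro τ - ⟨h1, h2⟩
      refine ⟨h1, fun q hq => ?_⟩
      rw [h2 q hq]
      congr 1
      refine Finset.sum_congr rfl fun p hp => ?_
      rw [Finset.mem_range] at hp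
      -- All digits are at most `2 ^ L`, including the code of a missing sibling, so equal addresses
      -- mean equal nodes in every coordinate.
      rw [Finset.prod_range_zero, mul_one, ← Finset.range_eq_Ico, prod_ind,
        ind_congr (sum_radix_inj K (fun j hj => (hcur j (Nat.zero_le _) hj p hp).le)
          (fun j hj => leftSibling_le (hcur j (Nat.zero_le _) hj q hq)))]
  | succ k ih =>
    have hkK : k < K := by omega
    have hpow : 1 ≤ (L + 1) ^ k := Nat.one_le_pow _ _ (by omega)
    have hpow' : 1 ≤ (L + 1) ^ (k + 1) := Nat.one_le_pow _ _ (by omega)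
    rw [levels]
    refine Runs.seq ((Runs.for (N := E) (f := 1) (Q := fun τ => ∀ i < E,
        τ.nat (21 + 4 * k) i = σ.nat (20 + 4 * k) i)
      (fun t τ => ∀ i < t, τ.nat (21 + 4 * k) i = σ.nat (20 + 4 * k) i)
      le_rfl (le_refl ((E + 1) * 1)) (by simp only [Cmd.WritesN]; omega) ?_ (by simp) ?_
      (fun _ _ h => h)).mono ?_ ?_)
    · intro τ hτ
      rw [NExp.eval_var, hτ.nat 1, hσ.nE]
      simp only [Cmd.writesN_for, Cmd.WritesN]; omega
    · intro t ht τ hτ hv h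
      refine Runs.setN le_rfl fun i hi => ?_
      have n1 : 21 + 4 * k ≠ 4 := by omega
      have e1 : τ.nat (20 + 4 * k) = σ.nat (20 + 4 * k) := hτ.nat _ (by
        simp only [Cmd.writesN_for, Cmd.WritesN]; omega)
      by_cases hit : i = t
      · simp [n1, NExp.eval, hv, hit, e1]
      · simp [n1, NExp.eval, hv, hit, h i (by omega)]
    · exact Nat.mul_le_mul_left _ hpow'
    intro τ hτ hcurτ
    have t1 : ∀ a, a ≠ 4 → a ≠ 21 + 4 * k → τ.nat a = σ.nat a := fun a h1 h2 => hτ.nat a (by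
      simp only [Cmd.writesN_for, Cmd.WritesN]; omega)
    have t2 : τ.real = σ.real := by
      ext a : 1
      exact hτ.real a (by simp [Cmd.writesR_for, Cmd.WritesR])
    have hF : ∀ {υ}, Frame (Cmd.for (23 + 4 * k) (NExp.var 3)
        (Cmd.seq (levels B K k)
          (Cmd.for 4 (NExp.var 1)
            (Cmd.setN (21 + 4 * k) (NExp.var 4)
              (NExp.load 9 (NExp.load (21 + 4 * k) (NExp.var 4))))))) τ υ →
        (∀ a, a ≠ 4 → a ≠ 5 → a ≠ 6 → (∀ j < k + 1, a ≠ 21 + 4 * j ∧ a ≠ 23 + 4 * j) →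
          υ.nat a = σ.nat a) ∧ υ.real (B + 1) = σ.real (B + 1) := fun {υ} hυ => by
      constructor
      · intro a h1 h2 h3 h4
        rw [hυ.nat a, t1 a h1 (h4 k (by omega)).1]
        simp only [Cmd.writesN_for, Cmd.WritesN]
        rintro (h | h | h | h)
        · exact (h4 k (by omega)).2 h
        · rcases writesN_levels _ _ _ _ h with h | h | h | ⟨j, hj, h⟩
          · exact h1 h
          · exact h2 h
          · exact h3 h
          · have := h4 j (by omega)
            tauto
        · exact h1 h
        · exact (h4 k (by omega)).1 h
      · rw [hυ.real, t2]
        simp only [Cmd.writesR_for, Cmd.WritesR, or_false]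
        intro h
        have := writesR_levels _ _ _ _ h
        omega
    set R := fun q p => ind (σ.nat (20 + 4 * K) p < σ.nat (20 + 4 * K) q) *
      (∏ j ∈ Finset.range k, ind (σ.nat (20 + 4 * j) p < σ.nat (20 + 4 * j) q)) with hR
    set W := fun q p => ∏ j ∈ Finset.Ico (k + 1) K, ind (σ.nat (21 + 4 * j) p =
      leftSibling (2 ^ L) (σ.nat (21 + 4 * j) q)) with hW
    -- After `l` rounds the current nodes are the ranks divided by `2 ^ l`, and the levels below `l`
    -- have been added. The factors `R` and `W` collect the coordinates before and after the current
    -- one.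
    refine Runs.for (N := L) (f := (E + 1) * (L + 1) ^ k) (fun l υ =>
      (∀ x, υ.real (B + 3) x = 0) ∧
      (∀ i < E, υ.nat (21 + 4 * k) i = σ.nat (20 + 4 * k) i / 2 ^ l) ∧
      ∀ q < E, υ.real (B + 2) q = σ.real (B + 2) q + ∑ p ∈ Finset.range E, σ.real (B + 1) p *
        (R q p * (∑ l' ∈ Finset.range l, ind (σ.nat (20 + 4 * k) p / 2 ^ l' =
          leftSibling (2 ^ L) (σ.nat (20 + 4 * k) q / 2 ^ l'))) * W q p))
      (Nat.mul_pos (by omega) hpow) (by rw [pow_succ]; apply le_of_eq; ring) ?_ ?_ ?_ ?_ ?_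
    · simp only [Cmd.WritesN, Cmd.writesN_for]
      rintro (h | h | h)
      · rcases writesN_levels _ _ _ _ h with h | h | h | ⟨j, hj, h⟩ <;> omega
      · omega
      · omega
    · intro υ hυ
      rw [NExp.eval_var, (hF hυ).1 3 (by omega) (by omega) (by omega) (fun j _ => by omega), hσ.nL]
    · have n1 : 21 + 4 * k ≠ 23 + 4 * k := by omega
      refine ⟨fun x => by simp [t2, hσ.cnt], fun i hi => ?_, fun q hq => by simp [t2]⟩
      rw [Mem.setN_nat_of_ne n1, hcurτ i hi]
      simp
    · rintro l hl υ hυ hv ⟨i1, i2, i3⟩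
      obtain ⟨f1, f2⟩ := hF hυ
      have hrd : Ready B K E L c υ := hσ.congr
        (fun a h1 h2 h3 h4 => f1 a h1 h2 h3 fun j hj => h4 j (by omega)) i1
      have hoth : ∀ j, k + 1 ≤ j → υ.nat (21 + 4 * j) = σ.nat (21 + 4 * j) := fun j hj =>
        f1 _ (by omega) (by omega) (by omega) fun j' hj' => by omega
      have hrk : ∀ j, υ.nat (20 + 4 * j) = σ.nat (20 + 4 * j) := fun j =>
        f1 _ (by omega) (by omega) (by omega) fun j' hj' => by omega
      refine Runs.seq ((ih (by omega) hrd ?_).mono le_rfl ?_)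
      · intro j hj hjK i hi
        rcases Nat.eq_or_lt_of_le hj with rfl | hj
        · rw [i2 i hi]
          exact (Nat.div_le_self _ _).trans_lt (hσ.rank k hkK i hi)
        · rw [hoth j hj]; exact hcur j hj hjK i hi
      rintro ω hω ⟨j1, j2⟩
      have wN : ∀ a, a ≠ 4 → a ≠ 5 → a ≠ 6 → (∀ j < k, a ≠ 21 + 4 * j ∧ a ≠ 23 + 4 * j) →
          ω.nat a = υ.nat a := fun a h1 h2 h3 h4 => hω.nat a (fun h => by
        rcases writesN_levels _ _ _ _ h with h | h | h | ⟨j, hj, h⟩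
        · exact h1 h
        · exact h2 h
        · exact h3 h
        · have := h4 j hj
          tauto)
      refine (Runs.for (N := E) (f := 1) (Q := fun ξ => ∀ i < E,
          ξ.nat (21 + 4 * k) i = ω.nat (21 + 4 * k) i / 2)
        (fun t ξ => (∀ i < t, ξ.nat (21 + 4 * k) i = ω.nat (21 + 4 * k) i / 2) ∧
          ∀ i, t ≤ i → ξ.nat (21 + 4 * k) i = ω.nat (21 + 4 * k) i)
        le_rfl (le_refl ((E + 1) * 1)) (by simp only [Cmd.WritesN]; omega) ?_ ?_ ?_
        (fun _ _ h => h.1)).mono (Nat.mul_le_mul_left _ hpow) ?_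
      · intro ξ hξ
        rw [NExp.eval_var, hξ.nat 1 (by simp only [Cmd.writesN_for, Cmd.WritesN]; omega),
          wN 1 (by omega) (by omega) (by omega) (fun j _ => by omega),
          f1 1 (by omega) (by omega) (by omega) (fun j _ => by omega), hσ.nE]
      · have n1 : 21 + 4 * k ≠ 4 := by omega
        exact ⟨by simp, fun i _ => by simp [n1]⟩
      · rintro t ht ξ hξ hv ⟨x1, x2⟩
        have n1 : 21 + 4 * k ≠ 4 := by omega
        have e9 : ξ.nat 9 = σ.nat 9 := by
          rw [hξ.nat 9 (by simp only [Cmd.writesN_for, Cmd.WritesN]; omega),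
            wN 9 (by omega) (by omega) (by omega) (fun j _ => by omega),
            f1 9 (by omega) (by omega) (by omega) (fun j _ => by omega)]
        have ec : ω.nat (21 + 4 * k) t < 2 ^ L := by
          rw [wN _ (by omega) (by omega) (by omega) (fun j _ => by omega), i2 t ht]
          exact (Nat.div_le_self _ _).trans_lt (hσ.rank k hkK t ht)
        have eh := hσ.half (ω.nat (21 + 4 * k) t) (by omega)
        refine Runs.setN le_rfl ⟨fun i hi => ?_, fun i hi => ?_⟩
        · by_cases hit : i = t
          · simp [n1, NExp.eval, hv, hit, x2 t le_rfl, e9, eh]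
          · simp [n1, NExp.eval, hv, hit, x1 i (by omega)]
        · have hit : i ≠ t := by omega
          simp [n1, NExp.eval, hv, hit, x2 i (by omega)]
      · intro ξ hξ x1
        have n1 : 21 + 4 * k ≠ 23 + 4 * k := by omega
        have xr : ξ.real = ω.real := by
          ext a : 1
          exact hξ.real a (by simp [Cmd.writesR_for, Cmd.WritesR])
        rw [Mem.setN_real, Mem.setN_nat_of_ne n1, xr]
        refine ⟨j1, fun i hi => ?_, fun q hq => ?_⟩
        · rw [x1 i hi, wN _ (by omega) (by omega) (by omega) (fun j _ => by omega), i2 i hi,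
            Nat.div_div_eq_div_mul, pow_succ]
        · rw [j2 q hq, i3 q hq, add_assoc, ← Finset.sum_add_distrib]
          congr 1
          refine Finset.sum_congr rfl fun p hp => ?_
          rw [Finset.mem_range] at hp
          have eI : ∏ j ∈ Finset.Ico k K, ind (υ.nat (21 + 4 * j) p =
              leftSibling (2 ^ L) (υ.nat (21 + 4 * j) q)) =
              ind (σ.nat (20 + 4 * k) p / 2 ^ l =
                leftSibling (2 ^ L) (σ.nat (20 + 4 * k) q / 2 ^ l)) * W q p := by
            rw [Finset.prod_eq_prod_Ico_succ_bot hkK, i2 p hp, i2 q hq]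
            congr 1
            refine Finset.prod_congr rfl fun j hj => ?_
            rw [hoth j (Finset.mem_Ico.mp hj).1]
          rw [eI, f2, Finset.sum_range_succ]
          simp only [hrk, hR]
          ring
    · rintro υ hυ ⟨i1, -, i3⟩
      refine ⟨i1, fun q hq => ?_⟩
      rw [i3 q hq]
      congr 1
      refine Finset.sum_congr rfl fun p hp => ?_
      rw [Finset.mem_range] at hp
      -- The sum over all `L` levels collapses to the indicator that the rank of `p` is smaller.
      rw [sum_ind_leftSibling L (hσ.rank k hkK p hp) (hσ.rank k hkK p hp) (hσ.rank k hkK q hq),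
        Finset.prod_range_succ]
      simp only [hR, hW]
      ring

/-! ### The dominance program: tables, sorting and passes -/

/-- `f 0; f 1; …; f (K - 1)`. -/
def Cmd.rep : ℕ → (ℕ → Cmd) → Cmd
  | 0, _ => Cmd.nop
  | K + 1, f => Cmd.seq (Cmd.rep K f) (f K)

theorem Cmd.writesN_rep (K : ℕ) (f : ℕ → Cmd) (a : ℕ) :
    (Cmd.rep K f).WritesN a ↔ ∃ k < K, (f k).WritesN a := by
  induction K with
  | zero => simp [Cmd.rep, Cmd.WritesN]
  | succ K ih =>
    simp only [Cmd.rep, Cmd.WritesN, ih, Nat.lt_succ_iff_lt_or_eq]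
    constructor
    · rintro (⟨k, hk, h⟩ | h)
      exacts [⟨k, Or.inl hk, h⟩, ⟨K, Or.inr rfl, h⟩]
    · rintro ⟨k, hk | rfl, h⟩
      exacts [Or.inl ⟨k, hk, h⟩, Or.inr h]

theorem Cmd.writesR_rep (K : ℕ) (f : ℕ → Cmd) (a : ℕ) :
    (Cmd.rep K f).WritesR a ↔ ∃ k < K, (f k).WritesR a := by
  induction K with
  | zero => simp [Cmd.rep, Cmd.WritesR]
  | succ K ih =>
    simp only [Cmd.rep, Cmd.WritesR, ih, Nat.lt_succ_iff_lt_or_eq]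
    constructor
    · rintro (⟨k, hk, h⟩ | h)
      exacts [⟨k, Or.inl hk, h⟩, ⟨K, Or.inr rfl, h⟩]
    · rintro ⟨k, hk | rfl, h⟩
      exacts [Or.inl ⟨k, hk, h⟩, Or.inr h]

/-- The repetition is part of the program text, so `K` enters only the weight and the budget `g` is
not multiplied. -/
theorem Runs.rep {K : ℕ} {f : ℕ → Cmd} {σ : Mem} {g : ℕ} (I : ℕ → Mem → Prop) (hg : 1 ≤ g)
    (h0 : I 0 σ)
    (hs : ∀ k < K, ∀ τ, Frame (Cmd.rep K f) σ τ → I k τ → Runs (f k) τ g (I (k + 1))) :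
    Runs (Cmd.rep K f) σ g (I K) := by
  have key : ∀ k ≤ K, Runs (Cmd.rep k f) σ g (I k) := by
    intro k
    induction k with
    | zero => exact fun _ => Runs.nop hg h0
    | succ k ih =>
      intro hk
      refine Runs.seq ((ih (by omega)).mono le_rfl fun τ hτ hI => ?_)
      refine hs k (by omega) τ (hτ.mono (fun a ha => ?_) (fun a ha => ?_)) hI
      · rw [Cmd.writesN_rep] at ha ⊢
        obtain ⟨j, hj, h⟩ := ha
        exact ⟨j, by omega, h⟩
      · rw [Cmd.writesR_rep] at ha ⊢
        obtain ⟨j, hj, h⟩ := ha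
        exact ⟨j, by omega, h⟩
  exact key K le_rfl

/-- The table of the multiples of the `k`-th power of the radix, which is in the variable `8`. -/
def radixTable (k : ℕ) : Cmd :=
  Cmd.seq (Cmd.setN (22 + 4 * k) (NExp.const 0) (NExp.const 0))
    (Cmd.seq (Cmd.for 4 (NExp.add (NExp.var 2) (NExp.const 1))
      (Cmd.setN (22 + 4 * k) (NExp.add (NExp.var 4) (NExp.const 1))
        (NExp.add (NExp.load (22 + 4 * k) (NExp.var 4)) (NExp.var 8))))
      (Cmd.setV 8 (NExp.load (22 + 4 * k) (NExp.add (NExp.var 2) (NExp.const 1)))))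

/-- Naturals cannot be multiplied, so the multiples of `S` come from repeated addition. One entry
beyond `M` is computed: it is the next power of the radix. -/
theorem runs_radixTable {σ : Mem} {k M S : ℕ} (hM : σ.nat 2 0 = M) (hS : σ.nat 8 0 = S) :
    Runs (radixTable k) σ (M + 2) fun τ => τ.nat 8 0 = (M + 1) * S ∧
      ∀ x ≤ M, τ.nat (22 + 4 * k) x = x * S := by
  have n1 : 22 + 4 * k ≠ 4 := by omega
  have n2 : 22 + 4 * k ≠ 8 := by omega
  have n3 : ¬ 2 = 22 + 4 * k := by omega
  have n4 : ¬ 8 = 22 + 4 * k := by omega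
  refine Runs.seq (Runs.setN (by omega) (Runs.seq ?_))
  refine Runs.for (N := M + 1) (f := 1) (fun i τ => τ.nat 2 0 = M ∧ τ.nat 8 0 = S ∧
    ∀ x ≤ i, τ.nat (22 + 4 * k) x = x * S) le_rfl (by omega)
    (by simp only [Cmd.WritesN]; omega) ?_ ?_ ?_ ?_
  · intro τ hτ
    have := hτ.nat 2 (by simp only [Cmd.writesN_for, Cmd.WritesN]; omega)
    simp [NExp.eval, this, n3, hM]
  · refine ⟨by simp [n3, hM], by simp [n4, hS], fun x hx => ?_⟩
    obtain rfl : x = 0 := by omega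
    simp [n1, NExp.eval]
  · rintro i hi τ - hv ⟨h1, h2, h3⟩
    refine Runs.setN le_rfl ⟨by simp [n3, h1], by simp [n4, h2], fun x hx => ?_⟩
    by_cases hxi : x = i + 1
    · simp [n1, NExp.eval, hv, hxi, h2, h3 i le_rfl]; ring
    · simp [n1, NExp.eval, hv, hxi, h3 x (by omega)]
  · rintro τ - ⟨h1, h2, h3⟩
    refine Runs.setV (by omega) ⟨?_, fun x hx => ?_⟩
    · simp [NExp.eval, h1, h3]
    · simp [n2, h3 x (by omega)]

/-- Adds to the entry `q` of the real array `B + 2` the sum of the weights, in the real array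
`B + 1`, of all items which precede `q` in each of the `K + 1` coordinates. -/
def dominance (B K : ℕ) : Cmd :=
  Cmd.seq initSize (Cmd.seq initTables (Cmd.seq (Cmd.setV 8 (NExp.const 1))
    (Cmd.seq (Cmd.rep K radixTable)
    (Cmd.seq (Cmd.rep K fun k => sortCmd (B + 10 + k) (20 + 4 * k))
    (Cmd.seq (sortCmd (B + 10 + K) (20 + 4 * K)) (levels B K K))))))

theorem writesN_dominance (B K a : ℕ) (h : (dominance B K).WritesN a) :
    2 ≤ a ∧ (a ≤ 13 ∨ 20 ≤ a) := by
  simp only [dominance, initSize, initTables, Cmd.WritesN, Cmd.writesN_for, Cmd.writesN_setV,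
    Cmd.writesN_rep, radixTable, or_false] at h
  rcases h with h | h | h | ⟨k, hk, h⟩ | ⟨k, hk, h⟩ | h | h
  · omega
  · omega
  · omega
  · omega
  · have := writesN_sortCmd _ _ _ h
    omega
  · have := writesN_sortCmd _ _ _ h
    omega
  · rcases writesN_levels _ _ _ _ h with h | h | h | ⟨j, hj, h⟩ <;> omega

theorem writesR_dominance (B K a : ℕ) (h : (dominance B K).WritesR a) : a = B + 2 ∨ a = B + 3 := by
  simp only [dominance, initSize, initTables, Cmd.WritesR, Cmd.writesR_for, Cmd.writesR_setV,
    Cmd.writesR_rep, radixTable] at h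
  rcases h with h | h | h | ⟨k, hk, h⟩ | ⟨k, hk, h⟩ | h | h
  · tauto
  · tauto
  · tauto
  · tauto
  · exact absurd h (writesR_sortCmd _ _ _)
  · exact absurd h (writesR_sortCmd _ _ _)
  · exact writesR_levels _ _ _ _ h

/-- The last of the `K + 1` coordinates needs no loop over levels, as the scan visits the items in
its order. This is why the exponent of the logarithm is `K`. -/
theorem runs_dominance {B K E L : ℕ} (hK : 1 ≤ K) {σ : Mem} (hE : σ.nat 1 0 = E)
    (hL : L = Nat.clog 2 E) (hcnt : ∀ x, σ.real (B + 3) x = 0) :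
    Runs (dominance B K) σ ((2 ^ L + 2) * (L + 1) ^ K) fun τ => (∀ x, τ.real (B + 3) x = 0) ∧
      ∀ q < E, τ.real (B + 2) q = σ.real (B + 2) q + ∑ p ∈ Finset.range E, σ.real (B + 1) p *
        ∏ k ∈ Finset.range (K + 1), ind (LexLT (σ.real (B + 10 + k)) p q) := by
  have hEL : E ≤ 2 ^ L := by rw [hL]; exact Nat.le_pow_clog (by norm_num) E
  -- At least one coordinate with levels is needed for the sorting time to be absorbed.
  have hpow : L + 1 ≤ (L + 1) ^ K := Nat.le_self_pow (by omega) _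
  have hpow1 : 1 ≤ (L + 1) ^ K := by omega
  set g := (2 ^ L + 2) * (L + 1) ^ K with hg
  have hg1 : 2 ^ L + 2 ≤ g := Nat.le_mul_of_pos_right _ hpow1
  have hg2 : (2 ^ L + 1) * (L + 1) ≤ g := Nat.mul_le_mul (by omega) hpow
  have hg3 : (E + 1) * (L + 1) ^ K ≤ g := Nat.mul_le_mul_right _ (by omega)
  refine Runs.seq ((runs_initSize hE).mono (by omega) ?_)
  rintro σ1 hF1 ⟨hM1, hL1⟩
  rw [← hL] at hM1 hL1
  have hE1 : σ1.nat 1 0 = E := by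
    rw [hF1.nat 1 (by simp [initSize, Cmd.writesN_for, Cmd.WritesN]), hE]
  have hR1 : σ1.real = σ.real := by
    ext a : 1
    exact hF1.real a (by simp [initSize, Cmd.writesR_for, Cmd.WritesR])
  refine Runs.seq ((runs_initTables hM1).mono (by omega) ?_)
  rintro σ2 hF2 hT
  have hN2 : ∀ a, a ≠ 4 → a ≠ 9 → a ≠ 10 → σ2.nat a = σ1.nat a := fun a h1 h2 h3 =>
    hF2.nat a (by simp [initTables, Cmd.writesN_for, Cmd.WritesN, h1, h2, h3])
  have hR2 : σ2.real = σ.real := by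
    ext a : 1
    rw [← hR1]
    exact hF2.real a (by simp [initTables, Cmd.writesR_for, Cmd.WritesR])
  refine Runs.seq (Runs.setV (by omega) ?_)
  simp only [NExp.eval]
  set σ3 := σ2.setN 8 0 1 with hσ3
  have hN3 : ∀ a, a ≠ 8 → σ3.nat a = σ2.nat a := fun a h => Mem.setN_nat_of_ne h
  have hR3 : σ3.real = σ.real := hR2
  have hM3 : σ3.nat 2 0 = 2 ^ L := by
    rw [hN3 2 (by norm_num), hN2 2 (by norm_num) (by norm_num) (by norm_num), hM1]
  refine Runs.seq ((Runs.rep (g := g) (fun k τ => τ.nat 8 0 = (2 ^ L + 1) ^ k ∧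
    ∀ j < k, ∀ x ≤ 2 ^ L, τ.nat (22 + 4 * j) x = x * (2 ^ L + 1) ^ j) (by omega)
    ⟨by simp [hσ3], by simp⟩ ?_).mono le_rfl ?_)
  · rintro k hk τ hτ ⟨h1, h2⟩
    have hM : τ.nat 2 0 = 2 ^ L := by
      rw [hτ.nat 2, hM3]
      rw [Cmd.writesN_rep]
      rintro ⟨j, -, h⟩
      simp only [radixTable, Cmd.WritesN, Cmd.writesN_for, Cmd.writesN_setV] at h
      omega
    refine (runs_radixTable hM h1).mono hg1 ?_
    rintro υ hυ ⟨i1, i2⟩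
    refine ⟨by rw [i1, pow_succ'], fun j hj x hx => ?_⟩
    rcases Nat.lt_succ_iff_lt_or_eq.mp hj with hj | rfl
    · rw [hυ.nat, h2 j hj x hx]
      simp only [radixTable, Cmd.WritesN, Cmd.writesN_for, Cmd.writesN_setV]
      omega
    · exact i2 x hx
  rintro σ4 hF4 ⟨-, hrad⟩
  have hN4 : ∀ a, a ≠ 4 → a ≠ 8 → a < 20 → σ4.nat a = σ3.nat a := fun a h1 h2 h3 =>
    hF4.nat a (by
      rw [Cmd.writesN_rep]
      rintro ⟨j, -, h⟩
      simp only [radixTable, Cmd.WritesN, Cmd.writesN_for, Cmd.writesN_setV] at h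
      omega)
  have hR4 : σ4.real = σ.real := by
    ext a : 1
    rw [← hR3]
    refine hF4.real a ?_
    rw [Cmd.writesR_rep]
    rintro ⟨j, -, h⟩
    simp [radixTable, Cmd.WritesR, Cmd.writesR_for] at h
  have hsort : ∀ c rk, 14 ≤ rk → ∀ τ : Mem, (∀ a, a ≠ 4 → a ≠ 5 → a ≠ 6 → a ≠ 7 → a ≠ 11 →
      a ≠ 12 → a ≠ 13 → a < 20 → τ.nat a = σ4.nat a) → Runs (sortCmd c rk) τ g fun υ =>
        Sorted E (υ.nat 13) (υ.nat rk) (τ.real c) := by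
    intro c rk hrk τ hτ
    refine (runs_sortCmd (L := L) hrk ?_ ?_ ?_ hEL ?_).mono hg2 fun _ _ h => h
    · rw [hτ, hN4, hN3, hN2, hE1] <;> norm_num
    · rw [hτ, hN4, hM3] <;> norm_num
    · rw [hτ, hN4, hN3, hN2, hL1] <;> norm_num
    · intro x hx
      rw [hτ, hN4, hN3, (hT x hx).1] <;> norm_num
  -- All sorts share the array `13`, so the order found for an earlier coordinate is overwritten and
  -- only its ranks persist.
  refine Runs.seq ((Runs.rep (g := g) (fun k τ => ∀ j < k, ∃ ord,
    Sorted E ord (τ.nat (20 + 4 * j)) (σ.real (B + 10 + j))) (by omega) (by simp) ?_).mono le_rfl ?_)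
  · rintro k hk τ hτ h
    have hr : τ.real = σ.real := by
      ext a : 1
      rw [← hR4]
      refine hτ.real a ?_
      rw [Cmd.writesR_rep]
      rintro ⟨j, -, h⟩
      exact writesR_sortCmd _ _ _ h
    refine (hsort (B + 10 + k) (20 + 4 * k) (by omega) τ ?_).mono le_rfl ?_
    · intro a a1 a2 a3 a4 a5 a6 a7 a8
      refine hτ.nat a ?_
      rw [Cmd.writesN_rep]
      rintro ⟨j, -, h⟩
      have := writesN_sortCmd _ _ _ h
      omega
    · intro υ hυ hS j hj
      rcases Nat.lt_succ_iff_lt_or_eq.mp hj with hj | rfl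
      · obtain ⟨ord, ho⟩ := h j hj
        refine ⟨ord, ?_⟩
        rw [hυ.nat]
        · exact ho
        · intro h
          have := writesN_sortCmd _ _ _ h
          omega
      · rw [hr] at hS
        exact ⟨_, hS⟩
  rintro σ5 hF5 hrank
  have hN5 : ∀ a, a ≠ 4 → a ≠ 5 → a ≠ 6 → a ≠ 7 → a ≠ 11 → a ≠ 12 → a ≠ 13 →
      (a < 20 ∨ a % 4 ≠ 0) → σ5.nat a = σ4.nat a := by
    intro a a1 a2 a3 a4 a5 a6 a7 a8
    refine hF5.nat a ?_
    rw [Cmd.writesN_rep]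
    rintro ⟨j, -, h⟩
    have := writesN_sortCmd _ _ _ h
    omega
  have hR5 : σ5.real = σ.real := by
    ext a : 1
    rw [← hR4]
    refine hF5.real a ?_
    rw [Cmd.writesR_rep]
    rintro ⟨j, -, h⟩
    exact writesR_sortCmd _ _ _ h
  refine Runs.seq ((hsort (B + 10 + K) (20 + 4 * K) (by omega) σ5
    (fun a a1 a2 a3 a4 a5 a6 a7 a8 => hN5 a a1 a2 a3 a4 a5 a6 a7 (Or.inl a8))).mono le_rfl ?_)
  rintro σ6 hF6 hS6
  have hN6 : ∀ a, a ≠ 4 → a ≠ 5 → a ≠ 6 → a ≠ 7 → a ≠ 11 → a ≠ 12 → a ≠ 13 →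
      a ≠ 20 + 4 * K → σ6.nat a = σ5.nat a := by
    intro a a1 a2 a3 a4 a5 a6 a7 a8
    refine hF6.nat a fun h => ?_
    have := writesN_sortCmd _ _ _ h
    omega
  have hR6 : σ6.real = σ.real := by
    ext a : 1
    rw [← hR5]
    exact hF6.real a (writesR_sortCmd _ _ _)
  rw [hR5] at hS6
  have hlow : ∀ a, a < 20 → a ≠ 4 → a ≠ 5 → a ≠ 6 → a ≠ 7 → a ≠ 8 → a ≠ 11 → a ≠ 12 → a ≠ 13 →
      σ6.nat a = σ2.nat a := by
    intro a a1 a2 a3 a4 a5 a6 a7 a8 a9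
    rw [hN6, hN5, hN4, hN3] <;> omega
  have hrk6 : ∀ k < K, ∃ ord, Sorted E ord (σ6.nat (20 + 4 * k)) (σ.real (B + 10 + k)) := by
    intro k hk
    rw [hN6] <;> first | omega | exact hrank k hk
  have hready : Ready B K E L (σ.real (B + 10 + K)) σ6 := by
    refine ⟨?_, ?_, ?_, fun x hx => ?_, fun x hx => ?_, fun k hk x hx => ?_, hS6,
      fun k hk i hi => ?_, ?_⟩
    · rw [hlow, hN2, hE1] <;> norm_num
    · rw [hlow, hN2, hM1] <;> norm_num
    · rw [hlow, hN2, hL1] <;> norm_num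
    · rw [hlow, (hT x hx).1] <;> norm_num
    · rw [hlow, (hT x hx).2] <;> norm_num
    · rw [hN6, hN5, hrad k hk x hx] <;> omega
    · obtain ⟨ord, ho⟩ := hrk6 k hk
      exact (ho.ord_rank i hi).1.trans_le hEL
    · rw [hR6]; exact hcnt
  refine (runs_levels B K K le_rfl hready (fun j h1 h2 => by omega)).mono hg3 ?_
  rintro τ - ⟨h1, h2⟩
  refine ⟨h1, fun q hq => ?_⟩
  rw [h2 q hq, hR6]
  congr 1
  refine Finset.sum_congr rfl fun p hp => ?_
  rw [Finset.mem_range] at hp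
  rw [Finset.Ico_self, Finset.prod_empty, mul_one, Finset.prod_range_succ, mul_comm (ind _)]
  congr 2
  · refine Finset.prod_congr rfl fun k hk => ?_
    obtain ⟨ord, ho⟩ := hrk6 k (Finset.mem_range.mp hk)
    exact ind_congr (ho.lt_iff p hp q hq)
  · exact ind_congr (hS6.lt_iff p hp q hq)

/-! ## The statistics of Hoeffding type -/

theorem sum_compl_range {n t : ℕ} (w : Fin t → Fin n) (hw : Function.Injective w)
    (f : Fin n → ℝ) [DecidablePred fun a => a ∉ Set.range w] :
    ∑ i ∈ Finset.univ.filter (fun a => a ∉ Set.range w), f i = ∑ i, f i - ∑ k, f (w k) := by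
  classical
  have h1 : ∑ k, f (w k) = ∑ i ∈ Finset.univ.filter (fun a => a ∈ Set.range w), f i := by
    rw [← Finset.sum_image (s := Finset.univ) (g := w) (fun a _ b _ h => hw h)]
    refine Finset.sum_congr ?_ fun _ _ => rfl
    ext a; simp
  rw [h1, eq_sub_iff_add_eq, add_comm, ← Finset.sum_filter_add_sum_filter_not Finset.univ
    (fun a => a ∈ Set.range w) f]

-- With the tail `w`, and thus the cut point, fixed, the signed indicators collapse to `(a w i - a w
-- l) * (a w j - a w k)`, and `dsum_hoef` applies on the complement of the range of `w`. Sums over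
-- that complement are full sums minus the contribution of the tail.
open Classical in
theorem uStat_splits {t r s n : ℕ} (c : ℝ) (IX : (Fin (t + 4) → Fin r → ℝ) → Prop)
    (IY : (Fin (t + 4) → Fin s → ℝ) → Prop) (vx : (Fin t → Fin r → ℝ) → Fin r → ℝ)
    (vy : (Fin t → Fin s → ℝ) → Fin s → ℝ)
    (hX : ∀ a b c e w, IX (tup a b c e w) ↔ a ≤ vx w ∧ b ≤ vx w ∧ ¬ c ≤ vx w ∧ ¬ e ≤ vx w)
    (hY : ∀ a b c e w, IY (tup a b c e w) ↔ a ≤ vy w ∧ b ≤ vy w ∧ ¬ c ≤ vy w ∧ ¬ e ≤ vy w)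
    (z : Fin n → Obs r s) (a b : (Fin t → Fin n) → Fin n → ℝ)
    (ha : ∀ w i, a w i = ind ((z i).1 ≤ vx fun j => (z (w j)).1))
    (hb : ∀ w i, b w i = ind ((z i).2 ≤ vy fun j => (z (w j)).2)) :
    uStat c (Htau t) IX IY n z = c * (∑ w : Fin t → Fin n, ind (Function.Injective w) *
      hoef ((n : ℝ) - t) (∑ i, a w i - ∑ k, a w (w k)) (∑ i, b w i - ∑ k, b w (w k))
        (∑ i, a w i * b w i - ∑ k, a w (w k) * b w (w k))) / (n.descFactorial (t + 4) : ℝ) := by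
  rw [uStat_eq_sum_injective, sum_injective_tup, Finset.sum_filter]
  congr 2
  refine Finset.sum_congr rfl fun w _ => ?_
  by_cases hw : Function.Injective w
  swap
  · rw [if_neg hw, ind_false hw, zero_mul]
  rw [if_pos hw, ind_true hw, one_mul]
  have hk : ∀ i j k l : Fin n, kernel (Htau t) IX IY (fun p => z (tup i j k l w p)) =
      (a w i - a w l) * (a w j - a w k) * ((b w i - b w l) * (b w j - b w k)) := by
    intro i j k l
    have e1 : (fun p => (z (tup i j k l w p)).1) = tup (z i).1 (z j).1 (z k).1 (z l).1
        (fun p => (z (w p)).1) := comp_tup i j k l w (fun p => (z p).1)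
    have e2 : (fun p => (z (tup i j k l w p)).2) = tup (z i).2 (z j).2 (z k).2 (z l).2
        (fun p => (z (w p)).2) := comp_tup i j k l w (fun p => (z p).2)
    simp only [kernel, e1, e2, sum_Htau, hX, hY, ind_and, ind_not, ← ha, ← hb]
    ring
  simp only [hk]
  rw [dsum_hoef _ (a w) (b w) (fun i => by rw [ha]; exact ind_mul_self _)
    (fun i => by rw [hb]; exact ind_mul_self _)]
  have hc : ((Finset.univ.filter (fun x => x ∉ Set.range w)).card : ℝ) = n - t := by
    have := sum_compl_range w hw (fun _ => 1)
    simpa using this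
  rw [hc, sum_compl_range w hw, sum_compl_range w hw,
    sum_compl_range w hw (fun i => a w i * b w i)]

/-- The tail is one observation, which lies below itself; hence the subtraction of `1` from each
count. -/
theorem UD_eq {r s n : ℕ} (z : Fin n → Obs r s) (a b : Fin n → Fin n → ℝ)
    (ha : ∀ w i, a w i = ind ((z i).1 ≤ (z w).1)) (hb : ∀ w i, b w i = ind ((z i).2 ≤ (z w).2)) :
    UD r s n z = (1 / 4) * (∑ w, hoef ((n : ℝ) - 1) (∑ i, a w i - 1) (∑ i, b w i - 1)
      (∑ i, a w i * b w i - 1)) / (n.descFactorial 5 : ℝ) := by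
  have h := uStat_splits (t := 1) (1 / 4) indD indD (fun w => w 0) (fun w => w 0)
    (fun _ _ _ _ _ => Iff.rfl) (fun _ _ _ _ _ => Iff.rfl) z (fun w i => a (w 0) i)
    (fun w i => b (w 0) i) (fun w i => ha _ _) (fun w i => hb _ _)
  rw [UD, h]
  congr 2
  rw [← (Equiv.funUnique (Fin 1) (Fin n)).symm.sum_comp]
  refine Finset.sum_congr rfl fun w _ => ?_
  have a1 : a w w = 1 := by rw [ha]; exact ind_true le_rfl
  have b1 : b w w = 1 := by rw [hb]; exact ind_true le_rfl
  rw [ind_true (Function.injective_of_subsingleton _)]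
  simp [a1, b1]

theorem UR_eq {r s n : ℕ} (z : Fin n → Obs r s) (a b : (Fin (r + s) → Fin n) → Fin n → ℝ)
    (ha : ∀ w i, a w i = ind (∀ j : Fin r, (z i).1 j ≤ (z (w (Fin.castAdd s j))).1 j))
    (hb : ∀ w i, b w i = ind (∀ j : Fin s, (z i).2 j ≤ (z (w (Fin.natAdd r j))).2 j)) :
    UR r s n z = (1 / 4) * (∑ w : Fin (r + s) → Fin n, ind (Function.Injective w) *
      hoef ((n : ℝ) - (r + s : ℕ)) (∑ i, a w i - ∑ k, a w (w k)) (∑ i, b w i - ∑ k, b w (w k))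
        (∑ i, a w i * b w i - ∑ k, a w (w k) * b w (w k))) /
        (n.descFactorial (r + s + 4) : ℝ) := by
  refine uStat_splits (t := r + s) (1 / 4) indRX indRY (fun w j => w (Fin.castAdd s j) j)
    (fun w j => w (Fin.natAdd r j) j) ?_ ?_ z a b ha hb
  · intro a b c e w
    rw [indRX, Splits]
    have : (fun j : Fin r => tup a b c e w ⟨4 + j, by omega⟩ j) =
        fun j => w (Fin.castAdd s j) j := by
      ext j; rw [tup_add a b c e w j (by omega)]; rfl
    rw [this]
    exact Iff.rfl
  · intro a b c e w
    rw [indRY, Splits]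
    have : (fun j : Fin s => tup a b c e w ⟨4 + (r + j), by omega⟩ j) =
        fun j => w (Fin.natAdd r j) j := by
      ext j; rw [tup_add a b c e w (r + j) (by omega)]; rfl
    rw [this]
    exact Iff.rfl

/-- The expression for `hoef`. -/
def hoefExp (N A B P : RExp) : RExp :=
  let m := RExp.mul
  let k := fun (c : ℕ) (e : RExp) => RExp.mul (RExp.num c) e
  let f := k 2 (RExp.sub (m N P) (m A B))
  let g := RExp.add (RExp.add (RExp.add
    (m P (RExp.add (RExp.add (RExp.sub (RExp.sub (m N N) (m (k 2 N) B)) (m (k 2 N) A))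
      (m (k 2 N) P)) (m (k 2 A) B)))
    (m A (RExp.sub (m B B) (m (k 2 B) P)))) (m B (RExp.sub (m A A) (m (k 2 A) P)))) (m (m N P) P)
  let h := RExp.add (RExp.sub (RExp.sub (RExp.add (m (k 2 N) P) (m (k 2 A) B)) (m (k 4 P) B))
    (m (k 4 A) P)) (m (k 4 P) P)
  RExp.add (RExp.sub (m f f) (k 4 g)) (k 2 h)

theorem eval_hoefExp (σ : Mem) (N A B P : RExp) :
    (hoefExp N A B P).eval σ = hoef (N.eval σ) (A.eval σ) (B.eval σ) (P.eval σ) := by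
  simp only [hoefExp, RExp.eval, RExp.eval_num, hoef]
  push_cast
  ring

/-- The expression `n (n - 1) ⋯ (n - m + 1)`. -/
def descExp (m : ℕ) : RExp :=
  RExp.prod m fun k => RExp.sub (RExp.ofNat (NExp.var 0)) (RExp.num k)

theorem eval_descExp {σ : Mem} {n m : ℕ} (hn : σ.nat 0 0 = n) (hmn : m ≤ n) :
    (descExp m).eval σ = (n.descFactorial m : ℝ) := by
  rw [descExp, RExp.eval_prod, Nat.descFactorial_eq_prod_range, Nat.cast_prod]
  refine Finset.prod_congr rfl fun k hk => ?_
  rw [Finset.mem_range] at hk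
  simp [RExp.eval, RExp.eval_num, hn, Nat.cast_sub (by omega : k ≤ n)]

/-! ### Points and queries -/

/-- Stores a point with the coordinates `pe k` and the weight `u` as item number `pos`, and a query
with the coordinates `qe k` as item number `N + pos`. -/
def setItem (B D : ℕ) (N pos : NExp) (pe qe : ℕ → RExp) (u : RExp) : Cmd :=
  Cmd.seq (Cmd.rep D fun k => Cmd.seq (Cmd.setR (B + 10 + k) pos (pe k))
      (Cmd.setR (B + 10 + k) (NExp.add N pos) (qe k)))
    (Cmd.seq (Cmd.setR (B + 1) pos u)
    (Cmd.seq (Cmd.setR (B + 1) (NExp.add N pos) (RExp.num 0))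
      (Cmd.setR (B + 2) (NExp.add N pos) (RExp.num 0))))

theorem writesN_setItem {B D : ℕ} {N pos : NExp} {pe qe : ℕ → RExp} {u : RExp} (a : ℕ) :
    ¬ (setItem B D N pos pe qe u).WritesN a := by
  simp [setItem, Cmd.WritesN, Cmd.writesN_rep]

theorem writesR_setItem {B D : ℕ} {N pos : NExp} {pe qe : ℕ → RExp} {u : RExp} (a : ℕ)
    (h : (setItem B D N pos pe qe u).WritesR a) : a = B + 1 ∨ a = B + 2 ∨ B + 10 ≤ a := by
  simp only [setItem, Cmd.WritesR, Cmd.writesR_rep] at h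
  rcases h with ⟨k, -, h⟩ | h | h | h <;> omega

/-- The first `t` of `n` points and queries have been stored. -/
def Items (B D n t : ℕ) (P Q : ℕ → ℕ → ℝ) (W : ℕ → ℝ) (σ : Mem) : Prop :=
  ∀ i < t, (∀ k < D, σ.real (B + 10 + k) i = P k i ∧ σ.real (B + 10 + k) (n + i) = Q k i) ∧
    σ.real (B + 1) i = W i ∧ σ.real (B + 1) (n + i) = 0 ∧ σ.real (B + 2) (n + i) = 0

/-- The expressions are evaluated while the item is partly written. They are therefore required to
depend only on the naturals and on the real arrays up to `B`, which stay untouched. -/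
theorem runs_setItem {B D n t f : ℕ} {P Q : ℕ → ℕ → ℝ} {W : ℕ → ℝ} {σ : Mem} {N pos : NExp}
    {pe qe : ℕ → RExp} {u : RExp} (hf : 1 ≤ f) (ht : t < n)
    (hN : ∀ τ : Mem, τ.nat = σ.nat → N.eval τ = n) (hpos : ∀ τ : Mem, τ.nat = σ.nat → pos.eval τ = t)
    (hI : Items B D n t P Q W σ)
    (hp : ∀ k < D, ∀ τ : Mem, τ.nat = σ.nat → (∀ a ≤ B, τ.real a = σ.real a) →
      (pe k).eval τ = P k t)
    (hq : ∀ k < D, ∀ τ : Mem, τ.nat = σ.nat → (∀ a ≤ B, τ.real a = σ.real a) →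
      (qe k).eval τ = Q k t)
    (hu : ∀ τ : Mem, τ.nat = σ.nat → (∀ a ≤ B, τ.real a = σ.real a) → u.eval τ = W t) :
    Runs (setItem B D N pos pe qe u) σ f fun τ => Items B D n (t + 1) P Q W τ := by
  refine Runs.seq ((Runs.rep (fun j τ => (∀ a, a < B + 10 → τ.real a = σ.real a) ∧
    (∀ i < t, ∀ k < D, τ.real (B + 10 + k) i = P k i ∧ τ.real (B + 10 + k) (n + i) = Q k i) ∧
    ∀ k < j, τ.real (B + 10 + k) t = P k t ∧ τ.real (B + 10 + k) (n + t) = Q k t) hf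
    ⟨fun _ _ => rfl, fun i hi => (hI i hi).1, by simp⟩ ?_).mono le_rfl ?_)
  · rintro j hj τ hτ ⟨h1, h2, h3⟩
    have hn : τ.nat = σ.nat := by
      ext a : 1
      exact hτ.nat a (by simp [Cmd.WritesN, Cmd.writesN_rep])
    refine Runs.seq (Runs.setR hf (Runs.setR hf ?_))
    have e1 : (NExp.add N pos).eval (τ.setR (B + 10 + j) t (P j t)) = n + t := by
      simp only [NExp.eval]
      rw [hN (τ.setR _ _ _) hn, hpos (τ.setR _ _ _) hn]
    rw [hpos τ hn, hp j hj τ hn (fun a ha => h1 a (by omega)), e1,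
      hq j hj (τ.setR (B + 10 + j) t (P j t)) hn
        (fun a ha => by rw [Mem.setR_real_of_ne (by omega), h1 a (by omega)])]
    refine ⟨fun a ha => ?_, fun i hi k hk => ?_, fun k hk => ?_⟩
    · rw [Mem.setR_real_of_ne (by omega), Mem.setR_real_of_ne (by omega), h1 a ha]
    · have n1 : i ≠ t := by omega
      have n2 : i ≠ n + t := by omega
      have n3 : n + i ≠ t := by omega
      simpa [n1, n2, n3] using h2 i hi k hk
    · have n2 : t ≠ n + t := by omega
      have n3 : n + t ≠ t := by omega
      by_cases hkj : k = j
      · have n4 : n ≠ 0 := by omega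
        subst hkj; simp [n4]
      · have := h3 k (by omega)
        simpa [hkj] using this
  · rintro τ hτ ⟨h1, h2, h3⟩
    have hn : τ.nat = σ.nat := by
      ext a : 1
      exact hτ.nat a (by simp [Cmd.WritesN, Cmd.writesN_rep])
    refine Runs.seq (Runs.setR hf (Runs.seq (Runs.setR hf (Runs.setR hf ?_))))
    have e1 : ∀ υ : Mem, υ.nat = σ.nat → (NExp.add N pos).eval υ = n + t := fun υ h => by
      simp only [NExp.eval]
      rw [hN _ h, hpos _ h]
    rw [hpos τ hn, hu τ hn (fun a ha => h1 a (by omega)), e1 (τ.setR _ _ _) hn,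
      e1 ((τ.setR _ _ _).setR _ _ _) hn]
    intro i hi
    refine ⟨fun k hk => ?_, ?_⟩
    · rw [Mem.setR_real_of_ne (by omega), Mem.setR_real_of_ne (by omega),
        Mem.setR_real_of_ne (by omega)]
      by_cases hit : i = t
      · subst hit; exact h3 k hk
      · exact h2 i (by omega) k hk
    · by_cases hit : i = t
      · subst hit
        have n2 : n ≠ 0 := by omega
        simp [RExp.eval_num, n2]
      · have n1 : i ≠ n + t := by omega
        have n2 : n + i ≠ t := by omega
        obtain ⟨-, i1, i2, i3⟩ := hI i (by omega)
        rw [← h1 _ (by omega)] at i1 i2 i3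
        simp [hit, n1, n2, i1, i2, i3]

/-- Queries carry weight `0`, so only points contribute to the sums; points have smaller item
numbers than queries, so the tie-breaking order counts equal coordinates as dominated. -/
theorem runs_dominance_items {B K n L : ℕ} (hK : 1 ≤ K) {σ : Mem} (hE : σ.nat 1 0 = n + n)
    (hL : L = Nat.clog 2 (n + n)) (hcnt : ∀ x, σ.real (B + 3) x = 0) {P Q : ℕ → ℕ → ℝ}
    {W : ℕ → ℝ} (hI : Items B (K + 1) n n P Q W σ) :
    Runs (dominance B K) σ ((2 ^ L + 2) * (L + 1) ^ K) fun τ => (∀ x, τ.real (B + 3) x = 0) ∧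
      ∀ i < n, τ.real (B + 2) (n + i) = ∑ p ∈ Finset.range n, W p *
        ∏ k ∈ Finset.range (K + 1), ind (P k p ≤ Q k i) := by
  refine (runs_dominance hK hE hL hcnt).mono le_rfl ?_
  rintro τ - ⟨h1, h2⟩
  refine ⟨h1, fun i hi => ?_⟩
  obtain ⟨-, -, -, i3⟩ := hI i hi
  rw [h2 (n + i) (by omega), i3, zero_add, Finset.sum_range_add, add_eq_left.mpr]
  · refine Finset.sum_congr rfl fun p hp => ?_
    rw [Finset.mem_range] at hp
    obtain ⟨j0, j1, -, -⟩ := hI p hp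
    rw [j1]
    congr 1
    refine Finset.prod_congr rfl fun k hk => ?_
    rw [Finset.mem_range] at hk
    -- Since `p < n + i`, a tie is decided in favour of the point, and the lexicographic order
    -- amounts to `≤`.
    refine ind_congr ?_
    rw [LexLT, (j0 k hk).1, ((hI i hi).1 k hk).2, le_iff_lt_or_eq]
    have : p < n + i := by omega
    simp [this]
  · refine Finset.sum_eq_zero fun p hp => ?_
    rw [Finset.mem_range] at hp
    rw [(hI p hp).2.2.1, zero_mul]

/-! ### The program for `U_D` -/

/-- For every observation `i`, counts the observations which are at most the observation `i` in all
coordinates `k < d` with `m k`, and stores the count in the real array `o`. -/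
def countBelow (d : ℕ) (m : ℕ → Bool) (o : ℕ) : Cmd :=
  Cmd.seq (Cmd.setV 1 (NExp.add (NExp.var 0) (NExp.var 0)))
    (Cmd.seq (Cmd.for 14 (NExp.var 0)
      (setItem d d (NExp.var 0) (NExp.var 14)
        (fun k => if m k then RExp.load k (NExp.var 14) else RExp.num 0)
        (fun k => if m k then RExp.load k (NExp.var 14) else RExp.num 0) (RExp.num 1)))
    (Cmd.seq (dominance d (d - 1))
      (Cmd.for 14 (NExp.var 0)
        (Cmd.setR o (NExp.var 14) (RExp.load (d + 2) (NExp.add (NExp.var 0) (NExp.var 14)))))))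

/-- Coordinates outside the mask are set to `0` in points and queries alike, where `0 ≤ 0` imposes
no condition. The bounds on `o` keep the result away from the working arrays of `dominance` and from
the items. -/
theorem runs_countBelow {d n L o : ℕ} (m : ℕ → Bool) (hd : 2 ≤ d) (ho : d + 4 ≤ o) (ho' : o < d + 10)
    (hL : L = Nat.clog 2 (n + n)) {σ : Mem} (hn : σ.nat 0 0 = n)
    (hcnt : ∀ x, σ.real (d + 3) x = 0) :
    Runs (countBelow d m o) σ ((2 ^ L + 2) * (L + 1) ^ (d - 1)) fun τ =>
      τ.nat 0 = σ.nat 0 ∧ (∀ x, τ.real (d + 3) x = 0) ∧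
      (∀ a, a ≤ d ∨ (d + 4 ≤ a ∧ a < d + 10 ∧ a ≠ o) → τ.real a = σ.real a) ∧
      ∀ i < n, τ.real o i = ∑ p ∈ Finset.range n,
        ∏ k ∈ Finset.range d, ind (m k = true → σ.real k p ≤ σ.real k i) := by
  have hEL : n + n ≤ 2 ^ L := by rw [hL]; exact Nat.le_pow_clog (by norm_num) _
  have hpow : 1 ≤ (L + 1) ^ (d - 1) := Nat.one_le_pow _ _ (by omega)
  set g := (2 ^ L + 2) * (L + 1) ^ (d - 1) with hg
  have hg1 : n + 1 ≤ g := le_trans (by omega) (Nat.le_mul_of_pos_right _ hpow)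
  have hd1 : d - 1 + 1 = d := by omega
  refine Runs.seq (Runs.setV (by omega) ?_)
  simp only [NExp.eval, NExp.eval_var, hn]
  set σ1 := σ.setN 1 0 (n + n) with hσ1
  set C : ℕ → ℕ → ℝ := fun k i => if m k then σ.real k i else 0 with hC
  refine Runs.seq ((Runs.for (N := n) (f := 1) (Q := fun τ => Items d d n n C C (fun _ => 1) τ)
    (fun t τ => Items d d n t C C (fun _ => 1) τ)
    le_rfl (by omega : (n + 1) * 1 ≤ g) (writesN_setItem _) ?_ ?_ ?_ (fun _ _ h => h)).mono le_rfl ?_)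
  · intro τ hτ
    rw [NExp.eval_var, hτ.nat 0]
    · simp [hσ1, hn]
    · simp [Cmd.writesN_for, writesN_setItem]
  · intro i hi
    omega
  · intro t ht τ hτ hv hI
    have h0 : τ.nat 0 0 = n := by
      rw [hτ.nat 0]
      · simp [hσ1, hn]
      · simp [Cmd.writesN_for, writesN_setItem]
    have hr : ∀ k < d, τ.real k = σ.real k := fun k hk => hτ.real k (fun h => by
      rw [Cmd.writesR_for] at h
      have := writesR_setItem _ h
      omega)
    have hC' : ∀ k < d, ∀ υ : Mem, υ.nat = τ.nat → (∀ a ≤ d, υ.real a = τ.real a) →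
        (if m k then RExp.load k (NExp.var 14) else RExp.num 0).eval υ = C k t := by
      intro k hk υ h1 h2
      by_cases hm : m k <;> simp [hm, hC, RExp.eval, RExp.eval_num, h1, hv, h2 k hk.le, hr k hk]
    exact (runs_setItem le_rfl ht (fun υ h => by rw [NExp.eval_var, h, h0])
      (fun υ h => by rw [NExp.eval_var, h, hv]) hI hC' hC'
      (fun υ _ _ => by simp [RExp.eval_num])).mono le_rfl fun υ _ h => h
  intro τ hτ hI
  have tN : ∀ a, a ≠ 14 → τ.nat a = σ1.nat a := fun a ha => hτ.nat a (by
    simp [Cmd.writesN_for, writesN_setItem, ha])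
  have tR : ∀ a, a ≤ d ∨ (d + 3 ≤ a ∧ a < d + 10) → τ.real a = σ.real a := fun a ha =>
    hτ.real a (fun h => by
      rw [Cmd.writesR_for] at h
      have := writesR_setItem _ h
      omega)
  rw [← hd1] at hI
  refine Runs.seq ((runs_dominance_items (n := n) (by omega) ?_ hL ?_ (by rw [hd1] at hI ⊢; exact hI)).mono
    le_rfl ?_)
  · rw [tN 1 (by norm_num)]; simp [hσ1]
  · rw [tR _ (by omega)]; exact hcnt
  rintro υ hυ ⟨h1, h2⟩
  have uN : υ.nat 0 = σ.nat 0 := by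
    rw [hυ.nat 0, tN 0 (by norm_num), hσ1, Mem.setN_nat_of_ne (by norm_num)]
    intro h
    have := writesN_dominance _ _ _ h
    omega
  have uR : ∀ a, a ≤ d ∨ (d + 4 ≤ a ∧ a < d + 10) → υ.real a = σ.real a := fun a ha => by
    rw [hυ.real a, tR a (by omega)]
    intro h
    have := writesR_dominance _ _ _ h
    omega
  refine Runs.for (N := n) (f := 1) (fun t ω => ∀ i < t, ω.real o i = υ.real (d + 2) (n + i))
    le_rfl (by omega) (by simp [Cmd.WritesN]) ?_ (by simp) ?_ ?_
  · intro ω hω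
    rw [NExp.eval_var, hω.nat 0 (by simp [Cmd.writesN_for, Cmd.WritesN]), uN, hn]
  · intro t ht ω hω hv h
    refine Runs.setR le_rfl fun i hi => ?_
    have e0 : ω.nat 0 0 = n := by
      rw [hω.nat 0 (by simp [Cmd.writesN_for, Cmd.WritesN]), uN, hn]
    have e1 : ω.real (d + 2) = υ.real (d + 2) := hω.real _ (by
      simp only [Cmd.writesR_for, Cmd.WritesR]; omega)
    by_cases hit : i = t
    · simp [hit, RExp.eval, NExp.eval, hv, e0, e1]
    · simp [hit, RExp.eval, NExp.eval, hv, h i (by omega)]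
  · intro ω hω h
    refine ⟨?_, fun x => ?_, fun a ha => ?_, fun i hi => ?_⟩
    · rw [hω.nat 0 (by simp [Cmd.writesN_for, Cmd.WritesN]), uN]
    · rw [hω.real _ (by simp only [Cmd.writesR_for, Cmd.WritesR]; omega), h1]
    · rw [hω.real _ (by simp only [Cmd.writesR_for, Cmd.WritesR]; omega), uR a (by omega)]
    · rw [h i hi, h2 i hi, hd1]
      refine Finset.sum_congr rfl fun p _ => ?_
      rw [one_mul]
      refine Finset.prod_congr rfl fun k _ => ?_
      by_cases hm : m k <;> simp [hC, hm]

theorem two_pow_clog_le {x : ℕ} (hx : 1 ≤ x) : 2 ^ Nat.clog 2 x ≤ 2 * x := by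
  rcases hx.eq_or_lt with rfl | h
  · simp
  · have h1 := Nat.pow_pred_clog_lt_self (b := 2) (by norm_num) h
    have h2 : 0 < Nat.clog 2 x := Nat.clog_pos (by norm_num) h
    obtain ⟨l, hl⟩ := Nat.exists_eq_succ_of_ne_zero h2.ne'
    rw [hl, Nat.pred_succ] at h1
    rw [hl, pow_succ]
    omega

/-- Rounding `2 * n ^ j` up to a power of two gives at most `4 * n ^ j`, and adding `2` at most `6 *
n ^ j`. The bound `4 ≤ n` makes the logarithm at least `2`, so that `3 + j * Real.logb 2 n` is at
most `(2 + j) * Real.logb 2 n`. -/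
theorem dominance_time_le {n j K x : ℕ} (hn : 4 ≤ n) (hx : x = 2 * n ^ j) :
    (((2 ^ Nat.clog 2 x + 2) * (Nat.clog 2 x + 1) ^ K : ℕ) : ℝ) ≤
      (6 * (2 + j) ^ K) * ((n : ℝ) ^ j * Real.logb 2 n ^ K) := by
  have hn0 : (0 : ℝ) < n := by positivity
  have hp : 1 ≤ n ^ j := Nat.one_le_pow _ _ (by omega)
  have h1 := two_pow_clog_le (x := x) (by omega)
  set L := Nat.clog 2 x
  have h2 : (2 : ℝ) ^ L ≤ 4 * (n : ℝ) ^ j := by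
    have : 2 ^ L ≤ 4 * n ^ j := by omega
    exact_mod_cast this
  have hp' : (1 : ℝ) ≤ (n : ℝ) ^ j := by exact_mod_cast hp
  have hl : 2 ≤ Real.logb 2 n := by
    rw [Real.le_logb_iff_rpow_le (by norm_num) hn0]
    norm_num
    exact hn
  have h3 : (L : ℝ) ≤ 2 + j * Real.logb 2 n := by
    have h4 : Real.logb 2 ((2 : ℝ) ^ L) ≤ Real.logb 2 (4 * (n : ℝ) ^ j) :=
      Real.logb_le_logb_of_le (by norm_num) (by positivity) h2
    have h5 : Real.logb 2 4 = 2 := by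
      rw [show (4 : ℝ) = 2 ^ (2 : ℕ) by norm_num, Real.logb_pow, Real.logb_self_eq_one (by norm_num)]
      norm_num
    rwa [Real.logb_pow, Real.logb_self_eq_one (by norm_num), mul_one,
      Real.logb_mul (by norm_num) (by positivity), h5, Real.logb_pow] at h4
  push_cast
  calc ((2 : ℝ) ^ L + 2) * ((L : ℝ) + 1) ^ K
      ≤ (6 * (n : ℝ) ^ j) * ((2 + j) * Real.logb 2 n) ^ K := by
        gcongr
        · linarith
        · nlinarith
    _ = _ := by rw [mul_pow]; ring

/-- The program for `U_D`. -/
def progD (r s : ℕ) : Cmd :=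
  let d := r + s
  let cnt := fun o => RExp.sub (RExp.load o (NExp.var 14)) (RExp.num 1)
  Cmd.seq (countBelow d (fun k => decide (k < r)) (d + 4))
    (Cmd.seq (countBelow d (fun k => decide (r ≤ k)) (d + 5))
    (Cmd.seq (countBelow d (fun _ => true) (d + 6))
    (Cmd.seq (Cmd.for 14 (NExp.var 0) (Cmd.setR d (NExp.const 0)
      (RExp.add (RExp.load d (NExp.const 0))
        (hoefExp (RExp.sub (RExp.ofNat (NExp.var 0)) (RExp.num 1)) (cnt (d + 4)) (cnt (d + 5))
          (cnt (d + 6))))))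
      (Cmd.setR d (NExp.const 0) (RExp.div (RExp.load d (NExp.const 0))
        (RExp.mul (RExp.num 4) (descExp 5)))))))

theorem prod_ind_range (d : ℕ) (p : ℕ → Prop) :
    ∏ k ∈ Finset.range d, ind (p k) = ind (∀ k < d, p k) := by
  rw [prod_ind]
  simp

theorem runs_progD {r s n : ℕ} (hr : 1 ≤ r) (hs : 1 ≤ s) (hn : 5 ≤ n) (z : Fin n → Obs r s) :
    Runs (progD r s) (input z)
      ((2 ^ Nat.clog 2 (n + n) + 2) * (Nat.clog 2 (n + n) + 1) ^ (r + s - 1))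
      fun σ => σ.real (r + s) 0 = UD r s n z := by
  set L := Nat.clog 2 (n + n) with hL
  have hEL : n + n ≤ 2 ^ L := by rw [hL]; exact Nat.le_pow_clog (by norm_num) _
  have hpow : 1 ≤ (L + 1) ^ (r + s - 1) := Nat.one_le_pow _ _ (by omega)
  have hg1 : n + 1 ≤ (2 ^ L + 2) * (L + 1) ^ (r + s - 1) :=
    le_trans (by omega) (Nat.le_mul_of_pos_right _ hpow)
  set g := (2 ^ L + 2) * (L + 1) ^ (r + s - 1) with hg
  have hz := holds_input z
  have i0 : (input z).nat 0 0 = n := by simp [input]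
  have ir : ∀ a x, r + s ≤ a → (input z).real a x = 0 := by
    intro a x ha
    have h1 : ¬ a < r := by omega
    have h2 : ¬ a - r < s := by omega
    simp [input, h1, h2]
  set σ := input z with hσ
  -- Three counts are made for every observation: in the `x` coordinates, in the `y` coordinates,
  -- and in all of them. Each pass returns the counters to zero for the next one.
  refine Runs.seq ((runs_countBelow _ (by omega) (by omega) (by omega) hL i0
    (fun x => ir _ _ (by omega))).mono le_rfl ?_)
  rintro σ1 - ⟨a1, a2, a3, a4⟩
  refine Runs.seq ((runs_countBelow _ (by omega) (by omega) (by omega) hL (by rw [a1, i0])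
    a2).mono le_rfl ?_)
  rintro σ2 - ⟨b1, b2, b3, b4⟩
  refine Runs.seq ((runs_countBelow _ (by omega) (by omega) (by omega) hL (by rw [b1, a1, i0])
    b2).mono le_rfl ?_)
  rintro σ3 - ⟨c1, c2, c3, c4⟩
  have hA : ∀ i < n, σ3.real (r + s + 4) i = ∑ p ∈ Finset.range n,
      ind (∀ k < r, σ.real (0 + k) p ≤ σ.real (0 + k) i) := by
    intro i hi
    rw [c3 _ (by omega), b3 _ (by omega), a4 i hi]
    refine Finset.sum_congr rfl fun p _ => ?_
    rw [prod_ind_range]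
    refine ind_congr ⟨fun h k hk => ?_, fun h k hk hm => ?_⟩
    · rw [zero_add]; exact h k (by omega) (by simpa using hk)
    · have := h k (by simpa using hm)
      rwa [zero_add] at this
  have hB : ∀ i < n, σ3.real (r + s + 5) i = ∑ p ∈ Finset.range n,
      ind (∀ k < s, σ.real (r + k) p ≤ σ.real (r + k) i) := by
    intro i hi
    rw [c3 _ (by omega), b4 i hi]
    refine Finset.sum_congr rfl fun p _ => ?_
    rw [prod_ind_range]
    refine ind_congr ⟨fun h k hk => ?_, fun h k hk hm => ?_⟩
    · have := h (r + k) (by omega) (by simp)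
      rwa [a3 _ (by omega)] at this
    · rw [a3 _ (by omega)]
      have hm' : r ≤ k := by simpa using hm
      have := h (k - r) (by omega)
      rwa [show r + (k - r) = k by omega] at this
  have hP : ∀ i < n, σ3.real (r + s + 6) i = ∑ p ∈ Finset.range n,
      (ind (∀ k < r, σ.real (0 + k) p ≤ σ.real (0 + k) i) *
        ind (∀ k < s, σ.real (r + k) p ≤ σ.real (r + k) i)) := by
    intro i hi
    rw [c4 i hi]
    refine Finset.sum_congr rfl fun p _ => ?_
    rw [prod_ind_range, ← ind_and]
    refine ind_congr ⟨fun h => ⟨fun k hk => ?_, fun k hk => ?_⟩, fun h k hk hm => ?_⟩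
    · have := h k (by omega) rfl
      rwa [b3 _ (by omega), a3 _ (by omega), ← zero_add k] at this
    · have := h (r + k) (by omega) rfl
      rwa [b3 _ (by omega), a3 _ (by omega)] at this
    · rw [b3 _ (by omega), a3 _ (by omega)]
      by_cases hkr : k < r
      · have := h.1 k hkr
        rwa [zero_add] at this
      · have := h.2 (k - r) (by omega)
        rwa [show r + (k - r) = k by omega] at this
  set a : Fin n → Fin n → ℝ := fun w i => ind ((z i).1 ≤ (z w).1) with ha
  set b : Fin n → Fin n → ℝ := fun w i => ind ((z i).2 ≤ (z w).2) with hb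
  have hA' : ∀ w : Fin n, σ3.real (r + s + 4) w = ∑ i, a w i := by
    intro w
    rw [hA w w.2, Finset.sum_range]
    exact Finset.sum_congr rfl fun i _ => ind_congr (hz.le_fst i w)
  have hB' : ∀ w : Fin n, σ3.real (r + s + 5) w = ∑ i, b w i := by
    intro w
    rw [hB w w.2, Finset.sum_range]
    exact Finset.sum_congr rfl fun i _ => ind_congr (hz.le_snd i w)
  have hP' : ∀ w : Fin n, σ3.real (r + s + 6) w = ∑ i, a w i * b w i := by
    intro w
    rw [hP w w.2, Finset.sum_range]
    exact Finset.sum_congr rfl fun i _ => congrArg₂ _ (ind_congr (hz.le_fst i w))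
      (ind_congr (hz.le_snd i w))
  have n3 : σ3.nat 0 0 = n := by rw [c1, b1, a1, i0]
  have r3 : σ3.real (r + s) 0 = 0 := by
    rw [c3 _ (by omega), b3 _ (by omega), a3 _ (by omega), ir _ _ le_rfl]
  clear_value σ
  refine Runs.seq ((Runs.for (N := n) (f := 1) (Q := fun τ => τ.nat 0 0 = n ∧ τ.real (r + s) 0 =
      ∑ w ∈ Finset.range n, hoef ((n : ℝ) - 1) (σ3.real (r + s + 4) w - 1)
        (σ3.real (r + s + 5) w - 1) (σ3.real (r + s + 6) w - 1))
    (fun t τ => τ.real (r + s) 0 = ∑ w ∈ Finset.range t, hoef ((n : ℝ) - 1)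
      (σ3.real (r + s + 4) w - 1) (σ3.real (r + s + 5) w - 1) (σ3.real (r + s + 6) w - 1))
    le_rfl (by omega : (n + 1) * 1 ≤ g) (by simp [Cmd.WritesN]) ?_ (by simp [r3]) ?_ ?_).mono
      le_rfl ?_)
  · intro τ hτ
    rw [NExp.eval_var, hτ.nat 0 (by simp [Cmd.writesN_for, Cmd.WritesN]), n3]
  · intro t ht τ hτ hv h
    have e0 : τ.nat 0 0 = n := by
      rw [hτ.nat 0 (by simp [Cmd.writesN_for, Cmd.WritesN]), n3]
    have er : ∀ k, k ≠ r + s → τ.real k = σ3.real k := fun k hk => hτ.real k (by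
      simpa [Cmd.writesR_for, Cmd.WritesR] using hk)
    refine Runs.setR le_rfl ?_
    rw [Finset.sum_range_succ, ← h]
    simp [RExp.eval, NExp.eval, eval_hoefExp, RExp.eval_num, e0, hv, er]
  · intro τ hτ h
    exact ⟨by rw [hτ.nat 0 (by simp [Cmd.writesN_for, Cmd.WritesN]), n3], h⟩
  · rintro τ - ⟨h1, h2⟩
    refine Runs.setR (by omega) ?_
    rw [UD_eq z a b (fun _ _ => rfl) (fun _ _ => rfl)]
    simp only [RExp.eval, NExp.eval, eval_descExp h1 hn, RExp.eval_num, h2, Mem.setR_real,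
      and_self, if_true, Finset.sum_range, hA', hB', hP']
    push_cast
    rw [div_mul_eq_div_div]
    ring

theorem exists_program_UD (r s : ℕ) (hr : 1 ≤ r) (hs : 1 ≤ s) :
    ∃ P : Cmd, ComputesInTime r s 5 P (UD r s)
      (fun n => (n : ℝ) * Real.logb 2 n ^ (r + s - 1)) :=
  ⟨progD r s, computesInTime_of_runs
    (fun n => (2 ^ Nat.clog 2 (n + n) + 2) * (Nat.clog 2 (n + n) + 1) ^ (r + s - 1))
    (6 * (2 + (1 : ℕ)) ^ (r + s - 1)) (by positivity)
    (fun n hn => by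
      have := dominance_time_le (n := n) (j := 1) (K := r + s - 1) (x := n + n) (by omega)
        (by ring)
      rwa [pow_one] at this)
    fun n hn z => runs_progD hr hs hn z⟩

/-! ## The program for `U_R` -/

/-- `k` nested loops over the variables `p, …, p + k - 1`, all of them from `0` to `n - 1`. -/
def forNest (body : Cmd) : ℕ → ℕ → Cmd
  | 0, _ => body
  | k + 1, p => Cmd.for p (NExp.var 0) (forNest body k (p + 1))

/-- The sum of `g` over all values below `n` of the variables `p, …, p + k - 1`. -/
noncomputable def allSum (n : ℕ) (g : (ℕ → ℕ) → ℝ) : ℕ → ℕ → (ℕ → ℕ) → ℝ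
  | 0, _, v => g v
  | k + 1, p, v => ∑ i ∈ Finset.range n, allSum n g k (p + 1) (Function.update v p i)

theorem allSum_eq (n : ℕ) (g : (ℕ → ℕ) → ℝ) (k p : ℕ) (v : ℕ → ℕ) :
    allSum n g k p v = ∑ i : Fin k → Fin n, g (setVars p i v) := by
  induction k generalizing p v with
  | zero =>
    have hv : ∀ i : Fin 0 → Fin n, setVars p i v = v := fun i => by
      ext q; simp [setVars]
    simp [allSum, hv]
  | succ k ih =>
    rw [allSum, sum_fin_cons, Finset.sum_range]
    exact Finset.sum_congr rfl fun a _ => by simp only [setVars_cons, ih]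

/-- The innermost variable can be summed inside the summand. The last of the `d` loops of `U_R` is
taken out in this way and replaced by a sweep. -/
theorem allSum_succ (n : ℕ) (g : (ℕ → ℕ) → ℝ) (k p : ℕ) (v : ℕ → ℕ) :
    allSum n (fun u => ∑ c ∈ Finset.range n, g (Function.update u (p + k) c)) k p v =
      allSum n g (k + 1) p v := by
  induction k generalizing p v with
  | zero => rfl
  | succ k ih =>
    rw [allSum, allSum]
    refine Finset.sum_congr rfl fun i _ => ?_
    rw [← ih]
    simp only [show p + 1 + k = p + (k + 1) by omega]

theorem writesN_forNest (body : Cmd) (k p a : ℕ) :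
    (forNest body k p).WritesN a ↔ body.WritesN a ∨ p ≤ a ∧ a < p + k := by
  induction k generalizing p with
  | zero => simp [forNest]
  | succ k ih =>
    simp only [forNest, Cmd.writesN_for, ih]
    by_cases h : body.WritesN a
    · simp [h]
    · simp only [h, false_or]; omega

/-- The body must leave the loop variables and the variable holding `n` alone, and `Base` must
survive assignments to the arrays from `lo` on. Each of the `k` loops multiplies the time by `n +
1`. -/
theorem runs_forNest {body : Cmd} {n f lo hi c : ℕ} {g : (ℕ → ℕ) → ℝ} {Base : Mem → Prop}
    (hf : 1 ≤ f) (hlo : 1 ≤ lo) (hB : ∀ σ a i v, lo ≤ a → Base σ → Base (σ.setN a i v))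
    (hBn : ∀ σ, Base σ → σ.nat 0 0 = n)
    (hbody : ∀ τ v, Base τ → (∀ q, lo ≤ q → q < hi → τ.nat q 0 = v q ∧ v q < n) →
      Runs body τ f fun υ => Base υ ∧ υ.real c 0 = τ.real c 0 + g v)
    (hN : ∀ a, body.WritesN a → 1 ≤ a ∧ (a < lo ∨ hi ≤ a)) (k p : ℕ) (hp : lo ≤ p) (hpk : p + k = hi)
    (σ : Mem) (v : ℕ → ℕ) (hσ : Base σ)
    (hv : ∀ q, lo ≤ q → q < p → σ.nat q 0 = v q ∧ v q < n) :
    Runs (forNest body k p) σ ((n + 1) ^ k * f) fun υ => Base υ ∧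
      υ.real c 0 = σ.real c 0 + allSum n g k p v := by
  induction k generalizing p σ v with
  | zero =>
    rw [pow_zero, one_mul]
    exact hbody σ v hσ fun q h1 h2 => hv q h1 (by omega)
  | succ k ih =>
    have hpos : 1 ≤ (n + 1) ^ k * f := Nat.mul_pos (Nat.one_le_pow _ _ (by omega)) hf
    have hW : ∀ a, lo ≤ a → a < p → ¬ (forNest body (k + 1) p).WritesN a := by
      intro a h1 h2 h
      rw [writesN_forNest] at h
      rcases h with h | h
      · have := hN a h; omega
      · omega
    refine Runs.for (N := n) (f := (n + 1) ^ k * f) (fun i τ => Base τ ∧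
      τ.real c 0 = σ.real c 0 + ∑ j ∈ Finset.range i,
        allSum n g k (p + 1) (Function.update v p j)) hpos (by rw [pow_succ']; exact le_of_eq (by ring))
      ?_ ?_ ⟨hB _ _ _ _ hp hσ, by simp⟩ ?_ ?_
    · rw [writesN_forNest]
      rintro (h | h)
      · have := hN p h; omega
      · omega
    · intro τ hτ
      rw [NExp.eval_var, hτ.nat 0, hBn σ hσ]
      intro h
      have h' : (forNest body (k + 1) p).WritesN 0 := h
      rw [writesN_forNest] at h'
      rcases h' with h' | h'
      · have := hN 0 h'; omega
      · omega
    · rintro i hi' τ hτ hvp ⟨hb, hc⟩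
      refine (ih (p + 1) (by omega) (by omega) τ (Function.update v p i) hb ?_).mono le_rfl ?_
      · intro q h1 h2
        by_cases h : q = p
        · subst h; simp [hvp, hi']
        · rw [Function.update_of_ne h, hτ.nat q (hW q h1 (by omega))]
          exact hv q h1 (by omega)
      · rintro υ - ⟨h1, h2⟩
        refine ⟨hB _ _ _ _ hp h1, ?_⟩
        rw [Mem.setN_real, h2, hc, Finset.sum_range_succ, add_assoc]
    · rintro τ - h
      exact h

/-! ### Cumulative sums over buckets -/

/-- For `v ≤ n`, puts the sum of the values `e` of the indices with entry at most `v` in the array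
`15` into the entry `v` of the real array `o`. -/
def bucketSum (o : ℕ) (e : RExp) : Cmd :=
  let v := NExp.add (NExp.var 14) (NExp.const 1)
  let b := NExp.load 15 (NExp.var 14)
  Cmd.seq (Cmd.for 14 (NExp.add (NExp.var 0) (NExp.const 1)) (Cmd.setR o (NExp.var 14) (RExp.num 0)))
    (Cmd.seq (Cmd.for 14 (NExp.var 0) (Cmd.setR o b (RExp.add (RExp.load o b) e)))
      (Cmd.for 14 (NExp.var 0) (Cmd.setR o v (RExp.add (RExp.load o v) (RExp.load o (NExp.var 14))))))

theorem writesN_bucketSum (o : ℕ) (e : RExp) (a : ℕ) : (bucketSum o e).WritesN a ↔ a = 14 := by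
  simp [bucketSum, Cmd.WritesN, Cmd.writesN_for]

theorem writesR_bucketSum (o : ℕ) (e : RExp) (a : ℕ) : (bucketSum o e).WritesR a ↔ a = o := by
  simp [bucketSum, Cmd.WritesR, Cmd.writesR_for]

/-- Clearing, filling the buckets and forming prefix sums are three linear passes, so the cumulative
sums at all thresholds cost as much as a single one. -/
theorem runs_bucketSum {o n : ℕ} {e : RExp} {W : ℕ → ℝ} {σ : Mem} (hn : σ.nat 0 0 = n)
    (he : ∀ τ : Mem, (∀ a, a ≠ 14 → τ.nat a = σ.nat a) → (∀ a, a ≠ o → τ.real a = σ.real a) →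
      ∀ j < n, τ.nat 14 0 = j → e.eval τ = W j) :
    Runs (bucketSum o e) σ (n + 2) fun τ => ∀ v ≤ n, τ.real o v =
      ∑ j ∈ Finset.range n, if σ.nat 15 j ≤ v then W j else 0 := by
  refine Runs.seq ((Runs.for (N := n + 1) (f := 1) (Q := fun τ => ∀ v ≤ n, τ.real o v = 0)
    (fun t τ => ∀ v < t, τ.real o v = 0) le_rfl (by omega) (by simp [Cmd.WritesN]) ?_ (by simp) ?_
      ?_).mono le_rfl ?_)
  · intro τ hτ
    have := hτ.nat 0 (by simp [Cmd.writesN_for, Cmd.WritesN])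
    simp [NExp.eval, this, hn]
  · intro t ht τ hτ hv h
    refine Runs.setR le_rfl fun v hv' => ?_
    by_cases hvt : v = t
    · simp [hvt, hv, RExp.eval_num]
    · simp [hvt, hv, h v (by omega)]
  · intro τ _ h v hv
    exact h v (by omega)
  intro σ1 hF1 h1
  have n1 : ∀ a, a ≠ 14 → σ1.nat a = σ.nat a := fun a ha => hF1.nat a (by
    simp [Cmd.writesN_for, Cmd.WritesN, ha])
  have r1 : ∀ a, a ≠ o → σ1.real a = σ.real a := fun a ha => hF1.real a (by
    simp [Cmd.writesR_for, Cmd.WritesR, ha])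
  refine Runs.seq ((Runs.for (N := n) (f := 1) (Q := fun τ => ∀ v ≤ n, τ.real o v =
      ∑ j ∈ Finset.range n, if σ.nat 15 j = v then W j else 0)
    (fun t τ => ∀ v ≤ n, τ.real o v = ∑ j ∈ Finset.range t, if σ.nat 15 j = v then W j else 0)
    le_rfl (by omega) (by simp [Cmd.WritesN]) ?_ ?_ ?_ ?_).mono le_rfl ?_)
  · intro τ hτ
    rw [NExp.eval_var, hτ.nat 0 (by simp [Cmd.writesN_for, Cmd.WritesN]), n1 0 (by norm_num), hn]
  · intro v hv
    simp [h1 v hv]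
  · intro t ht τ hτ hvt h
    have n2 : ∀ a, a ≠ 14 → τ.nat a = σ.nat a := fun a ha => by
      rw [hτ.nat a (by simp [Cmd.writesN_for, Cmd.WritesN, ha]), n1 a ha]
    have r2 : ∀ a, a ≠ o → τ.real a = σ.real a := fun a ha => by
      rw [hτ.real a (by simp [Cmd.writesR_for, Cmd.WritesR, ha]), r1 a ha]
    refine Runs.setR le_rfl fun v hv => ?_
    have e1 := he τ n2 r2 t ht hvt
    rw [Finset.sum_range_succ, ← h v hv]
    by_cases hb : σ.nat 15 t = v
    · simp [NExp.eval, RExp.eval, hvt, n2, hb, e1]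
    · have hb' : v ≠ σ.nat 15 t := fun h => hb h.symm
      simp [NExp.eval, hvt, n2, hb, hb']
  · intro τ _ h
    exact h
  intro σ2 hF2 h2
  have n2 : σ2.nat 0 0 = n := by
    rw [hF2.nat 0 (by simp [Cmd.writesN_for, Cmd.WritesN]), n1 0 (by norm_num), hn]
  -- After `t` rounds the entries up to `t` are cumulative, and the later ones still hold single
  -- buckets.
  refine Runs.for (N := n) (f := 1) (fun t τ => ∀ v ≤ n, τ.real o v = ∑ j ∈ Finset.range n,
      if v ≤ t then (if σ.nat 15 j ≤ v then W j else 0) else (if σ.nat 15 j = v then W j else 0))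
    le_rfl (by omega) (by simp [Cmd.WritesN]) ?_ ?_ ?_ ?_
  · intro τ hτ
    rw [NExp.eval_var, hτ.nat 0 (by simp [Cmd.writesN_for, Cmd.WritesN]), n2]
  · intro v hv
    rw [Mem.setN_real, h2 v hv]
    refine Finset.sum_congr rfl fun j _ => ?_
    by_cases h : v = 0
    · subst h; simp
    · simp [h]
  · intro t ht τ hτ hvt h
    refine Runs.setR le_rfl fun v hv => ?_
    have h3 := h (t + 1) (by omega)
    have h4 := h t (by omega)
    by_cases hvt' : v = t + 1
    · subst hvt'
      simp only [RExp.eval, NExp.eval, NExp.eval_var, hvt, Mem.setN_real, Mem.setR_real, and_self,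
        if_true, h3, h4, ← Finset.sum_add_distrib]
      refine Finset.sum_congr rfl fun j _ => ?_
      by_cases c1 : σ.nat 15 j = t + 1
      · simp [c1]
      · by_cases c2 : σ.nat 15 j ≤ t
        · simp [c1, c2, Nat.le_succ_of_le c2]
        · have c3 : ¬ σ.nat 15 j ≤ t + 1 := by omega
          simp [c1, c2, c3]
    · have h5 := h v hv
      simp only [NExp.eval, NExp.eval_var, hvt, Mem.setN_real, Mem.setR_real, hvt', and_false,
        if_false, h5]
      refine Finset.sum_congr rfl fun j _ => ?_
      by_cases c1 : v ≤ t
      · simp [c1, Nat.le_succ_of_le c1]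
      · have c2 : ¬ v ≤ t + 1 := by omega
        simp [c1, c2]
  · intro τ _ h v hv
    rw [h v hv]
    simp [hv]

/-- Puts the number of entries of the real array `c` below the entry `i` into the entry `i` of the
array `15`. -/
def ranks (c : ℕ) : Cmd :=
  Cmd.for 16 (NExp.var 0)
    (Cmd.seq (Cmd.setN 15 (NExp.var 16) (NExp.const 0))
      (Cmd.for 14 (NExp.var 0)
        (Cmd.ite (Test.ltR (RExp.load c (NExp.var 14)) (RExp.load c (NExp.var 16)))
          (Cmd.setN 15 (NExp.var 16) (NExp.add (NExp.load 15 (NExp.var 16)) (NExp.const 1)))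
          Cmd.nop)))

-- Counting by comparing all pairs takes quadratic time, which is affordable here because `d ≥ 2`.
open Classical in
theorem runs_ranks {c n : ℕ} {σ : Mem} (hn : σ.nat 0 0 = n) :
    Runs (ranks c) σ ((n + 1) * (n + 1)) fun τ => ∀ i < n,
      τ.nat 15 i = ((Finset.range n).filter fun j => σ.real c j < σ.real c i).card := by
  refine Runs.for (N := n) (f := n + 1) (fun t τ => ∀ i < t,
      τ.nat 15 i = ((Finset.range n).filter fun j => σ.real c j < σ.real c i).card)
    (by omega) le_rfl (by simp [Cmd.WritesN, Cmd.writesN_for]) ?_ (by simp) ?_ ?_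
  · intro τ hτ
    rw [NExp.eval_var, hτ.nat 0 (by simp [Cmd.writesN_for, Cmd.WritesN]), hn]
  · intro t ht τ hτ hvt h
    have t0 : τ.nat 0 0 = n := by
      rw [hτ.nat 0 (by simp [Cmd.writesN_for, Cmd.WritesN]), hn]
    have tr : τ.real = σ.real := by
      ext a : 1
      exact hτ.real a (by simp [Cmd.writesR_for, Cmd.WritesR])
    refine Runs.seq (Runs.setN (by omega) ?_)
    simp only [NExp.eval, NExp.eval_var, hvt]
    refine Runs.for (N := n) (f := 1) (fun m υ => υ.nat 15 t =
        ((Finset.range m).filter fun j => σ.real c j < σ.real c t).card ∧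
        ∀ i, i ≠ t → υ.nat 15 i = τ.nat 15 i) le_rfl (by omega) (by simp [Cmd.WritesN]) ?_ ?_ ?_ ?_
    · intro υ hυ
      rw [NExp.eval_var, hυ.nat 0 (by simp [Cmd.writesN_for, Cmd.WritesN])]
      simp [t0]
    · refine ⟨by simp, fun i hi => by simp [hi]⟩
    · rintro m hm υ hυ hvm ⟨h1, h2⟩
      have u16 : υ.nat 16 0 = t := by
        rw [hυ.nat 16 (by simp [Cmd.writesN_for, Cmd.WritesN])]
        simp [hvt]
      have ur : υ.real = σ.real := by
        ext a : 1
        rw [hυ.real a (by simp [Cmd.writesR_for, Cmd.WritesR]), Mem.setN_real, tr]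
      refine Runs.ite le_rfl (fun hc => Runs.setN le_rfl ?_) (fun hc => Runs.nop le_rfl ?_)
      · simp only [Test.holds, RExp.eval, NExp.eval_var, hvm, u16, ur] at hc
        rw [Finset.range_add_one, Finset.filter_insert, if_pos hc, Finset.card_insert_of_notMem
          (by simp)]
        refine ⟨by simp [NExp.eval, u16, h1], fun i hi => by simp [NExp.eval, u16, hi, h2 i hi]⟩
      · simp only [Test.holds, RExp.eval, NExp.eval_var, hvm, u16, ur] at hc
        rw [Finset.range_add_one, Finset.filter_insert, if_neg hc]
        exact ⟨by simp [h1], fun i hi => by simp [h2 i hi]⟩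
    · rintro υ - ⟨h1, h2⟩ i hi
      by_cases hit : i = t
      · subst hit; simp [h1]
      · simp [h2 i hit, h i (by omega)]
  · intro τ _ h
    exact h

-- If `Z i < Z j`, everything below `Z i` is below `Z j`, and `i` itself is an additional element.
-- Ties give equal counts, so these ranks reproduce the weak order.
open Classical in
theorem card_lt_le_card_lt_iff {n : ℕ} (Z : ℕ → ℝ) {i j : ℕ} (hi : i < n) :
    ((Finset.range n).filter fun k => Z k < Z j).card ≤
      ((Finset.range n).filter fun k => Z k < Z i).card ↔ Z j ≤ Z i := by
  constructor
  · intro h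
    by_contra! hlt
    refine absurd h (not_le.mpr (Finset.card_lt_card ?_))
    refine (Finset.ssubset_iff_of_subset fun k hk => ?_).mpr ⟨i, ?_, ?_⟩
    · rw [Finset.mem_filter] at hk ⊢
      exact ⟨hk.1, hk.2.trans hlt⟩
    · simpa [hi] using hlt
    · simp
  · intro h
    refine Finset.card_le_card fun k hk => ?_
    rw [Finset.mem_filter] at hk ⊢
    exact ⟨hk.1, hk.2.trans_le h⟩

/-! ### Counts below a cut point and the sweep over its last coordinate -/

/-- The indicator of the points which are at most the cut point in the coordinates
`off, …, off + m - 1`, where the coordinate `k` of the cut point is that of the observation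
`u (20 + k)`. -/
noncomputable def box (Z : ℕ → ℕ → ℝ) (off m : ℕ) (u : ℕ → ℕ) (j : ℕ) : ℝ :=
  ∏ k ∈ Finset.range m, ind (Z (off + k) j ≤ Z (off + k) (u (20 + (off + k))))

def boxExp (off m : ℕ) (j : NExp) : RExp :=
  RExp.prod m fun k => RExp.le (RExp.load (off + k) j)
    (RExp.load (off + k) (NExp.var (20 + (off + k))))

theorem eval_boxExp {σ : Mem} {Z : ℕ → ℕ → ℝ} {off m : ℕ} {u : ℕ → ℕ} (j : NExp)
    (hZ : ∀ k < m, σ.real (off + k) = Z (off + k))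
    (hu : ∀ k < m, σ.nat (20 + (off + k)) 0 = u (20 + (off + k))) :
    (boxExp off m j).eval σ = box Z off m u (j.eval σ) := by
  rw [boxExp, RExp.eval_prod, box]
  refine Finset.prod_congr rfl fun k hk => ?_
  rw [Finset.mem_range] at hk
  simp [RExp.eval, hZ k hk, hu k hk]

/-- The indicator that the values of the variables `20, …, 20 + d - 1` are distinct. -/
noncomputable def distinct (d : ℕ) (u : ℕ → ℕ) : ℝ :=
  ∏ k ∈ Finset.range d, ∏ l ∈ Finset.range k, (1 - ind ((u (20 + k) : ℝ) ≤ u (20 + l)) *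
    ind ((u (20 + l) : ℝ) ≤ u (20 + k)))

def distinctExp (d : ℕ) : RExp :=
  RExp.prod d fun k => RExp.prod k fun l =>
    let a := RExp.ofNat (NExp.var (20 + k))
    let b := RExp.ofNat (NExp.var (20 + l))
    RExp.neg (RExp.mul (RExp.le a b) (RExp.le b a))

theorem eval_distinctExp {σ : Mem} {d : ℕ} {u : ℕ → ℕ}
    (hu : ∀ k < d, σ.nat (20 + k) 0 = u (20 + k)) :
    (distinctExp d).eval σ = distinct d u := by
  rw [distinctExp, RExp.eval_prod, distinct]
  refine Finset.prod_congr rfl fun k hk => ?_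
  rw [RExp.eval_prod]
  refine Finset.prod_congr rfl fun l hl => ?_
  rw [Finset.mem_range] at hk hl
  simp [RExp.eval_neg, RExp.eval, hu k hk, hu l (by omega)]

theorem distinct_eq {n d : ℕ} {u : ℕ → ℕ} (w : Fin d → Fin n) (hw : ∀ k : Fin d, u (20 + k) = w k) :
    distinct d u = ind (Function.Injective w) := by
  -- Real expressions offer only `≤`, so equality of two indices is tested by two weak inequalities
  -- between their casts.
  have h1 : ∀ k l, 1 - ind ((u (20 + k) : ℝ) ≤ u (20 + l)) * ind ((u (20 + l) : ℝ) ≤ u (20 + k)) =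
      ind (u (20 + k) ≠ u (20 + l)) := by
    intro k l
    rw [← ind_and, ← ind_not]
    refine ind_congr (not_congr ?_)
    rw [Nat.cast_le, Nat.cast_le]
    omega
  simp only [distinct, h1, prod_ind_range]
  refine ind_congr ⟨fun h a b hab => ?_, fun h k hk l hl he => ?_⟩
  · rcases lt_trichotomy a b with hlt | heq | hlt
    · exact absurd (by rw [hw, hw, hab]) (h b b.2 a hlt)
    · exact heq
    · exact absurd (by rw [hw, hw, hab]) (h a a.2 b hlt)
  · have e1 := hw ⟨k, hk⟩
    have e2 := hw ⟨l, by omega⟩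
    simp only at e1 e2
    have := h (Fin.ext (by rw [← e1, ← e2, he]) : w ⟨k, hk⟩ = w ⟨l, by omega⟩)
    simp only [Fin.mk.injEq] at this
    omega

/-- The summand of `U_R` for the cut point given by the variables `20, …, 20 + r + s - 1`. -/
noncomputable def cutTerm (n r s : ℕ) (Z : ℕ → ℕ → ℝ) (u : ℕ → ℕ) : ℝ :=
  distinct (r + s) u * hoef ((n : ℝ) - (r + s : ℕ))
    (∑ j ∈ Finset.range n, box Z 0 r u j - ∑ k ∈ Finset.range (r + s), box Z 0 r u (u (20 + k)))
    (∑ j ∈ Finset.range n, box Z r s u j - ∑ k ∈ Finset.range (r + s), box Z r s u (u (20 + k)))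
    (∑ j ∈ Finset.range n, box Z 0 r u j * box Z r s u j -
      ∑ k ∈ Finset.range (r + s), box Z 0 r u (u (20 + k)) * box Z r s u (u (20 + k)))

theorem UR_eq_sum_cutTerm {r s n : ℕ} (z : Fin n → Obs r s) {Z : ℕ → ℕ → ℝ}
    (hX : ∀ (i : Fin n) (j : Fin r), Z j i = (z i).1 j)
    (hY : ∀ (i : Fin n) (j : Fin s), Z (r + j) i = (z i).2 j) (v : ℕ → ℕ) :
    UR r s n z = (1 / 4) * allSum n (cutTerm n r s Z) (r + s) 20 v /
      (n.descFactorial (r + s + 4) : ℝ) := by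
  have hs : ∀ (w : Fin (r + s) → Fin n) (k : Fin (r + s)), setVars 20 w v (20 + k) = w k := by
    intro w k
    simp [setVars]
  rw [UR_eq z (fun w i => box Z 0 r (setVars 20 w v) i) (fun w i => box Z r s (setVars 20 w v) i),
    allSum_eq]
  · congr 2
    refine Finset.sum_congr rfl fun w _ => ?_
    rw [cutTerm, distinct_eq w (hs w)]
    simp only [Finset.sum_range, hs]
  · intro w i
    rw [box, prod_ind_range]
    simp only [zero_add]
    refine ind_congr ⟨fun h j => ?_, fun h k hk => ?_⟩
    · have := h j j.2
      have e := hs w (Fin.castAdd s j)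
      rw [Fin.val_castAdd] at e
      rwa [e, hX, hX] at this
    · have e := hs w (Fin.castAdd s ⟨k, hk⟩)
      rw [Fin.val_castAdd] at e
      have := h ⟨k, hk⟩
      rw [← hX, ← hX] at this
      rwa [← e] at this
  · intro w i
    rw [box, prod_ind_range]
    refine ind_congr ⟨fun h j => ?_, fun h k hk => ?_⟩
    · have := h j j.2
      have e := hs w (Fin.natAdd r j)
      rw [Fin.val_natAdd] at e
      rwa [e, hY, hY] at this
    · have e := hs w (Fin.natAdd r ⟨k, hk⟩)
      rw [Fin.val_natAdd] at e
      have := h ⟨k, hk⟩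
      rw [← hY, ← hY] at this
      rwa [← e] at this

/-- The summand of `U_R`, where the bucket sums are in the real arrays `r + s + 1`, `r + s + 2` and
`r + s + 3`. -/
noncomputable def cutTermExp (r s : ℕ) : RExp :=
  let d := r + s
  let b := NExp.load 15 (NExp.var (20 + (d - 1)))
  let A := fun k => boxExp 0 r (NExp.var (20 + k))
  let B := fun k => boxExp r s (NExp.var (20 + k))
  RExp.mul (distinctExp d) (hoefExp (RExp.sub (RExp.ofNat (NExp.var 0)) (RExp.num d))
    (RExp.sub (RExp.load (d + 1) (NExp.var 0)) (RExp.sum (Finset.range d) A))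
    (RExp.sub (RExp.load (d + 2) b) (RExp.sum (Finset.range d) B))
    (RExp.sub (RExp.load (d + 3) b) (RExp.sum (Finset.range d) fun k => RExp.mul (A k) (B k))))

/-- Adds up the summands of `U_R` over all last coordinates of the cut point. -/
noncomputable def sweep (r s : ℕ) : Cmd :=
  let d := r + s
  let A := boxExp 0 r (NExp.var 14)
  let B := boxExp r (s - 1) (NExp.var 14)
  Cmd.seq (bucketSum (d + 1) A) (Cmd.seq (bucketSum (d + 2) B)
    (Cmd.seq (bucketSum (d + 3) (RExp.mul A B))
    (Cmd.for (20 + (d - 1)) (NExp.var 0) (Cmd.setR d (NExp.const 0)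
      (RExp.add (RExp.load d (NExp.const 0)) (cutTermExp r s))))))

theorem writesN_sweep (r s a : ℕ) : (sweep r s).WritesN a ↔ a = 14 ∨ a = 20 + (r + s - 1) := by
  simp only [sweep, Cmd.WritesN, writesN_bucketSum, Cmd.writesN_for]
  tauto

theorem writesR_sweep (r s a : ℕ) : (sweep r s).WritesR a → r + s ≤ a ∧ a < r + s + 4 := by
  simp only [sweep, Cmd.WritesR, writesR_bucketSum, Cmd.writesR_for]
  omega

theorem box_succ (Z : ℕ → ℕ → ℝ) (off m : ℕ) (u : ℕ → ℕ) (j : ℕ) :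
    box Z off (m + 1) u j =
      box Z off m u j * ind (Z (off + m) j ≤ Z (off + m) (u (20 + (off + m)))) := by
  rw [box, Finset.prod_range_succ]; rfl

theorem box_update {Z : ℕ → ℕ → ℝ} {off m : ℕ} {u : ℕ → ℕ} {q c : ℕ} (j : ℕ)
    (hq : 20 + (off + m) ≤ q) : box Z off m (Function.update u q c) j = box Z off m u j := by
  refine Finset.prod_congr rfl fun k hk => ?_
  rw [Finset.mem_range] at hk
  rw [Function.update_of_ne (by omega)]

/-- With the other coordinates of the cut point fixed, the count in `x` is constant, while the
counts in `y` and in both are cumulative sums along the last coordinate. After the bucket sums every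
choice of the last coordinate takes constant time, so the whole sweep is linear. -/
theorem runs_sweep {r s n : ℕ} (hr : 1 ≤ r) (hs : 1 ≤ s) {Z : ℕ → ℕ → ℝ} {σ : Mem} {v : ℕ → ℕ}
    (hn : σ.nat 0 0 = n) (hZ : ∀ a < r + s, σ.real a = Z a) (hle : ∀ i < n, σ.nat 15 i ≤ n)
    (hrho : ∀ i < n, ∀ j < n, σ.nat 15 j ≤ σ.nat 15 i ↔ Z (r + s - 1) j ≤ Z (r + s - 1) i)
    (hv : ∀ k < r + s - 1, σ.nat (20 + k) 0 = v (20 + k)) :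
    Runs (sweep r s) σ (n + 2) fun τ => τ.real (r + s) 0 = σ.real (r + s) 0 +
      ∑ c ∈ Finset.range n, cutTerm n r s Z (Function.update v (20 + (r + s - 1)) c) := by
  have eA : ∀ τ : Mem, (∀ a, a ≠ 14 → τ.nat a = σ.nat a) → (∀ a < r + s, τ.real a = σ.real a) →
      (boxExp 0 r (NExp.var 14)).eval τ = box Z 0 r v (τ.nat 14 0) := fun τ h1 h2 =>
    eval_boxExp _ (fun k hk => by rw [h2 _ (by omega), hZ _ (by omega)])
      (fun k hk => by rw [h1 _ (by omega), zero_add, hv _ (by omega)])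
  have eB : ∀ τ : Mem, (∀ a, a ≠ 14 → τ.nat a = σ.nat a) → (∀ a < r + s, τ.real a = σ.real a) →
      (boxExp r (s - 1) (NExp.var 14)).eval τ = box Z r (s - 1) v (τ.nat 14 0) := fun τ h1 h2 =>
    eval_boxExp _ (fun k hk => by rw [h2 _ (by omega), hZ _ (by omega)])
      (fun k hk => by rw [h1 _ (by omega), hv _ (by omega)])
  refine Runs.seq ((runs_bucketSum (W := box Z 0 r v) hn fun τ h1 h2 j hj hj' => ?_).mono le_rfl ?_)
  · rw [eA τ h1 fun a ha => h2 a (by omega), hj']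
  intro σ1 hF1 h1
  have n1 : ∀ a, a ≠ 14 → σ1.nat a = σ.nat a := fun a ha => hF1.nat a (by
    rwa [writesN_bucketSum])
  have r1 : ∀ a, a ≠ r + s + 1 → σ1.real a = σ.real a := fun a ha => hF1.real a (by
    rwa [writesR_bucketSum])
  refine Runs.seq ((runs_bucketSum (W := box Z r (s - 1) v) (by rw [n1 0 (by norm_num), hn])
    fun τ h1 h2 j hj hj' => ?_).mono le_rfl ?_)
  · rw [eB τ (fun a ha => by rw [h1 a ha, n1 a ha])
      (fun a ha => by rw [h2 a (by omega), r1 a (by omega)]), hj']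
  intro σ2 hF2 h2
  have n2 : ∀ a, a ≠ 14 → σ2.nat a = σ.nat a := fun a ha => by
    rw [hF2.nat a (by rwa [writesN_bucketSum]), n1 a ha]
  have r2 : ∀ a, a ≠ r + s + 2 → σ2.real a = σ1.real a := fun a ha => hF2.real a (by
    rwa [writesR_bucketSum])
  refine Runs.seq ((runs_bucketSum (W := fun j => box Z 0 r v j * box Z r (s - 1) v j)
    (by rw [n2 0 (by norm_num), hn]) fun τ h1 h2 j hj hj' => ?_).mono le_rfl ?_)
  · rw [RExp.eval, eA τ (fun a ha => by rw [h1 a ha, n2 a ha])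
      (fun a ha => by rw [h2 a (by omega), r2 a (by omega), r1 a (by omega)]),
      eB τ (fun a ha => by rw [h1 a ha, n2 a ha])
      (fun a ha => by rw [h2 a (by omega), r2 a (by omega), r1 a (by omega)]), hj']
  intro σ3 hF3 h3
  have n3 : ∀ a, a ≠ 14 → σ3.nat a = σ.nat a := fun a ha => by
    rw [hF3.nat a (by rwa [writesN_bucketSum]), n2 a ha]
  have r3 : ∀ a, a ≠ r + s + 3 → σ3.real a = σ2.real a := fun a ha => hF3.real a (by
    rwa [writesR_bucketSum])
  rw [n2 15 (by norm_num)] at h3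
  rw [n1 15 (by norm_num)] at h2
  -- All ranks are at most `n`, so the cumulative sum at `n` is the full sum; the last coordinate
  -- does not belong to the `x` part.
  have hA : σ3.real (r + s + 1) n = ∑ j ∈ Finset.range n, box Z 0 r v j := by
    rw [r3 _ (by omega), r2 _ (by omega), h1 n le_rfl]
    refine Finset.sum_congr rfl fun j hj => ?_
    rw [Finset.mem_range] at hj
    rw [if_pos (hle j hj)]
  have hind : ∀ c < n, ∀ j ∈ Finset.range n, ∀ x : ℝ,
      (if σ.nat 15 j ≤ σ.nat 15 c then x else 0) =
      x * ind (Z (r + s - 1) j ≤ Z (r + s - 1) c) := by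
    intro c hc j hj x
    rw [Finset.mem_range] at hj
    by_cases h : σ.nat 15 j ≤ σ.nat 15 c
    · rw [if_pos h, ind_true ((hrho c hc j hj).mp h), mul_one]
    · rw [if_neg h, ind_false (fun h' => h ((hrho c hc j hj).mpr h')), mul_zero]
  have hu0 : ∀ c j, box Z 0 r (Function.update v (20 + (r + s - 1)) c) j = box Z 0 r v j :=
    fun c j => box_update j (by omega)
  have hu1 : ∀ c j, box Z r s (Function.update v (20 + (r + s - 1)) c) j =
      box Z r (s - 1) v j * ind (Z (r + s - 1) j ≤ Z (r + s - 1) c) := by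
    intro c j
    obtain ⟨s', rfl⟩ : ∃ s', s = s' + 1 := ⟨s - 1, by omega⟩
    rw [box_succ, box_update j (by omega)]
    simp only [show r + (s' + 1) - 1 = r + s' by omega, Function.update_self, Nat.add_sub_cancel]
  have hB : ∀ c < n, σ3.real (r + s + 2) (σ.nat 15 c) = ∑ j ∈ Finset.range n,
      box Z r s (Function.update v (20 + (r + s - 1)) c) j := by
    intro c hc
    rw [r3 _ (by omega), h2 _ (hle c hc)]
    refine Finset.sum_congr rfl fun j hj => ?_
    rw [hind c hc j hj, hu1]
  have hP : ∀ c < n, σ3.real (r + s + 3) (σ.nat 15 c) = ∑ j ∈ Finset.range n,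
      box Z 0 r (Function.update v (20 + (r + s - 1)) c) j *
      box Z r s (Function.update v (20 + (r + s - 1)) c) j := by
    intro c hc
    rw [h3 _ (hle c hc)]
    refine Finset.sum_congr rfl fun j hj => ?_
    rw [hind c hc j hj, hu1, hu0, mul_assoc]
  refine Runs.for (N := n) (f := 1) (fun t τ => τ.real (r + s) 0 = σ.real (r + s) 0 +
    ∑ c ∈ Finset.range t, cutTerm n r s Z (Function.update v (20 + (r + s - 1)) c)) le_rfl (by omega)
    (by simp [Cmd.WritesN]) ?_ ?_ ?_ ?_
  · intro τ hτ
    rw [NExp.eval_var, hτ.nat 0 (by simp [Cmd.writesN_for, Cmd.WritesN]; omega),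
      n3 0 (by norm_num), hn]
  · rw [Mem.setN_real, r3 _ (by omega), r2 _ (by omega), r1 _ (by omega)]
    simp
  · intro c hc τ hτ hvc h
    have n4 : ∀ a, a ≠ 14 → a ≠ 20 + (r + s - 1) → τ.nat a = σ.nat a := fun a h1 h2 => by
      rw [hτ.nat a (by simpa [Cmd.writesN_for, Cmd.WritesN] using h2), n3 a h1]
    have r4 : ∀ a, a ≠ r + s → τ.real a = σ3.real a := fun a h1 =>
      hτ.real a (by simpa [Cmd.writesR_for, Cmd.WritesR] using h1)
    have t0 : τ.nat 0 0 = n := by rw [n4 0 (by norm_num) (by omega), hn]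
    have r5 : ∀ a < r + s, τ.real a = Z a := fun a ha => by
      rw [r4 a (by omega), r3 a (by omega), r2 a (by omega), r1 a (by omega), hZ a ha]
    set u := Function.update v (20 + (r + s - 1)) c with hu
    have hu' : ∀ k < r + s, τ.nat (20 + k) 0 = u (20 + k) := by
      intro k hk
      by_cases h : k = r + s - 1
      · subst h; rw [hvc, hu, Function.update_self]
      · rw [n4 _ (by omega) (by omega), hv k (by omega), hu, Function.update_of_ne (by omega)]
    refine Runs.setR le_rfl ?_
    have key : (cutTermExp r s).eval τ = cutTerm n r s Z u := by
      have eA' : ∀ k ∈ Finset.range (r + s), (boxExp 0 r (NExp.var (20 + k))).eval τ =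
          box Z 0 r u (u (20 + k)) := fun k hk => by
        rw [Finset.mem_range] at hk
        rw [eval_boxExp (u := u) _ (fun k hk => r5 _ (by omega)) (fun k hk => hu' _ (by omega)),
          NExp.eval_var, hu' k hk]
      have eB' : ∀ k ∈ Finset.range (r + s), (boxExp r s (NExp.var (20 + k))).eval τ =
          box Z r s u (u (20 + k)) := fun k hk => by
        rw [Finset.mem_range] at hk
        rw [eval_boxExp (u := u) _ (fun k hk => r5 _ (by omega)) (fun k hk => hu' _ (by omega)),
          NExp.eval_var, hu' k hk]
      simp only [cutTermExp, RExp.eval, eval_hoefExp, RExp.eval_num, RExp.eval_sum, NExp.eval,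
        NExp.eval_var, t0, hvc, eval_distinctExp hu']
      rw [Finset.sum_congr rfl eA', Finset.sum_congr rfl eB',
        Finset.sum_congr rfl fun k hk => congrArg₂ (· * ·) (eA' k hk) (eB' k hk),
        n4 15 (by norm_num) (by omega), r4 _ (by omega), r4 _ (by omega), r4 _ (by omega), hA,
        hB c hc, hP c hc, cutTerm]
      rw [Finset.sum_congr rfl fun j _ => (hu0 c j).symm]
    simp only [RExp.eval, NExp.eval, key, Mem.setN_real, Mem.setR_real, and_self, if_true, h]
    rw [Finset.sum_range_succ, add_assoc]
  · intro τ _ h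
    exact h

/-- The program for `U_R`. -/
noncomputable def progR (r s : ℕ) : Cmd :=
  let d := r + s
  Cmd.seq (ranks (d - 1)) (Cmd.seq (forNest (sweep r s) (d - 1) 20)
    (Cmd.setR d (NExp.const 0) (RExp.div (RExp.load d (NExp.const 0))
      (RExp.mul (RExp.num 4) (descExp (d + 4))))))

theorem runs_progR {r s n : ℕ} (hr : 1 ≤ r) (hs : 1 ≤ s) (hn : r + s + 4 ≤ n) (z : Fin n → Obs r s) :
    Runs (progR r s) (input z) ((n + 2) ^ (r + s)) fun σ => σ.real (r + s) 0 = UR r s n z := by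
  classical
  have hpow : (n + 2) ^ (r + s) = (n + 2) ^ (r + s - 1) * (n + 2) := by
    rw [← pow_succ]; congr 1; omega
  -- Both parts have at least one coordinate, so the exponent is at least `2` and the quadratic
  -- ranking fits.
  have h1 : (n + 1) * (n + 1) ≤ (n + 2) ^ (r + s) := by
    rw [hpow]
    exact Nat.mul_le_mul (le_trans (by omega) (Nat.le_self_pow (by omega) _)) (by omega)
  have i0 : (input z).nat 0 0 = n := by simp [input]
  have ir : (input z).real (r + s) 0 = 0 := by simp [input]
  have hz := holds_input z
  set σ := input z
  clear_value σ
  refine Runs.seq ((runs_ranks i0).mono h1 ?_)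
  intro σ1 hF1 hρ
  have n1 : σ1.nat 0 0 = n := by
    rw [hF1.nat 0 (by simp [ranks, Cmd.writesN_for, Cmd.WritesN]), i0]
  have r1 : σ1.real = σ.real := by
    ext a : 1
    exact hF1.real a (by simp [ranks, Cmd.writesR_for, Cmd.WritesR])
  -- Only `d - 1` loops surround the linear sweep; the sum over the last variable is part of the
  -- summand `g`.
  refine Runs.seq ((runs_forNest (n := n) (f := n + 2) (lo := 20) (hi := 20 + (r + s - 1))
    (c := r + s) (g := fun u => ∑ c ∈ Finset.range n,
      cutTerm n r s σ.real (Function.update u (20 + (r + s - 1)) c))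
    (Base := fun τ => τ.nat 0 0 = n ∧ (∀ i, τ.nat 15 i = σ1.nat 15 i) ∧
      ∀ a < r + s, τ.real a = σ.real a) (by omega) (by norm_num) ?_ (fun _ h => h.1) ?_ ?_
    (r + s - 1) 20 le_rfl rfl σ1 (fun _ => 0) ⟨n1, fun _ => rfl, fun a _ => by rw [r1]⟩
    (fun q h1 h2 => by omega)).mono ?_ ?_)
  · rintro τ a i v ha ⟨h1, h2, h3⟩
    have a0 : ¬ 0 = a := by omega
    have a15 : ¬ 15 = a := by omega
    exact ⟨by simpa [a0] using h1, fun i => by simpa [a15] using h2 i, h3⟩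
  · rintro τ v ⟨h1, h2, h3⟩ hv
    refine (runs_sweep hr hs h1 h3 ?_ ?_ (fun k hk => (hv (20 + k) (by omega) (by omega)).1)).mono
      le_rfl ?_
    · intro i hi
      rw [h2, hρ i hi]
      exact (Finset.card_filter_le _ _).trans (by simp)
    · intro i hi j hj
      rw [h2, h2, hρ i hi, hρ j hj]
      exact card_lt_le_card_lt_iff _ hi
    · intro υ hυ h
      refine ⟨⟨?_, fun i => ?_, fun a ha => ?_⟩, h⟩
      · rw [hυ.nat 0 (by rw [writesN_sweep]; omega), h1]
      · rw [hυ.nat 15 (by rw [writesN_sweep]; omega), h2]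
      · rw [hυ.real a (fun h => by have := writesR_sweep _ _ _ h; omega), h3 a ha]
  · intro a ha
    rw [writesN_sweep] at ha
    omega
  · rw [hpow]
    exact Nat.mul_le_mul_right _ (Nat.pow_le_pow_left (by omega) _)
  · rintro τ - ⟨⟨h1, -, -⟩, h2⟩
    refine Runs.setR (Nat.one_le_pow _ _ (by omega)) ?_
    rw [UR_eq_sum_cutTerm z hz.fst hz.snd (fun _ => 0)]
    rw [allSum_succ, show r + s - 1 + 1 = r + s by omega, r1, ir, zero_add] at h2
    simp only [RExp.eval, NExp.eval, eval_descExp h1 hn, RExp.eval_num, h2, Mem.setR_real,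
      and_self, if_true]
    push_cast
    rw [div_mul_eq_div_div]
    ring

theorem exists_program_UR (r s : ℕ) (hr : 1 ≤ r) (hs : 1 ≤ s) :
    ∃ P : Cmd, ComputesInTime r s (r + s + 4) P (UR r s) (fun n => (n : ℝ) ^ (r + s)) :=
  ⟨progR r s, computesInTime_of_runs (fun n => (n + 2) ^ (r + s)) (2 ^ (r + s)) (by positivity)
    (fun n hn => by
      rw [← mul_pow]
      push_cast
      have : (2 : ℝ) ≤ n := by exact_mod_cast (by omega : 2 ≤ n)
      gcongr
      linarith)
    fun n hn z => runs_progR hr hs hn z⟩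

/-! ## Programs which add to the output -/

/-- The sample size is `n`, the sample is in the real arrays below `d`, and the counters are zero. -/
structure Base (d n : ℕ) (Z : ℕ → ℕ → ℝ) (σ : Mem) : Prop where
  size : σ.nat 0 0 = n
  data : ∀ k < d, σ.real k = Z k
  counters : ∀ x, σ.real (d + 3) x = 0

/-- The program adds `x` to the output cell. -/
def Adds (d n g : ℕ) (Z : ℕ → ℕ → ℝ) (p : Cmd) (x : ℝ) : Prop :=
  ∀ σ, Base d n Z σ → Runs p σ g fun τ => Base d n Z τ ∧ τ.real d 0 = σ.real d 0 + x

theorem Adds.seq {d n g : ℕ} {Z : ℕ → ℕ → ℝ} {p q : Cmd} {x y : ℝ} (hp : Adds d n g Z p x)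
    (hq : Adds d n g Z q y) : Adds d n g Z (Cmd.seq p q) (x + y) := by
  intro σ hσ
  refine Runs.seq ((hp σ hσ).mono le_rfl ?_)
  rintro τ - ⟨hτ, h1⟩
  refine (hq τ hτ).mono le_rfl ?_
  rintro υ - ⟨hυ, h2⟩
  exact ⟨hυ, by rw [h2, h1, add_assoc]⟩

/-- Runs the programs `f a` for all `a ∈ S`. -/
noncomputable def Cmd.sum {α : Type*} (S : Finset α) (f : α → Cmd) : Cmd :=
  (S.toList.map f).foldr Cmd.seq Cmd.nop

/-- The index set belongs to the program text, so the number of summands enters the weight and not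
the budget. -/
theorem Adds.sum {d n g : ℕ} {Z : ℕ → ℕ → ℝ} (hg : 1 ≤ g) {α : Type*} {S : Finset α}
    {f : α → Cmd} {x : α → ℝ} (h : ∀ a ∈ S, Adds d n g Z (f a) (x a)) :
    Adds d n g Z (Cmd.sum S f) (∑ a ∈ S, x a) := by
  have key : ∀ l : List α, (∀ a ∈ l, Adds d n g Z (f a) (x a)) →
      Adds d n g Z ((l.map f).foldr Cmd.seq Cmd.nop) (l.map x).sum := by
    intro l
    induction l with
    | nil => exact fun _ σ hσ => Runs.nop hg ⟨hσ, by simp⟩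
    | cons a l ih =>
      intro hl
      simp only [List.map_cons, List.foldr_cons, List.sum_cons]
      exact (hl a (by simp)).seq (ih fun b hb => hl b (by simp [hb]))
  rw [← Finset.sum_map_toList]
  exact key _ fun a ha => h a (Finset.mem_toList.mp ha)

/-! ### Loops over pairs -/

/-- Runs through all pairs of values of the variables `15` and `16`, while the variable `14` counts
the pairs. -/
def pairFor (body : Cmd) : Cmd :=
  Cmd.seq (Cmd.setV 14 (NExp.const 0))
    (Cmd.for 15 (NExp.var 0) (Cmd.for 16 (NExp.var 0)
      (Cmd.seq body (Cmd.setV 14 (NExp.add (NExp.var 14) (NExp.const 1))))))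

theorem writesN_pairFor {body : Cmd} (hb : ∀ a, ¬ body.WritesN a) (a : ℕ) :
    (pairFor body).WritesN a ↔ a = 14 ∨ a = 15 ∨ a = 16 := by
  simp only [pairFor, Cmd.WritesN, Cmd.writesN_for, Cmd.setV, hb]
  tauto

theorem writesR_pairFor (body : Cmd) (a : ℕ) : (pairFor body).WritesR a ↔ body.WritesR a := by
  simp [pairFor, Cmd.WritesR, Cmd.writesR_for, Cmd.setV]

/-- The running counter provides `i * n + j`, the address of a pair, without a multiplication of
naturals. The invariant speaks only of the reals, which the loop administration never touches. -/
theorem runs_pairFor {body : Cmd} {n g : ℕ} {σ : Mem} (I : ℕ → (ℕ → ℕ → ℝ) → Prop)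
    (hg : (n + 1) * (n + 1) ≤ g) (hn : σ.nat 0 0 = n) (hb : ∀ a, ¬ body.WritesN a)
    (h0 : I 0 σ.real)
    (hs : ∀ i < n, ∀ j < n, ∀ τ : Mem, (∀ a, a ≠ 14 → a ≠ 15 → a ≠ 16 → τ.nat a = σ.nat a) →
      (∀ a, ¬ body.WritesR a → τ.real a = σ.real a) → τ.nat 14 0 = i * n + j → τ.nat 15 0 = i →
      τ.nat 16 0 = j → I (i * n + j) τ.real → Runs body τ 1 fun υ => I (i * n + j + 1) υ.real) :
    Runs (pairFor body) σ g fun τ => I (n * n) τ.real := by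
  refine Runs.seq (Runs.setV (by nlinarith) ?_)
  set σ0 := σ.setN 14 0 0
  have hN : ∀ a, a ≠ 14 → a ≠ 15 → a ≠ 16 → ¬ (Cmd.for 15 (NExp.var 0) (Cmd.for 16 (NExp.var 0)
      (Cmd.seq body (Cmd.setV 14 (NExp.add (NExp.var 14) (NExp.const 1)))))).WritesN a := by
    intro a h1 h2 h3
    simp [Cmd.writesN_for, Cmd.WritesN, Cmd.setV, hb, h1, h2, h3]
  have hR : ∀ a, (Cmd.for 15 (NExp.var 0) (Cmd.for 16 (NExp.var 0)
      (Cmd.seq body (Cmd.setV 14 (NExp.add (NExp.var 14) (NExp.const 1)))))).WritesR a ↔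
      body.WritesR a := by
    intro a
    simp [Cmd.writesR_for, Cmd.WritesR, Cmd.setV]
  refine Runs.for (N := n) (f := n + 1) (fun i τ => τ.nat 14 0 = i * n ∧ I (i * n) τ.real)
    (by omega) hg (by simp [Cmd.writesN_for, Cmd.WritesN, Cmd.setV, hb]) ?_ ?_ ?_ ?_
  · intro τ hτ
    rw [NExp.eval_var, hτ.nat 0 (hN 0 (by norm_num) (by norm_num) (by norm_num))]
    simp [hn]
  · simpa [σ0, NExp.eval] using h0
  · rintro i hi τ hτ hv ⟨h1, h2⟩
    have t0 : τ.nat 0 0 = n := by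
      rw [hτ.nat 0 (hN 0 (by norm_num) (by norm_num) (by norm_num))]
      simp [hn]
    refine Runs.for (N := n) (f := 1) (fun j υ => υ.nat 14 0 = i * n + j ∧ I (i * n + j) υ.real)
      le_rfl (by omega) (by simp [Cmd.WritesN, Cmd.setV, hb]) ?_ ?_ ?_ ?_
    · intro υ hυ
      rw [NExp.eval_var, hυ.nat 0 (by simp [Cmd.writesN_for, Cmd.WritesN, Cmd.setV, hb]), t0]
    · simpa [h1] using h2
    · rintro j hj υ hυ hvj ⟨h3, h4⟩
      have u15 : υ.nat 15 0 = i := by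
        rw [hυ.nat 15 (by simp [Cmd.writesN_for, Cmd.WritesN, Cmd.setV, hb]), hv]
      have uN : ∀ a, a ≠ 14 → a ≠ 15 → a ≠ 16 → υ.nat a = σ.nat a := fun a a1 a2 a3 => by
        rw [hυ.nat a (by simp [Cmd.writesN_for, Cmd.WritesN, Cmd.setV, hb, a1, a3]),
          hτ.nat a (hN a a1 a2 a3), Mem.setN_nat_of_ne a1]
      have uR : ∀ a, ¬ body.WritesR a → υ.real a = σ.real a := fun a ha => by
        rw [hυ.real a (by simpa [Cmd.writesR_for, Cmd.WritesR, Cmd.setV] using ha),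
          hτ.real a (by rwa [hR])]
        rfl
      refine Runs.seq ((hs i hi j hj υ uN uR h3 u15 hvj h4).mono le_rfl fun ω hω h => ?_)
      refine Runs.setV le_rfl ?_
      have : ω.nat 14 0 = i * n + j := by rw [hω.nat 14 (hb 14), h3]
      refine ⟨?_, h⟩
      simp [NExp.eval, this, add_assoc]
    · rintro υ - ⟨h3, h4⟩
      refine ⟨?_, ?_⟩
      · simp [h3, add_mul]
      · rw [add_mul, one_mul]; exact h4
  · rintro τ - ⟨-, h⟩
    exact h

theorem sum_range_mul_self (n : ℕ) (f : ℕ → ℕ → ℝ) :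
    ∑ t ∈ Finset.range (n * n), f (t / n) (t % n) =
      ∑ i ∈ Finset.range n, ∑ j ∈ Finset.range n, f i j := by
  have key : ∀ m, ∑ t ∈ Finset.range (m * n), f (t / n) (t % n) =
      ∑ i ∈ Finset.range m, ∑ j ∈ Finset.range n, f i j := by
    intro m
    induction m with
    | zero => simp
    | succ m ih =>
      rw [add_mul, one_mul, Finset.sum_range_add, ih, Finset.sum_range_succ]
      congr 1
      refine Finset.sum_congr rfl fun j hj => ?_
      rw [Finset.mem_range] at hj
      rw [mul_comm m n, Nat.mul_add_div (by omega), Nat.mul_add_mod, Nat.div_eq_of_lt hj,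
        Nat.mod_eq_of_lt hj, add_zero]
  exact key n

theorem div_mod_pair {n i j : ℕ} (hj : j < n) : (i * n + j) / n = i ∧ (i * n + j) % n = j := by
  rw [mul_comm i n, Nat.mul_add_div (by omega), Nat.mul_add_mod, Nat.div_eq_of_lt hj,
    Nat.mod_eq_of_lt hj, add_zero]
  exact ⟨rfl, rfl⟩

/-- Adds the sum over all pairs of the expression `e` in the variables `15` and `16`. -/
def pairSum (d : ℕ) (e : RExp) : Cmd :=
  pairFor (Cmd.setR d (NExp.const 0) (RExp.add (RExp.load d (NExp.const 0)) e))

theorem runs_pairSum {d n g : ℕ} {e : RExp} {f : ℕ → ℕ → ℝ} {σ : Mem}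
    (hg : (n + 1) * (n + 1) ≤ g) (hn : σ.nat 0 0 = n)
    (he : ∀ i < n, ∀ j < n, ∀ τ : Mem, (∀ a, a ≠ 14 → a ≠ 15 → a ≠ 16 → τ.nat a = σ.nat a) →
      (∀ a, a ≠ d → τ.real a = σ.real a) → τ.nat 14 0 = i * n + j → τ.nat 15 0 = i →
      τ.nat 16 0 = j → e.eval τ = f i j) :
    Runs (pairSum d e) σ g fun τ => τ.real d 0 = σ.real d 0 +
      ∑ i ∈ Finset.range n, ∑ j ∈ Finset.range n, f i j := by
  rw [← sum_range_mul_self]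
  refine runs_pairFor (fun t R => R d 0 = σ.real d 0 +
    ∑ t ∈ Finset.range t, f (t / n) (t % n)) hg hn (by simp [Cmd.WritesN]) (by simp) ?_
  intro i hi j hj τ hN hR h14 h15 h16 hI
  refine Runs.setR le_rfl ?_
  rw [Finset.sum_range_succ, ← add_assoc, ← hI, (div_mod_pair hj).1, (div_mod_pair hj).2]
  simp [RExp.eval, NExp.eval, he i hi j hj τ hN (by simpa [Cmd.WritesR] using hR) h14 h15 h16]

theorem adds_pairSum {d n g : ℕ} {Z : ℕ → ℕ → ℝ} {e : RExp} {f : ℕ → ℕ → ℝ}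
    (hg : (n + 1) * (n + 1) ≤ g)
    (he : ∀ i j, ∀ τ : Mem, (∀ k < d, τ.real k = Z k) → τ.nat 15 0 = i → τ.nat 16 0 = j →
      e.eval τ = f i j) :
    Adds d n g Z (pairSum d e) (∑ i ∈ Finset.range n, ∑ j ∈ Finset.range n, f i j) := by
  intro σ hσ
  refine (runs_pairSum (f := f) hg hσ.size fun i _ j _ τ _ hR _ h15 h16 =>
    he i j τ (fun k hk => by rw [hR k hk.ne, hσ.data k hk]) h15 h16).mono le_rfl ?_
  intro τ hτ h
  have hN : ∀ a, ¬ (Cmd.setR d (NExp.const 0) (RExp.add (RExp.load d (NExp.const 0)) e)).WritesN a :=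
    by simp [Cmd.WritesN]
  have hR : ∀ a, a ≠ d → τ.real a = σ.real a := fun a ha => hτ.real a (by
    rw [pairSum, writesR_pairFor]; simpa [Cmd.WritesR] using ha)
  refine ⟨⟨?_, fun k hk => ?_, fun x => ?_⟩, h⟩
  · rw [hτ.nat 0 (by rw [pairSum, writesN_pairFor hN]; norm_num), hσ.size]
  · rw [hR k hk.ne, hσ.data k hk]
  · rw [hR _ (by omega), hσ.counters]

/-- Subtracts four times the sum over the variable `15` of the squares of the sums over the variable
`16` of the expression `e`. -/
def subSquares (d : ℕ) (e : RExp) : Cmd :=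
  let c := NExp.const 0
  let acc := RExp.load (d + 4) c
  Cmd.for 15 (NExp.var 0)
    (Cmd.seq (Cmd.setR (d + 4) c (RExp.num 0))
    (Cmd.seq (Cmd.for 16 (NExp.var 0) (Cmd.setR (d + 4) c (RExp.add acc e)))
      (Cmd.setR d c (RExp.sub (RExp.load d c) (RExp.mul (RExp.num 4) (RExp.mul acc acc))))))

theorem adds_subSquares {d n g : ℕ} {Z : ℕ → ℕ → ℝ} {e : RExp} {f : ℕ → ℕ → ℝ}
    (hg : (n + 1) * (n + 1) ≤ g)
    (he : ∀ i j, ∀ τ : Mem, (∀ k < d, τ.real k = Z k) → τ.nat 15 0 = i → τ.nat 16 0 = j →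
      e.eval τ = f i j) :
    Adds d n g Z (subSquares d e)
      (∑ i ∈ Finset.range n, -4 * ((∑ j ∈ Finset.range n, f i j) * ∑ j ∈ Finset.range n, f i j)) := by
  intro σ hσ
  have hW : ∀ a, (subSquares d e).WritesN a ↔ a = 15 ∨ a = 16 := by
    intro a
    simp [subSquares, Cmd.WritesN, Cmd.writesN_for]
  have hW' : ∀ a, (subSquares d e).WritesR a ↔ a = d + 4 ∨ a = d := by
    intro a
    simp [subSquares, Cmd.WritesR, Cmd.writesR_for]
  refine (Runs.for (N := n) (f := n + 1) (fun t τ => τ.real d 0 = σ.real d 0 + ∑ i ∈ Finset.range t,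
    -4 * ((∑ j ∈ Finset.range n, f i j) * ∑ j ∈ Finset.range n, f i j)) (by omega) hg
    (by simp [Cmd.WritesN, Cmd.writesN_for]) ?_ (by simp) ?_ (fun _ _ h => h)).mono le_rfl ?_
  · intro τ hτ
    rw [NExp.eval_var, hτ.nat 0 (by rw [← subSquares, hW]; norm_num), hσ.size]
  · intro i hi τ hτ hv h
    have t0 : τ.nat 0 0 = n := by
      rw [hτ.nat 0 (by rw [← subSquares, hW]; norm_num), hσ.size]
    have tR : ∀ k, k ≠ d → k ≠ d + 4 → τ.real k = σ.real k := fun k h1 h2 =>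
      hτ.real k (by rw [← subSquares, hW']; tauto)
    refine Runs.seq (Runs.setR (by omega) (Runs.seq ?_))
    simp only [NExp.eval, RExp.eval_num, Nat.cast_zero]
    set τ0 := τ.setR (d + 4) 0 0
    refine (Runs.for (N := n) (f := 1) (fun t υ => υ.real (d + 4) 0 = ∑ j ∈ Finset.range t, f i j)
      le_rfl (by omega) (by simp [Cmd.WritesN]) ?_ (by simp [τ0]) ?_ (fun _ _ h => h)).mono
      le_rfl ?_
    · intro υ hυ
      rw [NExp.eval_var, hυ.nat 0 (by simp [Cmd.writesN_for, Cmd.WritesN])]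
      simp [τ0, t0]
    · intro j hj υ hυ hvj h'
      refine Runs.setR le_rfl ?_
      have e1 := he i j υ (fun k hk => by
        rw [hυ.real k (by simp [Cmd.writesR_for, Cmd.WritesR]; omega),
          Mem.setR_real_of_ne (by omega), tR k (by omega) (by omega), hσ.data k hk])
        (by rw [hυ.nat 15 (by simp [Cmd.writesN_for, Cmd.WritesN])]; simpa [τ0] using hv) hvj
      rw [Finset.sum_range_succ, ← h']
      simp [RExp.eval, NExp.eval, e1]
    · intro υ hυ h'
      refine Runs.setR (by omega) ?_
      have e2 : υ.real d 0 = τ.real d 0 := by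
        rw [hυ.real d (by simp [Cmd.writesR_for, Cmd.WritesR]), Mem.setR_real_of_ne (by omega)]
      rw [Finset.sum_range_succ, ← add_assoc, ← h]
      simp only [RExp.eval, NExp.eval, RExp.eval_num, h', e2, Mem.setN_real, Mem.setR_real,
        and_self, if_true]
      push_cast
      ring
  · intro τ hτ h
    have tR : ∀ k, k ≠ d → k ≠ d + 4 → τ.real k = σ.real k := fun k h1 h2 =>
      hτ.real k (by rw [← subSquares, hW']; tauto)
    refine ⟨⟨?_, fun k hk => ?_, fun x => ?_⟩, h⟩
    · rw [hτ.nat 0 (by rw [← subSquares, hW]; norm_num), hσ.size]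
    · rw [tR k (by omega) (by omega), hσ.data k hk]
    · rw [tR _ (by omega) (by omega), hσ.counters]

/-- Adds the sum over all pairs `q` and all pairs `p` of `v q * u p` for which the point with the
coordinates `pe` at `p` is at most the one with the coordinates `qe` at `q`. -/
def pairDominance (d : ℕ) (pe qe : ℕ → RExp) (u v : RExp) : Cmd :=
  Cmd.seq (Cmd.setV 17 (NExp.const 0))
    (Cmd.seq (Cmd.for 14 (NExp.var 0) (Cmd.setV 17 (NExp.add (NExp.var 17) (NExp.var 0))))
    (Cmd.seq (Cmd.setV 1 (NExp.add (NExp.var 17) (NExp.var 17)))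
    (Cmd.seq (pairFor (setItem d (d + d) (NExp.var 17) (NExp.var 14) pe qe u))
    (Cmd.seq (dominance d (d + d - 1))
      (pairSum d (RExp.mul v (RExp.load (d + 2) (NExp.add (NExp.var 17) (NExp.var 14)))))))))

/-- Every pair of observations becomes one point and one query, `2 * n ^ 2` items in `2 * d`
coordinates. Hence the factor `n ^ 2` and the exponent `2 * d - 1` of the logarithm. -/
theorem adds_pairDominance {d n g L : ℕ} {Z : ℕ → ℕ → ℝ} {pe qe : ℕ → RExp} {u v : RExp}
    {P Q : ℕ → ℕ → ℕ → ℝ} {U V : ℕ → ℕ → ℝ} (hd : 1 ≤ d) (hL : L = Nat.clog 2 (2 * n ^ 2))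
    (hg : g = (2 ^ L + 2) * (L + 1) ^ (d + d - 1))
    (hp : ∀ k < d + d, ∀ i j, ∀ τ : Mem, (∀ k < d, τ.real k = Z k) → τ.nat 15 0 = i →
      τ.nat 16 0 = j → (pe k).eval τ = P k i j)
    (hq : ∀ k < d + d, ∀ i j, ∀ τ : Mem, (∀ k < d, τ.real k = Z k) → τ.nat 15 0 = i →
      τ.nat 16 0 = j → (qe k).eval τ = Q k i j)
    (hu : ∀ i j, ∀ τ : Mem, (∀ k < d, τ.real k = Z k) → τ.nat 15 0 = i → τ.nat 16 0 = j →
      u.eval τ = U i j)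
    (hv : ∀ i j, ∀ τ : Mem, (∀ k < d, τ.real k = Z k) → τ.nat 15 0 = i → τ.nat 16 0 = j →
      v.eval τ = V i j) :
    Adds d n g Z (pairDominance d pe qe u v)
      (∑ i ∈ Finset.range n, ∑ j ∈ Finset.range n, V i j *
        ∑ i' ∈ Finset.range n, ∑ j' ∈ Finset.range n, U i' j' *
          ∏ k ∈ Finset.range (d + d), ind (P k i' j' ≤ Q k i j)) := by
  have hEL : 2 * n ^ 2 ≤ 2 ^ L := by rw [hL]; exact Nat.le_pow_clog (by norm_num) _
  have hpow : 1 ≤ (L + 1) ^ (d + d - 1) := Nat.one_le_pow _ _ (by omega)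
  have hgL : 2 ^ L + 2 ≤ g := by rw [hg]; exact Nat.le_mul_of_pos_right _ hpow
  -- By `(n - 1) ^ 2 ≥ 0` the loops over pairs are within `2 * n ^ 2 + 2`.
  have hgn : (n + 1) * (n + 1) ≤ g := by
    have : 2 * n ≤ n ^ 2 + 1 := by
      have := two_mul_le_add_sq (n : ℤ) 1
      zify
      linarith
    nlinarith
  have hgn1 : n + 1 ≤ g := le_trans (by nlinarith) hgn
  have hd1 : d + d - 1 + 1 = d + d := by omega
  intro σ hσ
  refine Runs.seq (Runs.setV (by omega) (Runs.seq ?_))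
  simp only [NExp.eval]
  set σ0 := σ.setN 17 0 0
  -- The number `n * n` is obtained by adding `n` repeatedly.
  refine (Runs.for (N := n) (f := 1) (fun t τ => τ.nat 17 0 = t * n) le_rfl (by omega)
    (by simp [Cmd.WritesN, Cmd.setV]) ?_ (by simp [σ0]) ?_ (fun _ _ h => h)).mono le_rfl ?_
  · intro τ hτ
    rw [NExp.eval_var, hτ.nat 0 (by simp [Cmd.writesN_for, Cmd.WritesN, Cmd.setV])]
    simp [σ0, hσ.size]
  · intro t ht τ hτ hvt h
    have t0 : τ.nat 0 0 = n := by
      rw [hτ.nat 0 (by simp [Cmd.writesN_for, Cmd.WritesN, Cmd.setV])]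
      simp [σ0, hσ.size]
    refine Runs.setV le_rfl ?_
    simp [NExp.eval, h, t0, add_mul]
  intro σ1 hF1 h17
  have n1 : σ1.nat 0 0 = n := by
    rw [hF1.nat 0 (by simp [Cmd.writesN_for, Cmd.WritesN, Cmd.setV])]
    simp [σ0, hσ.size]
  have r1 : σ1.real = σ.real := by
    ext a : 1
    rw [hF1.real a (by simp [Cmd.writesR_for, Cmd.WritesR, Cmd.setV])]
    rfl
  refine Runs.seq (Runs.setV (by omega) ?_)
  simp only [NExp.eval, NExp.eval_var, h17]
  set σ2 := σ1.setN 1 0 (n * n + n * n) with hσ2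
  have m0 : σ2.nat 0 0 = n := by simp [hσ2, n1]
  have m17 : σ2.nat 17 0 = n * n := by simp [hσ2, h17]
  have m1 : σ2.nat 1 0 = n * n + n * n := by simp [hσ2]
  have r2 : σ2.real = σ.real := r1
  clear_value σ2
  -- `Items` depends only on the reals, so the naturals may be filled with an arbitrary value.
  refine Runs.seq ((runs_pairFor (fun t R => Items d (d + d) (n * n) t
    (fun k t => P k (t / n) (t % n)) (fun k t => Q k (t / n) (t % n))
    (fun t => U (t / n) (t % n)) ⟨fun _ _ => 0, R⟩) hgn m0 writesN_setItem
    (fun i hi => absurd hi (by omega)) ?_).mono le_rfl ?_)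
  · intro i hi j hj τ hN hR h14 h15 h16 hI
    have htn : i * n + j < n * n := by nlinarith
    have t17 : τ.nat 17 0 = n * n := by
      rw [hN 17 (by norm_num) (by norm_num) (by norm_num), m17]
    have tR : ∀ k < d, τ.real k = Z k := fun k hk => by
      rw [hR k (fun h => by have := writesR_setItem _ h; omega), r2, hσ.data k hk]
    have hd' := (div_mod_pair (i := i) hj).1
    have hm' := (div_mod_pair (i := i) hj).2
    refine (runs_setItem (σ := τ) (P := fun k t => P k (t / n) (t % n))
      (Q := fun k t => Q k (t / n) (t % n)) (W := fun t => U (t / n) (t % n)) le_rfl htn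
      (fun υ h => by rw [NExp.eval_var, h, t17]) (fun υ h => by rw [NExp.eval_var, h, h14]) hI
      ?_ ?_ ?_).mono le_rfl fun υ _ h => h
    · intro k hk υ h1 h2
      simp only [hd', hm']
      exact hp k hk i j υ (fun k hk => by rw [h2 k hk.le, tR k hk]) (by rw [h1, h15])
        (by rw [h1, h16])
    · intro k hk υ h1 h2
      simp only [hd', hm']
      exact hq k hk i j υ (fun k hk => by rw [h2 k hk.le, tR k hk]) (by rw [h1, h15])
        (by rw [h1, h16])
    · intro υ h1 h2
      simp only [hd', hm']
      exact hu i j υ (fun k hk => by rw [h2 k hk.le, tR k hk]) (by rw [h1, h15]) (by rw [h1, h16])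
  intro σ3 hF3 hI
  have hN3 : ∀ a, a ≠ 14 → a ≠ 15 → a ≠ 16 → σ3.nat a = σ2.nat a := fun a a1 a2 a3 =>
    hF3.nat a (by rw [writesN_pairFor writesN_setItem]; tauto)
  have hR3 : ∀ a, a ≤ d ∨ a = d + 3 → σ3.real a = σ.real a := fun a ha => by
    rw [hF3.real a (fun h => by
      rw [writesR_pairFor] at h; have := writesR_setItem _ h; omega), r2]
  have hI' : Items d (d + d - 1 + 1) (n * n) (n * n) (fun k t => P k (t / n) (t % n))
      (fun k t => Q k (t / n) (t % n)) (fun t => U (t / n) (t % n)) σ3 := by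
    rw [hd1]; exact hI
  refine Runs.seq ((runs_dominance_items (L := L) (by omega)
    (by rw [hN3 1 (by norm_num) (by norm_num) (by norm_num), m1])
    (by rw [hL]; congr 1; ring) (fun x => by rw [hR3 _ (by omega), hσ.counters]) hI').mono
    hg.ge ?_)
  rintro σ4 hF4 ⟨h1, h2⟩
  have hN4 : ∀ a, a = 0 ∨ a = 17 → σ4.nat a = σ2.nat a := fun a ha => by
    rw [hF4.nat a (fun h => by have := writesN_dominance _ _ _ h; omega),
      hN3 a (by omega) (by omega) (by omega)]
  have hR4 : ∀ a, a ≤ d → σ4.real a = σ.real a := fun a ha => by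
    rw [hF4.real a (fun h => by have := writesR_dominance _ _ _ h; omega), hR3 a (by omega)]
  refine (runs_pairSum (f := fun i j => V i j * ∑ i' ∈ Finset.range n, ∑ j' ∈ Finset.range n,
    U i' j' * ∏ k ∈ Finset.range (d + d), ind (P k i' j' ≤ Q k i j)) hgn
    (by rw [hN4 0 (by simp), m0]) ?_).mono le_rfl ?_
  · intro i hi j hj τ hN hR h14 h15 h16
    have htn : i * n + j < n * n := by nlinarith
    have t17 : τ.nat 17 0 = n * n := by
      rw [hN 17 (by norm_num) (by norm_num) (by norm_num), hN4 17 (by simp), m17]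
    have e1 := hv i j τ (fun k hk => by rw [hR k (by omega), hR4 k hk.le, hσ.data k hk]) h15 h16
    simp only [RExp.eval, NExp.eval, NExp.eval_var, t17, h14, e1]
    rw [hR _ (by omega), h2 _ htn, hd1, ← sum_range_mul_self n (fun i' j' => U i' j' *
      ∏ k ∈ Finset.range (d + d), ind (P k i' j' ≤ Q k i j)), (div_mod_pair hj).1,
      (div_mod_pair hj).2]
  · intro τ hτ h
    have hN : ∀ a, ¬ (Cmd.setR d (NExp.const 0) (RExp.add (RExp.load d (NExp.const 0)) (RExp.mul v
        (RExp.load (d + 2) (NExp.add (NExp.var 17) (NExp.var 14)))))).WritesN a := by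
      simp [Cmd.WritesN]
    have hR : ∀ a, a ≠ d → τ.real a = σ4.real a := fun a ha => hτ.real a (by
      rw [pairSum, writesR_pairFor]; simpa [Cmd.WritesR] using ha)
    refine ⟨⟨?_, fun k hk => ?_, fun x => ?_⟩, ?_⟩
    · rw [hτ.nat 0 (by rw [pairSum, writesN_pairFor hN]; norm_num), hN4 0 (by simp), m0]
    · rw [hR k hk.ne, hR4 k hk.le, hσ.data k hk]
    · rw [hR _ (by omega), h1]
    · rw [h, hR4 d le_rfl]

/-! ## The statistics `U_{τ*_P}` and `U_{τ*_J}` -/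

/-- The antisymmetrised product of the four edges from `c` and `f` to `a` and `b`. -/
def quad {ι : Type*} (e : ι → ι → ℝ) (a b c f : ι) : ℝ :=
  e c a * e c b * e f a * e f b - e c f * e c b * e a f * e a b - e b a * e b c * e f a * e f c +
    e b f * e b c * e a f * e a c

/-- `dsum_eq` for a product of two antisymmetrised edge products. On the diagonal such a product has
only two terms, so the triple sums become sums of squares of sums over one index, and the double sum
is a sum over pairs. -/
theorem dsum_quad {n : ℕ} (eX eY : ℕ → ℕ → ℝ) (sqX : ∀ i j, eX i j * eX i j = eX i j)
    (sqY : ∀ i j, eY i j * eY i j = eY i j) (selfX : ∀ i, eX i i = 0) (selfY : ∀ i, eY i i = 0) :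
    dsum (Finset.range n) (fun a b c f => quad eX a b c f * quad eY a b c f) =
      (∑ k ∈ Finset.range n, ∑ l ∈ Finset.range n, ∑ i ∈ Finset.range n, ∑ j ∈ Finset.range n,
        quad eX i k l j * quad eY i k l j) +
      (∑ i ∈ Finset.range n, -4 * (
        (∑ j ∈ Finset.range n, eX i j * eY i j) * (∑ j ∈ Finset.range n, eX i j * eY i j) +
        (∑ j ∈ Finset.range n, eX i j * eY j i) * (∑ j ∈ Finset.range n, eX i j * eY j i) +
        (∑ j ∈ Finset.range n, eX j i * eY i j) * (∑ j ∈ Finset.range n, eX j i * eY i j) +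
        (∑ j ∈ Finset.range n, eX j i * eY j i) * (∑ j ∈ Finset.range n, eX j i * eY j i))) +
      ∑ i ∈ Finset.range n, ∑ j ∈ Finset.range n,
        2 * ((eX i j + eX j i) * (eY i j + eY j i)) := by
  -- For equal first indices the two mixed terms contain an edge from a vertex to itself and vanish;
  -- in the others the repeated edges merge by idempotence.
  have diag : ∀ e : ℕ → ℕ → ℝ, (∀ i j, e i j * e i j = e i j) → (∀ i, e i i = 0) →
      ∀ a b c, quad e a a b c = e b a * e c a + e a b * e a c := by
    intro e sq self a b c
    rw [quad, self]
    linear_combination (e c a * e c a) * sq b a + e b a * sq c a + (e a b * e a b) * sq a c +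
      e a c * sq a b
  rw [dsum_eq]
  · simp only [diag eX sqX selfX, diag eY sqY selfY, sqX, sqY]
    rw [sub_eq_add_neg]
    congr 1
    · congr 1
      · rw [Finset.sum_comm]
        refine Finset.sum_congr rfl fun k _ => ?_
        rw [Finset.sum_comm]
      · rw [← neg_mul, Finset.mul_sum]
        refine Finset.sum_congr rfl fun i _ => ?_
        congr 1
        simp only [Finset.sum_mul_sum, ← Finset.sum_add_distrib]
        refine Finset.sum_congr rfl fun j _ => Finset.sum_congr rfl fun k _ => ?_
        ring
    · simp only [Finset.mul_sum]
      refine Finset.sum_congr rfl fun i _ => Finset.sum_congr rfl fun j _ => ?_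
      ring
  · intro a b c
    simp only [quad, selfX, selfY]
    ring
  · intro a b c
    simp only [quad, selfX, selfY]
    ring
  · intro a b c f
    simp only [quad]
    ring
  · intro a b c f
    simp only [quad]
    ring

/-- The order is four, so the tail is empty and the sum over tails has a single term. -/
theorem uStat_edges {r s n : ℕ} (IX : (Fin (0 + 4) → Fin r → ℝ) → Prop)
    (IY : (Fin (0 + 4) → Fin s → ℝ) → Prop) (z : Fin n → Obs r s) (eX eY : ℕ → ℕ → ℝ)
    (hX : ∀ (a b c f : Fin n) w, ind (IX (tup (z a).1 (z b).1 (z c).1 (z f).1 w)) =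
      eX c a * eX c b * eX f a * eX f b)
    (hY : ∀ (a b c f : Fin n) w, ind (IY (tup (z a).2 (z b).2 (z c).2 (z f).2 w)) =
      eY c a * eY c b * eY f a * eY f b) :
    uStat 1 (Htau 0) IX IY n z =
      dsum (Finset.range n) (fun a b c f => quad eX a b c f * quad eY a b c f) /
        (n.descFactorial 4 : ℝ) := by
  classical
  have hk : ∀ a b c f (w : Fin 0 → Fin n), kernel (Htau 0) IX IY (fun p => z (tup a b c f w p)) =
      quad eX a b c f * quad eY a b c f := by
    intro a b c f w
    have e1 : (fun p => (z (tup a b c f w p)).1) = tup (z a).1 (z b).1 (z c).1 (z f).1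
        (fun p => (z (w p)).1) := comp_tup a b c f w (fun p => (z p).1)
    have e2 : (fun p => (z (tup a b c f w p)).2) = tup (z a).2 (z b).2 (z c).2 (z f).2
        (fun p => (z (w p)).2) := comp_tup a b c f w (fun p => (z p).2)
    rw [kernel, e1, e2, sum_Htau, sum_Htau]
    simp only [hX, hY]
    rfl
  rw [uStat_eq_sum_injective, sum_injective_tup, one_mul]
  simp only [hk]
  congr 1
  have h1 : (Finset.univ.filter fun w : Fin 0 → Fin n => Function.Injective w) = {Fin.elim0} := by
    ext w
    simp only [Finset.mem_filter, Finset.mem_univ, true_and, Finset.mem_singleton]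
    exact ⟨fun _ => Subsingleton.elim _ _, fun _ => Function.injective_of_subsingleton _⟩
  rw [h1, Finset.sum_singleton, Finset.filter_true_of_mem (by simp)]
  simp only [dsum, Finset.sum_range, ne_eq, Fin.ext_iff]

/-! ### Edges -/

/-- The sign of a term. -/
def sgn (b : Bool) : ℝ := if b then -1 else 1

def sgnExp (b : Bool) : RExp := if b then RExp.sub (RExp.num 0) (RExp.num 1) else RExp.num 1

theorem eval_sgnExp (σ : Mem) (b : Bool) : (sgnExp b).eval σ = sgn b := by
  cases b <;> simp [sgnExp, sgn, RExp.eval, RExp.eval_num]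

/-- A relation between two observations which only depends on the coordinates `lo, …, hi - 1`, with
an expression for it, and its expansion into weak inequalities in the coordinates. -/
structure EdgeKind (lo hi : ℕ) where
  exp : NExp → NExp → RExp
  val : (ℕ → ℕ → ℝ) → ℕ → ℕ → ℝ
  terms : Finset (Finset ℕ)
  neg : Finset ℕ → Bool
  eval_exp : ∀ (σ : Mem) (a b : NExp), (exp a b).eval σ = val σ.real (a.eval σ) (b.eval σ)
  val_congr : ∀ Z Z' : ℕ → ℕ → ℝ, (∀ k, lo ≤ k → k < hi → Z k = Z' k) → val Z = val Z'
  mem_terms : ∀ T ∈ terms, ∀ k ∈ T, lo ≤ k ∧ k < hi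
  val_eq : ∀ (Z : ℕ → ℕ → ℝ) (i j : ℕ),
    val Z i j = ∑ T ∈ terms, sgn (neg T) * ∏ k ∈ T, ind (Z k i ≤ Z k j)
  val_sq : ∀ (Z : ℕ → ℕ → ℝ) (i j : ℕ), val Z i j * val Z i j = val Z i j
  val_self : ∀ (Z : ℕ → ℕ → ℝ) (i : ℕ), val Z i i = 0

theorem forall_mem_Ico_add {lo m : ℕ} {p : ℕ → Prop} :
    (∀ k ∈ Finset.Ico lo (lo + m), p k) ↔ ∀ k < m, p (lo + k) := by
  refine ⟨fun h k hk => h _ (by simp [hk]), fun h k hk => ?_⟩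
  rw [Finset.mem_Ico] at hk
  have := h (k - lo) (by omega)
  rwa [show lo + (k - lo) = k by omega] at this

/-- There is an edge from `i` to `j` if `i` is not at most `j`. -/
noncomputable def edgeNotLe (lo m : ℕ) {hi : ℕ} (hm : 1 ≤ m) (h : lo + m = hi) : EdgeKind lo hi where
  exp a b := RExp.neg (leExp lo m a b)
  val Z i j := 1 - ind (∀ k < m, Z (lo + k) i ≤ Z (lo + k) j)
  terms := {∅, Finset.Ico lo (lo + m)}
  neg T := decide T.Nonempty
  eval_exp σ a b := by rw [RExp.eval_neg, eval_leExp]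
  val_congr Z Z' h' := by
    ext i j
    congr 1
    refine ind_congr (forall₂_congr fun k hk => ?_)
    rw [h' _ (by omega) (by omega)]
  mem_terms T hT k hk := by
    simp only [Finset.mem_insert, Finset.mem_singleton] at hT
    rcases hT with rfl | rfl
    · simp at hk
    · simpa [h] using hk
  val_eq Z i j := by
    -- With at least one coordinate the two terms are different sets, and only the nonempty one
    -- carries a minus sign.
    have h1 : (Finset.Ico lo (lo + m)).Nonempty := by simp; omega
    rw [Finset.sum_pair h1.ne_empty.symm, prod_ind (Finset.Ico lo (lo + m))]
    simp only [h1, forall_mem_Ico_add]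
    simp [sgn]
    ring
  val_sq Z i j := by
    rw [← ind_not, ind_mul_self]
  val_self Z i := by
    rw [ind_true (fun _ _ => le_rfl), sub_self]

/-- There is an edge from `i` to `j` if `j` is smaller than `i` in every coordinate. -/
noncomputable def edgeGt (lo m : ℕ) {hi : ℕ} (hm : 1 ≤ m) (h : lo + m = hi) : EdgeKind lo hi where
  exp a b := ltExp lo m b a
  val Z i j := ind (∀ k < m, Z (lo + k) j < Z (lo + k) i)
  terms := (Finset.Ico lo (lo + m)).powerset
  neg T := decide (Odd T.card)
  eval_exp σ a b := by rw [eval_ltExp]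
  val_congr Z Z' h' := by
    ext i j
    refine ind_congr (forall₂_congr fun k hk => ?_)
    rw [h' _ (by omega) (by omega)]
  mem_terms T hT k hk := by
    simpa [h] using Finset.mem_powerset.mp hT hk
  val_eq Z i j := by
    -- Each strict inequality is `1` minus the reverse weak one; the product expands over subsets
    -- with the sign given by the parity of the cardinality.
    rw [← forall_mem_Ico_add (p := fun k => Z k j < Z k i), ← prod_ind]
    simp only [← not_le, ind_not]
    simp only [sub_eq_neg_add]
    rw [Finset.prod_add]
    refine Finset.sum_congr rfl fun T _ => ?_
    rw [Finset.prod_const_one, mul_one, Finset.prod_neg]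
    congr 1
    by_cases h : Odd T.card
    · simp [sgn, h, h.neg_one_pow]
    · simp [sgn, h, (Nat.not_odd_iff_even.mp h).neg_one_pow]
  val_sq Z i j := ind_mul_self _
  val_self Z i := ind_false fun h => lt_irrefl _ (h 0 (by omega))

/-! ### Sums over quadruples as dominance sums among pairs -/

/-- One of two alternatives. -/
def pick {α : Type*} (b : Bool) (i j : α) : α := if b then j else i

theorem eval_pick (σ : Mem) (b : Bool) (i j : NExp) :
    (pick b i j).eval σ = pick b (i.eval σ) (j.eval σ) := by
  cases b <;> rfl

/-- The two generating transpositions swap `i` with `j` and `k` with `l` independently, each with a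
sign. In every term one edge lies inside `(i, j)` and one inside `(k, l)`; these become weights, and
the two remaining edges relate the pairs in opposite directions. -/
theorem quad_eq_sum {ι : Type*} (e : ι → ι → ℝ) (i k l j : ι) :
    quad e i k l j = ∑ a : Bool, ∑ b : Bool, sgn a * sgn b *
      (e (pick (!a) i j) (pick a i j) * e (pick (!b) k l) (pick b k l) *
        (e (pick (!b) k l) (pick a i j) * e (pick (!a) i j) (pick b k l))) := by
  simp only [Fintype.sum_bool, sgn, pick, quad]
  simp
  ring

/-- The choices `a` for the coordinates below `r`, and `b` for the other ones. -/
def flag (r : ℕ) (a b : Bool) (k : ℕ) : Bool := if k < r then a else b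

/-- The coordinates of the point which belongs to the pair `(i, j)`: first the ones which occur in the
edges into the pair, then the ones which occur in the edges out of it. -/
noncomputable def pointCoord (d : ℕ) (M M' : Finset ℕ) (Z : ℕ → ℕ → ℝ) (α : ℕ → Bool) (k i j : ℕ) :
    ℝ :=
  if k < d then (if k ∈ M then -Z k (pick (α k) i j) else 0)
  else if k - d ∈ M' then Z (k - d) (pick (!α (k - d)) i j) else 0

/-- The coordinates of the query which belongs to the pair `(i, j)`. -/
noncomputable def queryCoord (d : ℕ) (M M' : Finset ℕ) (Z : ℕ → ℕ → ℝ) (β : ℕ → Bool) (k i j : ℕ) :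
    ℝ :=
  if k < d then (if k ∈ M then -Z k (pick (!β k) i j) else 0)
  else if k - d ∈ M' then Z (k - d) (pick (β (k - d)) i j) else 0

def pointExp (d : ℕ) (M M' : Finset ℕ) (α : ℕ → Bool) (k : ℕ) : RExp :=
  if k < d then (if k ∈ M then
    RExp.sub (RExp.num 0) (RExp.load k (pick (α k) (NExp.var 15) (NExp.var 16))) else RExp.num 0)
  else if k - d ∈ M' then RExp.load (k - d) (pick (!α (k - d)) (NExp.var 15) (NExp.var 16))
  else RExp.num 0

def queryExp (d : ℕ) (M M' : Finset ℕ) (β : ℕ → Bool) (k : ℕ) : RExp :=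
  if k < d then (if k ∈ M then
    RExp.sub (RExp.num 0) (RExp.load k (pick (!β k) (NExp.var 15) (NExp.var 16))) else RExp.num 0)
  else if k - d ∈ M' then RExp.load (k - d) (pick (β (k - d)) (NExp.var 15) (NExp.var 16))
  else RExp.num 0

theorem eval_pointExp {d k i j : ℕ} {M M' : Finset ℕ} {Z : ℕ → ℕ → ℝ} {α : ℕ → Bool} {τ : Mem}
    (hk : k < d + d) (hZ : ∀ k < d, τ.real k = Z k) (hi : τ.nat 15 0 = i) (hj : τ.nat 16 0 = j) :
    (pointExp d M M' α k).eval τ = pointCoord d M M' Z α k i j := by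
  by_cases h : k < d
  · by_cases hM : k ∈ M <;>
      simp [pointExp, pointCoord, h, hM, RExp.eval, RExp.eval_num, eval_pick, hZ k h, hi, hj]
  · by_cases hM : k - d ∈ M' <;> simp [pointExp, pointCoord, h, hM, RExp.eval, RExp.eval_num,
      eval_pick, hZ (k - d) (by omega), hi, hj]

theorem eval_queryExp {d k i j : ℕ} {M M' : Finset ℕ} {Z : ℕ → ℕ → ℝ} {β : ℕ → Bool} {τ : Mem}
    (hk : k < d + d) (hZ : ∀ k < d, τ.real k = Z k) (hi : τ.nat 15 0 = i) (hj : τ.nat 16 0 = j) :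
    (queryExp d M M' β k).eval τ = queryCoord d M M' Z β k i j := by
  by_cases h : k < d
  · by_cases hM : k ∈ M <;>
      simp [queryExp, queryCoord, h, hM, RExp.eval, RExp.eval_num, eval_pick, hZ k h, hi, hj]
  · by_cases hM : k - d ∈ M' <;> simp [queryExp, queryCoord, h, hM, RExp.eval, RExp.eval_num,
      eval_pick, hZ (k - d) (by omega), hi, hj]

theorem prod_ind_union {r d : ℕ} {T T' : Finset ℕ} (hT : ∀ k ∈ T, k < r ∧ k < d)
    (hT' : ∀ k ∈ T', r ≤ k ∧ k < d) {R RX RY : ℕ → Prop} (hX : ∀ k < r, R k ↔ RX k)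
    (hY : ∀ k, r ≤ k → (R k ↔ RY k)) :
    ∏ k ∈ Finset.range d, ind (k ∈ T ∪ T' → R k) = (∏ k ∈ T, ind (RX k)) * ∏ k ∈ T', ind (RY k) := by
  rw [prod_ind, prod_ind, prod_ind, ← ind_and]
  refine ind_congr ⟨fun h => ⟨fun k hk => ?_, fun k hk => ?_⟩, fun h k hk hm => ?_⟩
  · exact (hX k (hT k hk).1).mp (h k (Finset.mem_range.mpr (hT k hk).2) (by simp [hk]))
  · exact (hY k (hT' k hk).1).mp (h k (Finset.mem_range.mpr (hT' k hk).2) (by simp [hk]))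
  · rcases Finset.mem_union.mp hm with hm | hm
    · exact (hX k (hT k hm).1).mpr (h.1 k hm)
    · exact (hY k (hT' k hm).1).mpr (h.2 k hm)

/-- The sets `T₁` and `T₃` belong to the edges from the query pair into the point pair, `T₂` and
`T₄` to those in the other direction. The two directions occupy separate blocks of `d` coordinates,
and within a block the `x` and `y` parts use disjoint coordinates. -/
theorem prod_coord {r d : ℕ} (hrd : r ≤ d) {T₁ T₂ T₃ T₄ : Finset ℕ} (h₁ : ∀ k ∈ T₁, k < r)
    (h₂ : ∀ k ∈ T₂, k < r) (h₃ : ∀ k ∈ T₃, r ≤ k ∧ k < d) (h₄ : ∀ k ∈ T₄, r ≤ k ∧ k < d)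
    (Z : ℕ → ℕ → ℝ) (a b a' b' : Bool) (i j k l : ℕ) :
    ∏ q ∈ Finset.range (d + d), ind (pointCoord d (T₁ ∪ T₃) (T₂ ∪ T₄) Z (flag r a a') q i j ≤
      queryCoord d (T₁ ∪ T₃) (T₂ ∪ T₄) Z (flag r b b') q k l) =
    (∏ q ∈ T₁, ind (Z q (pick (!b) k l) ≤ Z q (pick a i j))) *
      (∏ q ∈ T₃, ind (Z q (pick (!b') k l) ≤ Z q (pick a' i j))) *
    ((∏ q ∈ T₂, ind (Z q (pick (!a) i j) ≤ Z q (pick b k l))) *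
      ∏ q ∈ T₄, ind (Z q (pick (!a') i j) ≤ Z q (pick b' k l))) := by
  rw [Finset.prod_range_add]
  congr 1
  · rw [← prod_ind_union (R := fun q => Z q (pick (!(flag r b b' q)) k l) ≤
      Z q (pick (flag r a a' q) i j)) (fun q hq => ⟨h₁ q hq, (h₁ q hq).trans_le hrd⟩) h₃
      (fun q hq => by simp [flag, hq]) (fun q hq => by simp [flag, not_lt.mpr hq])]
    refine Finset.prod_congr rfl fun q hq => ind_congr ?_
    rw [Finset.mem_range] at hq
    by_cases hM : q ∈ T₁ ∪ T₃
    -- Here the query bounds the point from below; the minus signs reverse this into an inequality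
    -- of dominance type. Coordinates that do not occur read `0 ≤ 0`.
    · simp only [pointCoord, queryCoord, hq, hM, if_true, neg_le_neg_iff, forall_const]
    · simp only [pointCoord, queryCoord, hq, hM, if_true, if_false, le_refl, false_imp_iff]
  · rw [← prod_ind_union (R := fun q => Z q (pick (!(flag r a a' q)) i j) ≤
      Z q (pick (flag r b b' q) k l)) (fun q hq => ⟨h₂ q hq, (h₂ q hq).trans_le hrd⟩) h₄
      (fun q hq => by simp [flag, hq]) (fun q hq => by simp [flag, not_lt.mpr hq])]
    refine Finset.prod_congr rfl fun q hq => ind_congr ?_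
    have hq' : ¬ d + q < d := by omega
    by_cases hM : q ∈ T₂ ∪ T₄
    · simp only [pointCoord, queryCoord, hq', hM, if_true, if_false, Nat.add_sub_cancel_left,
        forall_const]
    · simp only [pointCoord, queryCoord, hq', hM, if_false, le_refl, false_imp_iff,
        Nat.add_sub_cancel_left]

theorem sum_prod_four {α : Type*} (A B : Finset α) (f₁ f₂ g₁ g₂ : α → ℝ) :
    ∑ T ∈ (A ×ˢ A) ×ˢ (B ×ˢ B), f₁ T.1.1 * f₂ T.1.2 * (g₁ T.2.1 * g₂ T.2.2) =
      (∑ T ∈ A, f₁ T) * (∑ T ∈ A, f₂ T) * ((∑ T ∈ B, g₁ T) * ∑ T ∈ B, g₂ T) := by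
  rw [Finset.sum_mul_sum A A, Finset.sum_mul_sum B B, ← Finset.sum_product', ← Finset.sum_product',
    Finset.sum_mul_sum, ← Finset.sum_product']

/-- Adds the sum over all pairs of pairs of the term with the swaps `a`, `b` in the first part and `a'`,
`b'` in the second part. -/
noncomputable def swapTerm {r d : ℕ} (X : EdgeKind 0 r) (Y : EdgeKind r d) (a b a' b' : Bool) : Cmd :=
  let i := NExp.var 15
  let j := NExp.var 16
  Cmd.sum ((X.terms ×ˢ X.terms) ×ˢ (Y.terms ×ˢ Y.terms)) fun T =>
    pairDominance d (pointExp d (T.1.1 ∪ T.2.1) (T.1.2 ∪ T.2.2) (flag r a a'))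
      (queryExp d (T.1.1 ∪ T.2.1) (T.1.2 ∪ T.2.2) (flag r b b'))
      (RExp.mul (RExp.mul (RExp.mul (RExp.mul (sgnExp a) (sgnExp a'))
        (RExp.mul (sgnExp (X.neg T.1.1)) (sgnExp (X.neg T.1.2))))
        (RExp.mul (sgnExp (Y.neg T.2.1)) (sgnExp (Y.neg T.2.2))))
        (RExp.mul (X.exp (pick (!a) i j) (pick a i j)) (Y.exp (pick (!a') i j) (pick a' i j))))
      (RExp.mul (RExp.mul (sgnExp b) (sgnExp b'))
        (RExp.mul (X.exp (pick (!b) i j) (pick b i j)) (Y.exp (pick (!b') i j) (pick b' i j))))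

theorem EdgeKind.eval_eq {lo hi d i j : ℕ} (E : EdgeKind lo hi) (hd : hi ≤ d) {Z : ℕ → ℕ → ℝ}
    {τ : Mem} (hZ : ∀ k < d, τ.real k = Z k) {a b : NExp} (ha : a.eval τ = i) (hb : b.eval τ = j) :
    (E.exp a b).eval τ = E.val Z i j := by
  rw [E.eval_exp, ha, hb, E.val_congr _ Z fun k _ hk => hZ k (by omega)]

/-- Each of the four edges between the pairs, two in `x` and two in `y`, is expanded into its terms;
every choice `T` of four terms is one dominance sum. The edges inside the point pair and inside the
query pair go into the weights `U` and `V`. -/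
theorem adds_swapTerm {r d n g L : ℕ} {Z : ℕ → ℕ → ℝ} (X : EdgeKind 0 r) (Y : EdgeKind r d)
    (hrd : r ≤ d) (hd : 1 ≤ d) (hL : L = Nat.clog 2 (2 * n ^ 2))
    (hg : g = (2 ^ L + 2) * (L + 1) ^ (d + d - 1)) (a b a' b' : Bool) :
    Adds d n g Z (swapTerm X Y a b a' b')
      (∑ k ∈ Finset.range n, ∑ l ∈ Finset.range n, ∑ i ∈ Finset.range n, ∑ j ∈ Finset.range n,
        (sgn a * sgn b * (X.val Z (pick (!a) i j) (pick a i j) * X.val Z (pick (!b) k l) (pick b k l) *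
          (X.val Z (pick (!b) k l) (pick a i j) * X.val Z (pick (!a) i j) (pick b k l)))) *
        (sgn a' * sgn b' * (Y.val Z (pick (!a') i j) (pick a' i j) *
          Y.val Z (pick (!b') k l) (pick b' k l) *
          (Y.val Z (pick (!b') k l) (pick a' i j) * Y.val Z (pick (!a') i j) (pick b' k l))))) := by
  have hg1 : 1 ≤ g := by rw [hg]; exact Nat.mul_pos (Nat.succ_pos _) (Nat.one_le_pow _ _ (by omega))
  have h := Adds.sum hg1 (S := (X.terms ×ˢ X.terms) ×ˢ (Y.terms ×ˢ Y.terms)) fun T _ =>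
    adds_pairDominance (n := n) (Z := Z)
      (pe := pointExp d (T.1.1 ∪ T.2.1) (T.1.2 ∪ T.2.2) (flag r a a'))
      (qe := queryExp d (T.1.1 ∪ T.2.1) (T.1.2 ∪ T.2.2) (flag r b b'))
      (u := RExp.mul (RExp.mul (RExp.mul (RExp.mul (sgnExp a) (sgnExp a'))
        (RExp.mul (sgnExp (X.neg T.1.1)) (sgnExp (X.neg T.1.2))))
        (RExp.mul (sgnExp (Y.neg T.2.1)) (sgnExp (Y.neg T.2.2))))
        (RExp.mul (X.exp (pick (!a) (NExp.var 15) (NExp.var 16))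
          (pick a (NExp.var 15) (NExp.var 16)))
          (Y.exp (pick (!a') (NExp.var 15) (NExp.var 16)) (pick a' (NExp.var 15) (NExp.var 16)))))
      (v := RExp.mul (RExp.mul (sgnExp b) (sgnExp b'))
        (RExp.mul (X.exp (pick (!b) (NExp.var 15) (NExp.var 16))
          (pick b (NExp.var 15) (NExp.var 16)))
          (Y.exp (pick (!b') (NExp.var 15) (NExp.var 16)) (pick b' (NExp.var 15) (NExp.var 16)))))
      (P := pointCoord d (T.1.1 ∪ T.2.1) (T.1.2 ∪ T.2.2) Z (flag r a a'))
      (Q := queryCoord d (T.1.1 ∪ T.2.1) (T.1.2 ∪ T.2.2) Z (flag r b b'))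
      (U := fun i j => sgn a * sgn a' * (sgn (X.neg T.1.1) * sgn (X.neg T.1.2)) *
        (sgn (Y.neg T.2.1) * sgn (Y.neg T.2.2)) *
        (X.val Z (pick (!a) i j) (pick a i j) * Y.val Z (pick (!a') i j) (pick a' i j)))
      (V := fun i j => sgn b * sgn b' *
        (X.val Z (pick (!b) i j) (pick b i j) * Y.val Z (pick (!b') i j) (pick b' i j)))
      hd hL hg
      (fun k hk i j τ h1 h2 h3 => eval_pointExp hk h1 h2 h3)
      (fun k hk i j τ h1 h2 h3 => eval_queryExp hk h1 h2 h3)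
      (fun i j τ h1 h2 h3 => by
        have hp : ∀ c, (pick c (NExp.var 15) (NExp.var 16)).eval τ = pick c i j := fun c => by
          rw [eval_pick, NExp.eval_var, NExp.eval_var, h2, h3]
        simp only [RExp.eval, eval_sgnExp, X.eval_eq hrd h1 (hp _) (hp _),
          Y.eval_eq le_rfl h1 (hp _) (hp _)])
      (fun i j τ h1 h2 h3 => by
        have hp : ∀ c, (pick c (NExp.var 15) (NExp.var 16)).eval τ = pick c i j := fun c => by
          rw [eval_pick, NExp.eval_var, NExp.eval_var, h2, h3]
        simp only [RExp.eval, eval_sgnExp, X.eval_eq hrd h1 (hp _) (hp _),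
          Y.eval_eq le_rfl h1 (hp _) (hp _)])
  refine (congrArg (Adds d n g Z (swapTerm X Y a b a' b')) ?_).mp h
  -- The sum over the choices of terms is moved inside the sums over `k`, `l`, `i` and `j`, where
  -- distributivity in the form of `sum_prod_four` reassembles the edges.
  simp only [Finset.mul_sum]
  rw [Finset.sum_comm]
  refine Finset.sum_congr rfl fun k _ => ?_
  rw [Finset.sum_comm]
  refine Finset.sum_congr rfl fun l _ => ?_
  rw [Finset.sum_comm]
  refine Finset.sum_congr rfl fun i _ => ?_
  rw [Finset.sum_comm]
  refine Finset.sum_congr rfl fun j _ => ?_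
  have e := sum_prod_four X.terms Y.terms
    (fun T => sgn (X.neg T) * ∏ q ∈ T, ind (Z q (pick (!b) k l) ≤ Z q (pick a i j)))
    (fun T => sgn (X.neg T) * ∏ q ∈ T, ind (Z q (pick (!a) i j) ≤ Z q (pick b k l)))
    (fun T => sgn (Y.neg T) * ∏ q ∈ T, ind (Z q (pick (!b') k l) ≤ Z q (pick a' i j)))
    (fun T => sgn (Y.neg T) * ∏ q ∈ T, ind (Z q (pick (!a') i j) ≤ Z q (pick b' k l)))
  rw [← X.val_eq, ← X.val_eq, ← Y.val_eq, ← Y.val_eq] at e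
  trans (sgn a * sgn b * (X.val Z (pick (!a) i j) (pick a i j) *
      X.val Z (pick (!b) k l) (pick b k l)) * (sgn a' * sgn b' *
      (Y.val Z (pick (!a') i j) (pick a' i j) * Y.val Z (pick (!b') k l) (pick b' k l)))) *
      (X.val Z (pick (!b) k l) (pick a i j) * X.val Z (pick (!a) i j) (pick b k l) *
        (Y.val Z (pick (!b') k l) (pick a' i j) * Y.val Z (pick (!a') i j) (pick b' k l)))
  · rw [← e, Finset.mul_sum]
    refine Finset.sum_congr rfl fun T hT => ?_
    simp only [Finset.mem_product] at hT
    obtain ⟨⟨t1, t2⟩, t3, t4⟩ := hT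
    rw [prod_coord hrd (fun k hk => (X.mem_terms _ t1 k hk).2) (fun k hk => (X.mem_terms _ t2 k hk).2)
      (Y.mem_terms _ t3) (Y.mem_terms _ t4)]
    ring
  · ring

/-- Adds the sum of the antisymmetrised products over all quadruples of observations. -/
noncomputable def quadSum {r d : ℕ} (X : EdgeKind 0 r) (Y : EdgeKind r d) : Cmd :=
  Cmd.sum Finset.univ fun a => Cmd.sum Finset.univ fun b => Cmd.sum Finset.univ fun a' =>
    Cmd.sum Finset.univ fun b' => swapTerm X Y a b a' b'

/-- The swaps in the `x` factor and in the `y` factor are chosen independently, which makes sixteen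
programs, a number that does not depend on `n`. -/
theorem adds_quadSum {r d n g L : ℕ} {Z : ℕ → ℕ → ℝ} (X : EdgeKind 0 r) (Y : EdgeKind r d)
    (hrd : r ≤ d) (hd : 1 ≤ d) (hL : L = Nat.clog 2 (2 * n ^ 2))
    (hg : g = (2 ^ L + 2) * (L + 1) ^ (d + d - 1)) :
    Adds d n g Z (quadSum X Y)
      (∑ k ∈ Finset.range n, ∑ l ∈ Finset.range n, ∑ i ∈ Finset.range n, ∑ j ∈ Finset.range n,
        quad (X.val Z) i k l j * quad (Y.val Z) i k l j) := by
  have hg1 : 1 ≤ g := by rw [hg]; exact Nat.mul_pos (Nat.succ_pos _) (Nat.one_le_pow _ _ (by omega))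
  have h := Adds.sum hg1 (S := Finset.univ) fun a _ => Adds.sum hg1 (S := Finset.univ) fun b _ =>
    Adds.sum hg1 (S := Finset.univ) fun a' _ => Adds.sum hg1 (S := Finset.univ) fun b' _ =>
      adds_swapTerm (n := n) (Z := Z) X Y hrd hd hL hg a b a' b'
  refine (congrArg (Adds d n g Z (quadSum X Y)) ?_).mp h
  simp only [quad_eq_sum, Fintype.sum_bool, ← Finset.sum_add_distrib]
  refine Finset.sum_congr rfl fun k _ => Finset.sum_congr rfl fun l _ =>
    Finset.sum_congr rfl fun i _ => Finset.sum_congr rfl fun j _ => ?_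
  ring

/-- Corrects the sum over all quadruples to the sum over the quadruples of distinct observations. -/
noncomputable def quadCorrection {r d : ℕ} (X : EdgeKind 0 r) (Y : EdgeKind r d) : Cmd :=
  let i := NExp.var 15
  let j := NExp.var 16
  Cmd.seq (Cmd.seq (Cmd.seq (Cmd.seq
    (subSquares d (RExp.mul (X.exp i j) (Y.exp i j)))
    (subSquares d (RExp.mul (X.exp i j) (Y.exp j i))))
    (subSquares d (RExp.mul (X.exp j i) (Y.exp i j))))
    (subSquares d (RExp.mul (X.exp j i) (Y.exp j i))))
    (pairSum d (RExp.mul (RExp.num 2) (RExp.mul (RExp.add (X.exp i j) (X.exp j i))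
      (RExp.add (Y.exp i j) (Y.exp j i)))))

theorem adds_quadCorrection {r d n g : ℕ} {Z : ℕ → ℕ → ℝ} (X : EdgeKind 0 r) (Y : EdgeKind r d)
    (hrd : r ≤ d) (hg : (n + 1) * (n + 1) ≤ g) :
    Adds d n g Z (quadCorrection X Y) (
      (∑ i ∈ Finset.range n, -4 * ((∑ j ∈ Finset.range n, X.val Z i j * Y.val Z i j) *
        ∑ j ∈ Finset.range n, X.val Z i j * Y.val Z i j)) +
      (∑ i ∈ Finset.range n, -4 * ((∑ j ∈ Finset.range n, X.val Z i j * Y.val Z j i) *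
        ∑ j ∈ Finset.range n, X.val Z i j * Y.val Z j i)) +
      (∑ i ∈ Finset.range n, -4 * ((∑ j ∈ Finset.range n, X.val Z j i * Y.val Z i j) *
        ∑ j ∈ Finset.range n, X.val Z j i * Y.val Z i j)) +
      (∑ i ∈ Finset.range n, -4 * ((∑ j ∈ Finset.range n, X.val Z j i * Y.val Z j i) *
        ∑ j ∈ Finset.range n, X.val Z j i * Y.val Z j i)) +
      ∑ i ∈ Finset.range n, ∑ j ∈ Finset.range n,
        2 * ((X.val Z i j + X.val Z j i) * (Y.val Z i j + Y.val Z j i))) := by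
  have ev : ∀ (i j : ℕ) (τ : Mem), (∀ k < d, τ.real k = Z k) → τ.nat 15 0 = i → τ.nat 16 0 = j →
      (X.exp (NExp.var 15) (NExp.var 16)).eval τ = X.val Z i j ∧
      (X.exp (NExp.var 16) (NExp.var 15)).eval τ = X.val Z j i ∧
      (Y.exp (NExp.var 15) (NExp.var 16)).eval τ = Y.val Z i j ∧
      (Y.exp (NExp.var 16) (NExp.var 15)).eval τ = Y.val Z j i := fun i j τ h1 h2 h3 =>
    ⟨X.eval_eq hrd h1 h2 h3, X.eval_eq hrd h1 h3 h2, Y.eval_eq le_rfl h1 h2 h3,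
      Y.eval_eq le_rfl h1 h3 h2⟩
  refine Adds.seq (Adds.seq (Adds.seq (Adds.seq ?_ ?_) ?_) ?_) ?_
  · exact adds_subSquares hg fun i j τ h1 h2 h3 => by
      obtain ⟨e1, e2, e3, e4⟩ := ev i j τ h1 h2 h3
      simp only [RExp.eval, e1, e3]
  · exact adds_subSquares hg fun i j τ h1 h2 h3 => by
      obtain ⟨e1, e2, e3, e4⟩ := ev i j τ h1 h2 h3
      simp only [RExp.eval, e1, e4]
  · exact adds_subSquares hg fun i j τ h1 h2 h3 => by
      obtain ⟨e1, e2, e3, e4⟩ := ev i j τ h1 h2 h3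
      simp only [RExp.eval, e2, e3]
  · exact adds_subSquares hg fun i j τ h1 h2 h3 => by
      obtain ⟨e1, e2, e3, e4⟩ := ev i j τ h1 h2 h3
      simp only [RExp.eval, e2, e4]
  · exact adds_pairSum hg fun i j τ h1 h2 h3 => by
      obtain ⟨e1, e2, e3, e4⟩ := ev i j τ h1 h2 h3
      simp only [RExp.eval, RExp.eval_num, e1, e2, e3, e4, Nat.cast_ofNat]

/-- The program for the U-statistic of order four with the given edges. -/
noncomputable def progQuad {r d : ℕ} (X : EdgeKind 0 r) (Y : EdgeKind r d) : Cmd :=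
  Cmd.seq (Cmd.seq (quadSum X Y) (quadCorrection X Y))
    (Cmd.setR d (NExp.const 0) (RExp.div (RExp.load d (NExp.const 0)) (descExp 4)))

theorem runs_progQuad {r s n L : ℕ} (hr : 1 ≤ r) (hn : 4 ≤ n) (X : EdgeKind 0 r)
    (Y : EdgeKind r (r + s)) (hL : L = Nat.clog 2 (2 * n ^ 2))
    (IX : (Fin (0 + 4) → Fin r → ℝ) → Prop) (IY : (Fin (0 + 4) → Fin s → ℝ) → Prop)
    (z : Fin n → Obs r s)
    (hX : ∀ (a b c f : Fin n) w, ind (IX (tup (z a).1 (z b).1 (z c).1 (z f).1 w)) =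
      X.val (input z).real c a * X.val (input z).real c b * X.val (input z).real f a *
        X.val (input z).real f b)
    (hY : ∀ (a b c f : Fin n) w, ind (IY (tup (z a).2 (z b).2 (z c).2 (z f).2 w)) =
      Y.val (input z).real c a * Y.val (input z).real c b * Y.val (input z).real f a *
        Y.val (input z).real f b) :
    Runs (progQuad X Y) (input z) ((2 ^ L + 2) * (L + 1) ^ (r + s + (r + s) - 1))
      fun σ => σ.real (r + s) 0 = uStat 1 (Htau 0) IX IY n z := by
  rw [uStat_edges IX IY z _ _ hX hY, dsum_quad _ _ (X.val_sq _) (Y.val_sq _) (X.val_self _)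
    (Y.val_self _)]
  have hEL : 2 * n ^ 2 ≤ 2 ^ L := by rw [hL]; exact Nat.le_pow_clog (by norm_num) _
  have hg1 : (n + 1) * (n + 1) ≤ (2 ^ L + 2) * (L + 1) ^ (r + s + (r + s) - 1) := by
    have h1 : (n + 1) * (n + 1) ≤ 2 ^ L + 2 := by
      nlinarith
    exact h1.trans (Nat.le_mul_of_pos_right _ (Nat.one_le_pow _ _ (by omega)))
  have hB : Base (r + s) n (input z).real (input z) := by
    refine ⟨by simp [input], fun _ _ => rfl, fun x => ?_⟩
    have h1 : ¬ r + s + 3 < r := by omega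
    have h2 : ¬ r + s + 3 - r < s := by omega
    simp [input, h1, h2]
  refine Runs.seq ((((adds_quadSum X Y (by omega) (by omega) hL rfl).seq
    (adds_quadCorrection X Y (by omega) hg1)) _ hB).mono le_rfl ?_)
  rintro τ - ⟨hτ, h⟩
  refine Runs.setR (by nlinarith) ?_
  have i0 : (input z).real (r + s) 0 = 0 := by simp [input]
  rw [i0, zero_add] at h
  simp only [RExp.eval, NExp.eval, eval_descExp hτ.size hn, h, Mem.setR_real, and_self, if_true,
    mul_add (-4 : ℝ), Finset.sum_add_distrib, add_assoc]

theorem progQuad_computesInTime {r s : ℕ} (hr : 1 ≤ r) (X : EdgeKind 0 r)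
    (Y : EdgeKind r (r + s)) (IX : (Fin (0 + 4) → Fin r → ℝ) → Prop)
    (IY : (Fin (0 + 4) → Fin s → ℝ) → Prop)
    (hX : ∀ (n : ℕ) (z : Fin n → Obs r s) (a b c f : Fin n) w,
      ind (IX (tup (z a).1 (z b).1 (z c).1 (z f).1 w)) =
      X.val (input z).real c a * X.val (input z).real c b * X.val (input z).real f a *
        X.val (input z).real f b)
    (hY : ∀ (n : ℕ) (z : Fin n → Obs r s) (a b c f : Fin n) w,
      ind (IY (tup (z a).2 (z b).2 (z c).2 (z f).2 w)) =
      Y.val (input z).real c a * Y.val (input z).real c b * Y.val (input z).real f a *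
        Y.val (input z).real f b) :
    ComputesInTime r s 4 (progQuad X Y) (uStat 1 (Htau 0) IX IY)
      (fun n => (n : ℝ) ^ 2 * Real.logb 2 n ^ (2 * (r + s) - 1)) := by
  have e : 2 * (r + s) - 1 = r + s + (r + s) - 1 := by omega
  rw [e]
  exact computesInTime_of_runs
    (fun n => (2 ^ Nat.clog 2 (2 * n ^ 2) + 2) *
      (Nat.clog 2 (2 * n ^ 2) + 1) ^ (r + s + (r + s) - 1))
    (6 * (2 + (2 : ℕ)) ^ (r + s + (r + s) - 1)) (by positivity)
    (fun n hn => dominance_time_le hn rfl)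
    fun n hn z => runs_progQuad hr hn X Y rfl IX IY z (hX n z) (hY n z)

theorem exists_program_UP (r s : ℕ) (hr : 1 ≤ r) (hs : 1 ≤ s) :
    ∃ P : Cmd, ComputesInTime r s 4 P (UP r s)
      (fun n => (n : ℝ) ^ 2 * Real.logb 2 n ^ (2 * (r + s) - 1)) := by
  refine ⟨_, progQuad_computesInTime hr (edgeNotLe 0 r hr (Nat.zero_add r)) (edgeNotLe r s hs rfl)
    indP indP (fun n z a b c f w => ?_) fun n z a b c f w => ?_⟩
  · have e : ∀ i j : Fin n, (edgeNotLe 0 r hr (Nat.zero_add r)).val (input z).real i j =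
        ind (¬ (z i).1 ≤ (z j).1) := fun i j => by
      rw [ind_not]
      exact congrArg (1 - ·) (ind_congr ((holds_input z).le_fst i j))
    rw [e, e, e, e, ← ind_and, ← ind_and, ← ind_and, and_assoc, and_assoc]
    rfl
  · have e : ∀ i j : Fin n, (edgeNotLe r s hs rfl).val (input z).real i j =
        ind (¬ (z i).2 ≤ (z j).2) := fun i j => by
      rw [ind_not]
      exact congrArg (1 - ·) (ind_congr ((holds_input z).le_snd i j))
    rw [e, e, e, e, ← ind_and, ← ind_and, ← ind_and, and_assoc, and_assoc]
    rfl

theorem exists_program_UJ (r s : ℕ) (hr : 1 ≤ r) (hs : 1 ≤ s) :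
    ∃ P : Cmd, ComputesInTime r s 4 P (UJ r s)
      (fun n => (n : ℝ) ^ 2 * Real.logb 2 n ^ (2 * (r + s) - 1)) := by
  refine ⟨_, progQuad_computesInTime hr (edgeGt 0 r hr (Nat.zero_add r)) (edgeGt r s hs rfl)
    indJ indJ (fun n z a b c f w => ?_) fun n z a b c f w => ?_⟩
  · have e : ∀ i j : Fin n, (edgeGt 0 r hr (Nat.zero_add r)).val (input z).real i j =
        ind (StrongLT (z j).1 (z i).1) := fun i j =>
      ind_congr ((holds_input z).lt_fst j i)
    -- The edges are grouped by their larger end and `indJ` by its smaller end, so the two middle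
    -- factors change places.
    rw [e, e, e, e, mul_right_comm (ind (StrongLT (z a).1 (z c).1)), ← ind_and, ← ind_and,
      ← ind_and, and_assoc, and_assoc]
    rfl
  · have e : ∀ i j : Fin n, (edgeGt r s hs rfl).val (input z).real i j =
        ind (StrongLT (z j).2 (z i).2) := fun i j =>
      ind_congr ((holds_input z).lt_snd j i)
    rw [e, e, e, e, mul_right_comm (ind (StrongLT (z a).2 (z c).2)), ← ind_and, ← ind_and,
      ← ind_and, and_assoc, and_assoc]
    rfl

end RankCov
theorem mainTheorem9 (r s : ℕ) (hr : 1 ≤ r) (hs : 1 ≤ s) :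
    (∃ P : RankCov.Cmd, RankCov.ComputesInTime r s 5 P (RankCov.UD r s)
      (fun n => (n : ℝ) * Real.logb 2 n ^ (r + s - 1))) ∧
    (∃ P : RankCov.Cmd, RankCov.ComputesInTime r s (r + s + 4) P (RankCov.UR r s)
      (fun n => (n : ℝ) ^ (r + s))) ∧
    (∃ P : RankCov.Cmd, RankCov.ComputesInTime r s 4 P (RankCov.UP r s)
      (fun n => (n : ℝ) ^ 2 * Real.logb 2 n ^ (2 * (r + s) - 1))) ∧
    (∃ P : RankCov.Cmd, RankCov.ComputesInTime r s 4 P (RankCov.UJ r s)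
      (fun n => (n : ℝ) ^ 2 * Real.logb 2 n ^ (2 * (r + s) - 1))) ∧
    RankCov.ComputesInTime r s 5 (RankCov.naiveD r s) (RankCov.UD r s)
      (fun n => (n : ℝ) ^ 5) ∧
    RankCov.ComputesInTime r s (r + s + 4) (RankCov.naiveR r s) (RankCov.UR r s)
      (fun n => (n : ℝ) ^ (4 + (r + s))) ∧
    RankCov.ComputesInTime r s 4 (RankCov.naiveP r s) (RankCov.UP r s)
      (fun n => (n : ℝ) ^ 4) ∧
    RankCov.ComputesInTime r s 4 (RankCov.naiveJ r s) (RankCov.UJ r s)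
      (fun n => (n : ℝ) ^ 4) := by
  exact ⟨RankCov.exists_program_UD r s hr hs, RankCov.exists_program_UR r s hr hs,
    RankCov.exists_program_UP r s hr hs, RankCov.exists_program_UJ r s hr hs,
    RankCov.naiveD_computesInTime r s, RankCov.naiveR_computesInTime r s,
    RankCov.naiveP_computesInTime r s, RankCov.naiveJ_computesInTime r s⟩
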